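/- Let $G$ be a finite group with identity $e$, and let $\omega\colon G^3\to\mathbb{C}^\times$ be a normalized unitary $3$-cocycle: $|\omega(g,h,k)|=1$ for all $g,h,k$, $\omega(g,h,k)=1$ whenever one of $g,h,k$ is $e$, and $$\omega(h,k,l)\,\omega(g,hk,l)\,\omega(g,h,k)=\omega(gh,k,l)\,\omega(g,h,kl).$$ Put $$\theta_g(x,y)=\frac{\omega(g,x,y)\,\omega(x,y,(xy)^{-1}gxy)}{\omega(x,x^{-1}gx,y)},\qquad \gamma_x(h,l)=\frac{\omega(h,l,x)\,\omega(x,x^{-1}hx,x^{-1}lx)}{\omega(h,x,x^{-1}lx)}.$$ **The quasi-Hopf algebra $D^\omega G$.** Let $D^\omega G$ be the complex vector space with basis $\delta_g\bar x$ ($g,x\in G$), and with $$\delta_g\bar x\cdot\delta_h\bar y=\theta_g(x,y)\,\delta_{g,xhx^{-1}}\,\delta_g\overline{xy},\qquad 1=\sum_g\delta_g\bar e,$$ $$\Delta(\delta_g\bar x)=\sum_{hl=g}\gamma_x(h,l)\,\delta_h\bar x\otimes\delta_l\bar x,\qquad \varepsilon(\delta_g\bar x)=\delta_{g,e},$$ $$\Phi=\sum_{g,h,k}\omega(g,h,k)\,\delta_g\bar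 e\otimes\delta_h\bar e\otimes\delta_k\bar e,\qquad R=\sum_{g,h}\delta_g\bar e\otimes\delta_h\bar g,$$ $$S(\delta_h\bar g)=\theta_{h^{-1}}(g,g^{-1})^{-1}\gamma_g(h,h^{-1})^{-1}\,\delta_{g^{-1}h^{-1}g}\overline{g^{-1}},\qquad \alpha=1,\qquad \beta=\sum_g\omega(g,g^{-1},g)\,\delta_g\bar e .$$ This is a quasitriangular quasi-Hopf algebra, in the convention $(\Delta\otimes 1)\Delta(h)=\Phi\,(1\otimes\Delta)\Delta(h)\,\Phi^{-1}$ and $\Delta^{op}(h)R=R\Delta(h)$. **The category $\operatorname{Rep}(D^\omega G)$.** Objects are the finite-dimensional left $D^\omega G$-modules. The algebra acts on $V\otimes W$ through $\Delta$ and on $\mathbb{C}$ through $\varepsilon$; the associator $(V\otimes W)\otimes U\to V\otimes(W\otimes U)$ is the action of $\Phi^{-1}$; the unitors are those of vector spaces; the braiding $V\otimes W\to W\otimes V$ is the action of $R$ followed by the flip. The dual of $V$ is $V^*$ with $h$ acting by the transpose of $S(h)$, with evaluation $V^*\otimes V\to\mathbb{C}$, $f\otimes v\mapsto f(\alpha v)$,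 and coevaluation $1\mapsto\sum_i\beta v_i\otimes v^i$ for dual bases $(v_i)$, $(v^i)$. The pivotal structure $V\to V^{**}$ is $v\mapsto(\beta^{-1}v)^{**}$. The twist $\theta_V$ is the right partial trace of the self-braiding $c_{V,V}$ with respect to this pivotal structure. **The category $\mathcal{Z}(\mathsf{Vec}^{\omega^{-1}}G)^{bop}$.** $\mathsf{Vec}^{\omega^{-1}}G$ is the monoidal category of finite-dimensional $G$-graded complex vector spaces and degree-preserving linear maps, whose associator on homogeneous vectors of degrees $g,h,k$ is multiplication by $\omega(g,h,k)^{-1}$. The dual of $V$ is $V^*$ with $(V^*)_g=(V_{g^{-1}})^*$, with evaluation $f\otimes v\mapsto f(v)$ and coevaluation $1\mapsto\sum_i\sum_g\omega(g,g^{-1},g)(v_i)_g\otimes v^i$, where $(v_i)_g$ is the component of degree $g$; the pivotal structure $V\to V^{**}$ is $v\mapsto\omega(g,g^{-1},g)^{-1}v^{**}$ for $v$ of degree $g$. $\mathcal{Z}$ denotes the Drinfeld center: objects are pairs of an object $X$ and a half-braiding $X\otimes U\cong U\otimes X$ natural in $U$ and compatible with $\otimes$, and the braiding $c_{X,Y}$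 is the half-braiding of $X$ at $Y$. The superscript $bop$ means that the same monoidal category is taken with the reversed braiding $c_{Y,X}^{-1}\colon X\otimes Y\to Y\otimes X$; its twist is the right partial trace of the reversed self-braiding $c_{X,X}^{-1}$ with respect to the pivotal structure above. **Theorem.** 1. $\operatorname{Rep}(D^\omega G)$ and $\mathcal{Z}(\mathsf{Vec}^{\omega^{-1}}G)^{bop}$, with these braidings and twists, are ribbon fusion categories over $\mathbb{C}$: they are $\mathbb{C}$-linear, abelian and semisimple, with bilinear tensor product, finite-dimensional morphism spaces, finitely many simple objects up to isomorphism, simple unit and duals, every endomorphism of a simple object is a scalar, and the twist $\theta$ is a natural automorphism of the identity functor with $\theta_{X\otimes Y}=(\theta_X\otimes\theta_Y)\,c_{Y,X}\,c_{X,Y}$ and $\theta_{X^*}=(\theta_X)^*$. 2. They are equivalent as ribbon fusion categories: there is a $\mathbb{C}$-linear braided monoidal functor $F\colon\operatorname{Rep}(D^\omega G)\to\mathcal{Z}(\mathsf{Vec}^{\omega^{-1}}G)^{bop}$ that is an equivalence of categories and satisfies $F(\theta_V)=\theta_{F(V)}$ for all $V$. 3. They have the same $S$- and $T$-matrices up to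 reordering of the simple objects: there is a bijection $i\mapsto e(i)$ between the isomorphism classes of simple objects of $\operatorname{Rep}(D^\omega G)$ and those of $\mathcal{Z}(\mathsf{Vec}^{\omega^{-1}}G)^{bop}$ with $S_{e(i),e(j)}=S_{i,j}$ and $T_{e(i),e(j)}=T_{i,j}$ for all $i,j$. Here, for simple objects $X$ and $Y$ in the classes $i$ and $j$, $S_{i,j}$ is $\frac{1}{|G|}$ times the scalar by which the endomorphism of the unit object obtained as follows acts: apply the coevaluations $\mathbf{1}\to X\otimes X^*$ and $\mathbf{1}\to Y\otimes Y^*$, then the double braiding $c_{Y,X^*}c_{X^*,Y}$ of the two middle factors, then $\widetilde{\mathrm{ev}}_X\otimes\widetilde{\mathrm{ev}}_Y$ with $\widetilde{\mathrm{ev}}_X=\mathrm{ev}_X\circ c_{X,X^*}\circ(\theta_X\otimes 1)\colon X\otimes X^*\to\mathbf{1}$. $T$ is the diagonal matrix whose entry at $i$ is the scalar by which $\theta_X$ acts on $X$. -/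

import Mathlib

open CategoryTheory MonoidalCategory
open scoped TensorProduct

set_option linter.unusedSectionVars false
set_option linter.unusedSimpArgs false

/-- A normalized `3`-cocycle on `G` with values in `ℂˣ`. -/
structure NormalizedCocycle (G : Type*) [Group G] where
  toFun : G → G → G → ℂˣ
  cocycle : ∀ g h k l : G,
    toFun h k l * toFun g (h * k) l * toFun g h k = toFun (g * h) k l * toFun g h (k * l)
  one_left : ∀ g h : G, toFun 1 g h = 1
  one_mid : ∀ g h : G, toFun g 1 h = 1
  one_right : ∀ g h : G, toFun g h 1 = 1

namespace NormalizedCocycle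

variable {G : Type*} [Group G]

instance : CoeFun (NormalizedCocycle G) (fun _ => G → G → G → ℂˣ) := ⟨toFun⟩

attribute [simp] one_left one_mid one_right

/-- The pointwise inverse cocycle. -/
instance : Inv (NormalizedCocycle G) where
  inv ω :=
    { toFun := fun g h k => (ω g h k)⁻¹
      cocycle := fun g h k l => by
        have := ω.cocycle g h k l
        rw [← mul_inv, ← mul_inv, ← mul_inv, this]
      one_left := by simp
      one_mid := by simp
      one_right := by simp }

@[simp] theorem inv_apply (ω : NormalizedCocycle G) (g h k : G) : ω⁻¹ g h k = (ω g h k)⁻¹ := rfl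

/-- All values of the cocycle have absolute value one. -/
def IsUnitary (ω : NormalizedCocycle G) : Prop := ∀ g h k : G, ‖(ω g h k : ℂ)‖ = 1

variable (ω : NormalizedCocycle G)

/-- `θ_g(x, y) = ω(g, x, y) ω(x, y, (xy)⁻¹gxy) / ω(x, x⁻¹gx, y)`. -/
def θ (g x y : G) : ℂˣ :=
  ω g x y * ω x y ((x * y)⁻¹ * g * (x * y)) / ω x (x⁻¹ * g * x) y

/-- `γ_x(h, l) = ω(h, l, x) ω(x, x⁻¹hx, x⁻¹lx) / ω(h, x, x⁻¹lx)`. -/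
def γ (x h l : G) : ℂˣ :=
  ω h l x * ω x (x⁻¹ * h * x) (x⁻¹ * l * x) / ω h x (x⁻¹ * l * x)

@[simp] theorem θ_one_left (g y : G) : ω.θ g 1 y = 1 := by simp [θ]
@[simp] theorem θ_one_right (g x : G) : ω.θ g x 1 = 1 := by simp [θ]
@[simp] theorem θ_one (x y : G) : ω.θ 1 x y = 1 := by simp [θ]
@[simp] theorem γ_one (h l : G) : ω.γ 1 h l = 1 := by simp [γ]
@[simp] theorem γ_one_left (x l : G) : ω.γ x 1 l = 1 := by simp [γ]
@[simp] theorem γ_one_right (x h : G) : ω.γ x h 1 = 1 := by simp [γ]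

theorem cocycle_add (g h k l : G) : Additive.ofMul (ω h k l) + Additive.ofMul (ω g (h * k) l) +
    Additive.ofMul (ω g h k) = Additive.ofMul (ω (g * h) k l) + Additive.ofMul (ω g h (k * l)) := by
  simpa only [ofMul_mul] using congrArg Additive.ofMul (ω.cocycle g h k l)

theorem θ_cocycle (g x y z : G) :
    ω.θ g x y * ω.θ g (x * y) z = ω.θ g x (y * z) * ω.θ (x⁻¹ * g * x) y z := by
  have h1 := ω.cocycle_add g x y z
  have h2 := ω.cocycle_add x (x⁻¹ * g * x) y z
  have h3 := ω.cocycle_add x y ((x * y)⁻¹ * g * (x * y)) z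
  have h4 := ω.cocycle_add x y z ((x * y * z)⁻¹ * g * (x * y * z))
  apply Additive.ofMul.injective
  simp only [θ, ofMul_mul, ofMul_div, mul_inv_rev, mul_assoc, inv_mul_cancel_left,
    mul_inv_cancel_left] at h1 h2 h3 h4 ⊢
  linear_combination (norm := abel) h1 - h2 + h3 - h4

theorem γ_cocycle (x g h k : G) :
    ω.γ x g h * ω.γ x (g * h) k * ω (x⁻¹ * g * x) (x⁻¹ * h * x) (x⁻¹ * k * x) =
      ω.γ x h k * ω.γ x g (h * k) * ω g h k := by
  have h1 := ω.cocycle_add g h k x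
  have h2 := ω.cocycle_add g h x (x⁻¹ * k * x)
  have h3 := ω.cocycle_add g x (x⁻¹ * h * x) (x⁻¹ * k * x)
  have h4 := ω.cocycle_add x (x⁻¹ * g * x) (x⁻¹ * h * x) (x⁻¹ * k * x)
  apply Additive.ofMul.injective
  simp only [γ, ofMul_mul, ofMul_div, mul_inv_rev, mul_assoc, inv_mul_cancel_left,
    mul_inv_cancel_left] at h1 h2 h3 h4 ⊢
  linear_combination (norm := abel) -h1 + h2 - h3 + h4

theorem θ_γ (g h x y : G) :
    ω.θ g x y * ω.θ h x y * ω.γ x g h * ω.γ y (x⁻¹ * g * x) (x⁻¹ * h * x) =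
      ω.θ (g * h) x y * ω.γ (x * y) g h := by
  have h1 := ω.cocycle_add g h x y
  have h2 := ω.cocycle_add g x (x⁻¹ * h * x) y
  have h3 := ω.cocycle_add g x y ((x * y)⁻¹ * h * (x * y))
  have h4 := ω.cocycle_add x (x⁻¹ * g * x) (x⁻¹ * h * x) y
  have h5 := ω.cocycle_add x (x⁻¹ * g * x) y ((x * y)⁻¹ * h * (x * y))
  have h6 := ω.cocycle_add x y ((x * y)⁻¹ * g * (x * y)) ((x * y)⁻¹ * h * (x * y))
  apply Additive.ofMul.injective
  simp only [θ, γ, ofMul_mul, ofMul_div, mul_inv_rev, mul_assoc, inv_mul_cancel_left,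
    mul_inv_cancel_left] at h1 h2 h3 h4 h5 h6 ⊢
  linear_combination (norm := abel) h1 - h2 + h3 + h4 - h5 + h6

theorem apply_inv (g : G) : ω g⁻¹ g g⁻¹ * ω g g⁻¹ g = 1 := by
  have h := ω.cocycle g g⁻¹ g g⁻¹
  simpa using h

end NormalizedCocycle

/-! ### Gradings of vector spaces by a finite group -/

/-- A grading of the vector space `V` by the finite group `G`, encoded by the projections onto the
homogeneous components: the component of degree `g` is the range of `proj g`. -/
structure Grading (G : Type*) [Fintype G] (V : Type*) [AddCommGroup V] [Module ℂ V] where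
  proj : G → V →ₗ[ℂ] V
  proj_self : ∀ (g : G) (v : V), proj g (proj g v) = proj g v
  proj_ne : ∀ (g h : G) (v : V), g ≠ h → proj g (proj h v) = 0
  sum_proj : ∀ v : V, ∑ g : G, proj g v = v

namespace Grading

variable {G : Type*} [Fintype G]
variable {V W U X M : Type*} [AddCommGroup V] [Module ℂ V] [AddCommGroup W] [Module ℂ W]
  [AddCommGroup U] [Module ℂ U] [AddCommGroup X] [Module ℂ X] [AddCommGroup M] [Module ℂ M]

attribute [simp] proj_self sum_proj

theorem proj_proj [DecidableEq G] (p : Grading G V) (g h : G) (v : V) :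
    p.proj g (p.proj h v) = if g = h then p.proj h v else 0 := by
  split_ifs with hgh
  · subst hgh; simp
  · exact p.proj_ne g h v hgh

/-- The homogeneous components form an internal direct sum decomposition. -/
theorem isInternal [DecidableEq G] (p : Grading G V) :
    DirectSum.IsInternal (fun g : G => LinearMap.range (p.proj g)) := by
  let d : V →ₗ[ℂ] DirectSum G (fun g => LinearMap.range (p.proj g)) :=
    ∑ g : G, (DirectSum.lof ℂ G (fun g => LinearMap.range (p.proj g)) g) ∘ₗ
      (p.proj g).rangeRestrict
  refine @DirectSum.Decomposition.isInternal _ _ _ _ _ _ _ _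
    (DirectSum.Decomposition.ofLinearMap _ d ?_ ?_)
  · ext v
    simp [d]
  · refine DirectSum.linearMap_ext _ fun i => ?_
    ext ⟨x, y, rfl⟩ : 1
    simp only [LinearMap.comp_apply, DirectSum.coeLinearMap_lof, LinearMap.id_apply, d,
      LinearMap.sum_apply]
    rw [Finset.sum_eq_single i]
    · congr 1
      exact Subtype.ext (p.proj_self i y)
    · intro j _ hj
      have : (p.proj j).rangeRestrict (p.proj i y) = 0 := Subtype.ext (p.proj_ne j i y hj)
      rw [this, map_zero]
    · simp

theorem lin_ext (p : Grading G V) {f g : V →ₗ[ℂ] M}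
    (h : ∀ (a : G) (v : V), f (p.proj a v) = g (p.proj a v)) : f = g := by
  ext v
  rw [← p.sum_proj v, map_sum, map_sum]
  exact Finset.sum_congr rfl fun a _ => h a v

theorem lin_ext₂ (p : Grading G V) (q : Grading G W) {f g : V ⊗[ℂ] W →ₗ[ℂ] M}
    (h : ∀ (a b : G) (v : V) (w : W),
      f (p.proj a v ⊗ₜ q.proj b w) = g (p.proj a v ⊗ₜ q.proj b w)) : f = g :=
  TensorProduct.ext <| p.lin_ext fun a v => q.lin_ext fun b w => h a b v w

theorem lin_ext₃ (p : Grading G V) (q : Grading G W) (r : Grading G U)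
    {f g : (V ⊗[ℂ] W) ⊗[ℂ] U →ₗ[ℂ] M}
    (h : ∀ (a b c : G) (v : V) (w : W) (u : U),
      f ((p.proj a v ⊗ₜ q.proj b w) ⊗ₜ r.proj c u) =
        g ((p.proj a v ⊗ₜ q.proj b w) ⊗ₜ r.proj c u)) : f = g :=
  TensorProduct.ext <| lin_ext₂ p q fun a b v w => r.lin_ext fun c u => h a b c v w u

theorem lin_ext₃' (p : Grading G V) (q : Grading G W) (r : Grading G U)
    {f g : V ⊗[ℂ] (W ⊗[ℂ] U) →ₗ[ℂ] M}
    (h : ∀ (a b c : G) (v : V) (w : W) (u : U),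
      f (p.proj a v ⊗ₜ (q.proj b w ⊗ₜ r.proj c u)) =
        g (p.proj a v ⊗ₜ (q.proj b w ⊗ₜ r.proj c u))) : f = g :=
  TensorProduct.ext <| p.lin_ext fun a v => lin_ext₂ q r fun b c w u => h a b c v w u

theorem lin_ext₄ (p : Grading G V) (q : Grading G W) (r : Grading G U) (s : Grading G X)
    {f g : ((V ⊗[ℂ] W) ⊗[ℂ] U) ⊗[ℂ] X →ₗ[ℂ] M}
    (h : ∀ (a b c d : G) (v : V) (w : W) (u : U) (x : X),
      f (((p.proj a v ⊗ₜ q.proj b w) ⊗ₜ r.proj c u) ⊗ₜ s.proj d x) =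
        g (((p.proj a v ⊗ₜ q.proj b w) ⊗ₜ r.proj c u) ⊗ₜ s.proj d x)) : f = g :=
  TensorProduct.ext <| lin_ext₃ p q r fun a b c v w u => s.lin_ext fun d x => h a b c d v w u x

/-- Multiplication of the component of degree `(g, h, k)` by `f g h k`. -/
noncomputable def scale (p : Grading G V) (q : Grading G W) (r : Grading G U)
    (f : G → G → G → ℂˣ) : V ⊗[ℂ] (W ⊗[ℂ] U) →ₗ[ℂ] V ⊗[ℂ] (W ⊗[ℂ] U) :=
  ∑ g : G, ∑ h : G, ∑ k : G,
    (f g h k : ℂ) • TensorProduct.map (p.proj g) (TensorProduct.map (q.proj h) (r.proj k))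

theorem scale_tmul (p : Grading G V) (q : Grading G W) (r : Grading G U) (f : G → G → G → ℂˣ)
    (a b c : G) (v : V) (w : W) (u : U) :
    scale p q r f (p.proj a v ⊗ₜ (q.proj b w ⊗ₜ r.proj c u)) =
      (f a b c : ℂ) • (p.proj a v ⊗ₜ (q.proj b w ⊗ₜ r.proj c u)) := by
  classical
  simp only [scale, LinearMap.sum_apply, LinearMap.smul_apply, TensorProduct.map_tmul, proj_proj]
  rw [Finset.sum_eq_single a, Finset.sum_eq_single b, Finset.sum_eq_single c]
  · simp
  · intro x _ hx; simp [hx]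
  · simp
  · intro x _ hx; simp [hx]
  · simp
  · intro x _ hx; simp [hx]
  · simp

variable [Group G]

/-- The projection of `V ⊗ W` onto the component of degree `g`, which is `⨁ₕ Vₕ ⊗ W_{h⁻¹g}`. -/
noncomputable def tensorProj (p : Grading G V) (q : Grading G W) (g : G) :
    V ⊗[ℂ] W →ₗ[ℂ] V ⊗[ℂ] W :=
  ∑ h : G, TensorProduct.map (p.proj h) (q.proj (h⁻¹ * g))

theorem tensorProj_tmul [DecidableEq G] (p : Grading G V) (q : Grading G W) (g a b : G)
    (v : V) (w : W) :
    tensorProj p q g (p.proj a v ⊗ₜ q.proj b w) =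
      if g = a * b then p.proj a v ⊗ₜ q.proj b w else 0 := by
  simp only [tensorProj, LinearMap.sum_apply, TensorProduct.map_tmul, proj_proj]
  rw [Finset.sum_eq_single a]
  · by_cases h : g = a * b
    · simp [h]
    · simp [h, inv_mul_eq_iff_eq_mul]
  · intro h _ hh
    simp [hh]
  · simp

/-- The grading of `V ⊗ W`: the component of degree `g` is `⨁ₕ Vₕ ⊗ W_{h⁻¹g}`. -/
noncomputable def tensor (p : Grading G V) (q : Grading G W) : Grading G (V ⊗[ℂ] W) where
  proj := tensorProj p q
  proj_self g := by
    classical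
    refine LinearMap.congr_fun (f := tensorProj p q g ∘ₗ tensorProj p q g) (lin_ext₂ p q ?_)
    intro a b v w
    simp only [LinearMap.comp_apply, tensorProj_tmul]
    split_ifs with h <;> simp [tensorProj_tmul, h]
  proj_ne g h x hgh := by
    classical
    refine LinearMap.congr_fun (f := tensorProj p q g ∘ₗ tensorProj p q h) (g := 0)
      (lin_ext₂ p q ?_) x
    intro a b v w
    simp only [LinearMap.comp_apply, tensorProj_tmul]
    split_ifs with h'
    · subst h'; simp [tensorProj_tmul, hgh]
    · simp
  sum_proj x := by
    classical
    rw [← LinearMap.sum_apply]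
    refine LinearMap.congr_fun (g := LinearMap.id) (lin_ext₂ p q ?_) x
    intro a b v w
    simp [LinearMap.sum_apply, tensorProj_tmul]

theorem tensor_proj [DecidableEq G] (p : Grading G V) (q : Grading G W) (g a b : G)
    (v : V) (w : W) :
    (tensor p q).proj g (p.proj a v ⊗ₜ q.proj b w) =
      if g = a * b then p.proj a v ⊗ₜ q.proj b w else 0 := tensorProj_tmul p q g a b v w

theorem tensor_proj_mul (p : Grading G V) (q : Grading G W) (a b : G) (v : V) (w : W) :
    (tensor p q).proj (a * b) (p.proj a v ⊗ₜ q.proj b w) = p.proj a v ⊗ₜ q.proj b w := by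
  classical
  rw [tensor_proj, if_pos rfl]

open scoped Classical in
/-- The grading of `ℂ` concentrated in degree `k`. -/
noncomputable def single (k : G) : Grading G ℂ where
  proj g := if g = k then LinearMap.id else 0
  proj_self g v := by split_ifs <;> simp
  proj_ne g h v hgh := by
    by_cases hg : g = k
    · subst hg; simp [hgh.symm]
    · simp [hg]
  sum_proj v := by
    simp [← LinearMap.sum_apply]

theorem single_proj [DecidableEq G] (k g : G) (c : ℂ) :
    (single k).proj g c = if g = k then c else 0 := by
  by_cases h : g = k <;> simp [single, h]

theorem single_proj_self (k : G) (c : ℂ) : (single k).proj k c = c := by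
  simp [single]

open scoped Classical in
/-- The dual grading: the component of degree `g` is the dual of the component of degree `g⁻¹`. -/
noncomputable def dual (p : Grading G V) : Grading G (Module.Dual ℂ V) where
  proj g := Module.Dual.transpose (p.proj g⁻¹)
  proj_self g f := by ext v; simp [Module.Dual.transpose_apply]
  proj_ne g h f hgh := by
    ext v
    simp [Module.Dual.transpose_apply, p.proj_ne h⁻¹ g⁻¹ v (fun e => hgh (inv_injective e).symm)]
  sum_proj f := by
    ext v
    rw [LinearMap.sum_apply, Fintype.sum_equiv (Equiv.inv G) _ (fun g => f (p.proj g v))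
      (fun g => by simp [Module.Dual.transpose_apply]), ← map_sum, p.sum_proj]

/-- The associator `(v ⊗ w) ⊗ u ↦ f(g, h, k) v ⊗ (w ⊗ u)` for `v`, `w`, `u` homogeneous of degrees
`g`, `h`, `k`. -/
noncomputable def assoc (p : Grading G V) (q : Grading G W) (r : Grading G U)
    (f : G → G → G → ℂˣ) : (V ⊗[ℂ] W) ⊗[ℂ] U ≃ₗ[ℂ] V ⊗[ℂ] (W ⊗[ℂ] U) :=
  LinearEquiv.ofLinearMap (scale p q r f ∘ₗ (TensorProduct.assoc ℂ V W U).toLinearMap)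
    ((TensorProduct.assoc ℂ V W U).symm.toLinearMap ∘ₗ scale p q r (fun a b c => (f a b c)⁻¹))
    (lin_ext₃' p q r fun a b c v w u => by simp [scale_tmul, smul_smul])
    (lin_ext₃ p q r fun a b c v w u => by simp [scale_tmul, smul_smul])

theorem assoc_tmul (p : Grading G V) (q : Grading G W) (r : Grading G U) (f : G → G → G → ℂˣ)
    (a b c : G) (v : V) (w : W) (u : U) :
    assoc p q r f ((p.proj a v ⊗ₜ q.proj b w) ⊗ₜ r.proj c u) =
      (f a b c : ℂ) • (p.proj a v ⊗ₜ (q.proj b w ⊗ₜ r.proj c u)) := by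
  simp [assoc, scale_tmul]

theorem assoc_symm_tmul (p : Grading G V) (q : Grading G W) (r : Grading G U)
    (f : G → G → G → ℂˣ) (a b c : G) (v : V) (w : W) (u : U) :
    (assoc p q r f).symm (p.proj a v ⊗ₜ (q.proj b w ⊗ₜ r.proj c u)) =
      ((f a b c)⁻¹ : ℂ) • ((p.proj a v ⊗ₜ q.proj b w) ⊗ₜ r.proj c u) := by
  simp [assoc, scale_tmul]

end Grading

/-! ### The category of graded vector spaces with associator given by a cocycle -/

/-- A finite-dimensional `G`-graded vector space, as an object of the category whose associator is
given by `ω`. -/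
structure VecG {G : Type*} [Group G] [Fintype G] (ω : NormalizedCocycle G) where
  carrier : Type
  [addCommGroup : AddCommGroup carrier]
  [module : Module ℂ carrier]
  [finite : Module.Finite ℂ carrier]
  grading : Grading G carrier

namespace VecG

variable {G : Type*} [Group G] [Fintype G] {ω : NormalizedCocycle G}

attribute [instance] addCommGroup module finite

instance : CoeSort (VecG ω) Type := ⟨carrier⟩

/-- A degree-preserving linear map. -/
@[ext]
structure Hom (V W : VecG ω) where
  toLin : V →ₗ[ℂ] W
  comm : ∀ (g : G) (v : V), toLin (V.grading.proj g v) = W.grading.proj g (toLin v)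

attribute [simp] Hom.comm

instance : Category (VecG ω) where
  Hom V W := Hom V W
  id V := ⟨LinearMap.id, fun _ _ => rfl⟩
  comp f g := ⟨g.toLin ∘ₗ f.toLin, fun _ _ => by simp⟩

@[simp] theorem id_toLin (V : VecG ω) : Hom.toLin (𝟙 V) = LinearMap.id := rfl
@[simp] theorem comp_toLin {V W U : VecG ω} (f : V ⟶ W) (g : W ⟶ U) :
    Hom.toLin (f ≫ g) = Hom.toLin g ∘ₗ Hom.toLin f := rfl

@[ext] theorem hom_ext {V W : VecG ω} {f g : V ⟶ W} (h : Hom.toLin f = Hom.toLin g) : f = g :=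
  Hom.ext h

instance (V W : VecG ω) : Add (V ⟶ W) :=
  ⟨fun f g => ⟨Hom.toLin f + Hom.toLin g, fun _ _ => by simp⟩⟩
instance (V W : VecG ω) : Zero (V ⟶ W) := ⟨⟨0, fun _ _ => by simp⟩⟩
instance (V W : VecG ω) : Neg (V ⟶ W) := ⟨fun f => ⟨-Hom.toLin f, fun _ _ => by simp⟩⟩
instance (V W : VecG ω) : Sub (V ⟶ W) :=
  ⟨fun f g => ⟨Hom.toLin f - Hom.toLin g, fun _ _ => by simp⟩⟩
instance (V W : VecG ω) : SMul ℕ (V ⟶ W) := ⟨fun c f => ⟨c • Hom.toLin f, fun _ _ => by simp⟩⟩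
instance (V W : VecG ω) : SMul ℤ (V ⟶ W) := ⟨fun c f => ⟨c • Hom.toLin f, fun _ _ => by simp⟩⟩
instance (V W : VecG ω) : SMul ℂ (V ⟶ W) := ⟨fun c f => ⟨c • Hom.toLin f, fun _ _ => by simp⟩⟩

instance (V W : VecG ω) : AddCommGroup (V ⟶ W) :=
  Function.Injective.addCommGroup (fun f : V ⟶ W => Hom.toLin f) (fun _ _ h => Hom.ext h)
    rfl (fun _ _ => rfl) (fun _ => rfl) (fun _ _ => rfl) (fun _ _ => rfl) (fun _ _ => rfl)

@[simp] theorem add_toLin {V W : VecG ω} (f g : V ⟶ W) :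
    Hom.toLin (f + g) = Hom.toLin f + Hom.toLin g := rfl

instance (V W : VecG ω) : Module ℂ (V ⟶ W) :=
  Function.Injective.module ℂ (⟨⟨fun f : V ⟶ W => Hom.toLin f, rfl⟩, fun _ _ => rfl⟩ :
    (V ⟶ W) →+ (V →ₗ[ℂ] W)) (fun _ _ h => Hom.ext h) (fun _ _ => rfl)

@[simp] theorem smul_toLin {V W : VecG ω} (c : ℂ) (f : V ⟶ W) :
    Hom.toLin (c • f) = c • Hom.toLin f := rfl

instance : Preadditive (VecG ω) where
  add_comp _ _ _ f f' g := by ext v; simp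
  comp_add _ _ _ f g g' := by ext v; simp

instance : Linear ℂ (VecG ω) where
  smul_comp _ _ _ r f g := by ext v; simp
  comp_smul _ _ _ f r g := by ext v; simp

/-- An isomorphism from a degree-preserving linear equivalence. -/
def isoMk {V W : VecG ω} (e : V ≃ₗ[ℂ] W)
    (h : ∀ (g : G) (v : V), e (V.grading.proj g v) = W.grading.proj g (e v)) : V ≅ W where
  hom := ⟨e.toLinearMap, h⟩
  inv := ⟨e.symm.toLinearMap, fun g w => by
    apply e.injective
    simp [h]⟩
  hom_inv_id := by ext v; simp
  inv_hom_id := by ext v; simp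

/-- The tensor product of graded vector spaces. -/
noncomputable def tensor (V W : VecG ω) : VecG ω where
  carrier := V ⊗[ℂ] W
  grading := V.grading.tensor W.grading

/-- The vector space `ℂ` in degree `k`. -/
noncomputable def single (k : G) : VecG ω where
  carrier := ℂ
  grading := Grading.single k

/-- The tensor product of degree-preserving maps. -/
noncomputable def tensorMap {V V' W W' : VecG ω} (f : V ⟶ V') (g : W ⟶ W') :
    tensor V W ⟶ tensor V' W' where
  toLin := TensorProduct.map (Hom.toLin f) (Hom.toLin g)
  comm k := by
    classical
    refine LinearMap.congr_fun (f := TensorProduct.map (Hom.toLin f) (Hom.toLin g) ∘ₗ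
      (V.grading.tensor W.grading).proj k) (g := (V'.grading.tensor W'.grading).proj k ∘ₗ
        TensorProduct.map (Hom.toLin f) (Hom.toLin g)) (Grading.lin_ext₂ V.grading W.grading ?_)
    intro a b v w
    simp only [LinearMap.comp_apply, Grading.tensor_proj, TensorProduct.map_tmul, Hom.comm]
    split_ifs <;> simp

/-- The associator, see `Grading.assoc`. -/
noncomputable def assoc (V W U : VecG ω) : tensor (tensor V W) U ≅ tensor V (tensor W U) :=
  isoMk (Grading.assoc V.grading W.grading U.grading ω) fun g => by
    classical
    refine LinearMap.congr_fun
      (f := (Grading.assoc V.grading W.grading U.grading ω).toLinearMap ∘ₗ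
        ((V.grading.tensor W.grading).tensor U.grading).proj g)
      (g := (V.grading.tensor (W.grading.tensor U.grading)).proj g ∘ₗ
        (Grading.assoc V.grading W.grading U.grading ω).toLinearMap)
      (Grading.lin_ext₃ V.grading W.grading U.grading ?_)
    intro a b c v w u
    have h1 := Grading.tensor_proj (V.grading.tensor W.grading) U.grading g (a * b) c
      (V.grading.proj a v ⊗ₜ W.grading.proj b w) u
    have h2 := Grading.tensor_proj V.grading (W.grading.tensor U.grading) g a (b * c) v
      (W.grading.proj b w ⊗ₜ U.grading.proj c u)
    simp only [Grading.tensor_proj_mul] at h1 h2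
    simp only [LinearMap.comp_apply, h1, LinearEquiv.coe_coe, Grading.assoc_tmul, map_smul, h2,
      mul_assoc]
    split_ifs
    · simp [Grading.assoc_tmul]
    · simp

theorem single_lin_ext {M V : Type*} [AddCommGroup M] [Module ℂ M] [AddCommGroup V] [Module ℂ V]
    (p : Grading G V) {f g : ℂ ⊗[ℂ] V →ₗ[ℂ] M}
    (h : ∀ (a : G) (v : V), f (1 ⊗ₜ p.proj a v) = g (1 ⊗ₜ p.proj a v)) : f = g := by
  apply TensorProduct.ext
  ext : 1
  exact p.lin_ext h

theorem lin_single_ext {M V : Type*} [AddCommGroup M] [Module ℂ M] [AddCommGroup V] [Module ℂ V]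
    (p : Grading G V) {f g : V ⊗[ℂ] ℂ →ₗ[ℂ] M}
    (h : ∀ (a : G) (v : V), f (p.proj a v ⊗ₜ 1) = g (p.proj a v ⊗ₜ 1)) : f = g := by
  apply TensorProduct.ext
  refine p.lin_ext fun a v => ?_
  ext : 1
  exact h a v

noncomputable def leftUnitor (V : VecG ω) : tensor (single 1) V ≅ V :=
  isoMk (TensorProduct.lid ℂ V) fun g => by
    classical
    refine LinearMap.congr_fun (f := (TensorProduct.lid ℂ V).toLinearMap ∘ₗ
      ((Grading.single 1).tensor V.grading).proj g)
      (g := V.grading.proj g ∘ₗ (TensorProduct.lid ℂ V).toLinearMap)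
      (single_lin_ext V.grading fun a v => ?_)
    have h := Grading.tensor_proj (Grading.single 1) V.grading g 1 a (1 : ℂ) v
    rw [Grading.single_proj_self] at h
    simp only [LinearMap.comp_apply, h, one_mul]
    simp only [LinearEquiv.coe_coe, TensorProduct.lid_tmul, one_smul, Grading.proj_proj]
    split_ifs <;> simp

noncomputable def rightUnitor (V : VecG ω) : tensor V (single 1) ≅ V :=
  isoMk (TensorProduct.rid ℂ V) fun g => by
    classical
    refine LinearMap.congr_fun (f := (TensorProduct.rid ℂ V).toLinearMap ∘ₗ
      (V.grading.tensor (Grading.single 1)).proj g)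
      (g := V.grading.proj g ∘ₗ (TensorProduct.rid ℂ V).toLinearMap)
      (lin_single_ext V.grading fun a v => ?_)
    have h := Grading.tensor_proj V.grading (Grading.single 1) g a 1 v (1 : ℂ)
    rw [Grading.single_proj_self] at h
    simp only [LinearMap.comp_apply, h, mul_one]
    simp only [LinearEquiv.coe_coe, TensorProduct.rid_tmul, one_smul, Grading.proj_proj]
    split_ifs <;> simp

theorem pentagon_aux {V W U X : Type*} [AddCommGroup V] [Module ℂ V] [AddCommGroup W]
    [Module ℂ W] [AddCommGroup U] [Module ℂ U] [AddCommGroup X] [Module ℂ X]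
    (p : Grading G V) (q : Grading G W) (r : Grading G U) (s : Grading G X) :
    TensorProduct.map LinearMap.id (Grading.assoc q r s ω).toLinearMap ∘ₗ
      (Grading.assoc p (q.tensor r) s ω).toLinearMap ∘ₗ
        TensorProduct.map (Grading.assoc p q r ω).toLinearMap LinearMap.id =
    (Grading.assoc p q (r.tensor s) ω).toLinearMap ∘ₗ
      (Grading.assoc (p.tensor q) r s ω).toLinearMap := by
  refine Grading.lin_ext₄ p q r s fun a b c d v w u x => ?_
  have h1 := Grading.assoc_tmul p (q.tensor r) s ω a (b * c) d v (q.proj b w ⊗ₜ r.proj c u) x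
  have h2 := Grading.assoc_tmul (p.tensor q) r s ω (a * b) c d (p.proj a v ⊗ₜ q.proj b w) u x
  have h3 := Grading.assoc_tmul p q (r.tensor s) ω a b (c * d) v w (r.proj c u ⊗ₜ s.proj d x)
  rw [Grading.tensor_proj_mul] at h1 h2 h3
  simp only [LinearMap.comp_apply, LinearEquiv.coe_coe, Grading.assoc_tmul, h1, h2, h3, map_smul,
    LinearMap.id_apply, TensorProduct.map_tmul, ← TensorProduct.smul_tmul', smul_smul,
    TensorProduct.tmul_smul]
  congr 1
  have := congrArg Units.val (ω.cocycle a b c d)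
  push_cast at this
  linear_combination this

noncomputable instance : MonoidalCategoryStruct (VecG ω) where
  tensorObj := tensor
  tensorHom := tensorMap
  whiskerLeft V _ _ f := tensorMap (𝟙 V) f
  whiskerRight f W := tensorMap f (𝟙 W)
  tensorUnit := single 1
  associator := assoc
  leftUnitor := leftUnitor
  rightUnitor := rightUnitor

/-- The monoidal category of finite-dimensional `G`-graded vector spaces with associator `ω`. -/
noncomputable instance : MonoidalCategory (VecG ω) := MonoidalCategory.ofTensorHom
  (id_tensorHom_id := fun V W => by
    apply hom_ext; exact TensorProduct.map_id)
  (tensorHom_comp_tensorHom := fun f₁ f₂ g₁ g₂ => by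
    apply hom_ext; exact (TensorProduct.map_comp _ _ _ _).symm)
  (associator_naturality := fun {V W U V' W' U'} f g h => by
    apply hom_ext
    change (Grading.assoc V'.grading W'.grading U'.grading ω).toLinearMap ∘ₗ
      TensorProduct.map (TensorProduct.map (Hom.toLin f) (Hom.toLin g)) (Hom.toLin h) =
      TensorProduct.map (Hom.toLin f) (TensorProduct.map (Hom.toLin g) (Hom.toLin h)) ∘ₗ
      (Grading.assoc V.grading W.grading U.grading ω).toLinearMap
    refine Grading.lin_ext₃ V.grading W.grading U.grading fun a b c v w u => ?_
    simp [Grading.assoc_tmul])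
  (leftUnitor_naturality := fun {V W} f => by
    apply hom_ext
    change (TensorProduct.lid ℂ W).toLinearMap ∘ₗ TensorProduct.map LinearMap.id (Hom.toLin f) =
      Hom.toLin f ∘ₗ (TensorProduct.lid ℂ V).toLinearMap
    ext; simp)
  (rightUnitor_naturality := fun {V W} f => by
    apply hom_ext
    change (TensorProduct.rid ℂ W).toLinearMap ∘ₗ TensorProduct.map (Hom.toLin f) LinearMap.id =
      Hom.toLin f ∘ₗ (TensorProduct.rid ℂ V).toLinearMap
    ext; simp)
  (pentagon := fun V W U X => by
    apply hom_ext
    exact pentagon_aux V.grading W.grading U.grading X.grading)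
  (triangle := fun V W => by
    apply hom_ext
    change TensorProduct.map LinearMap.id (TensorProduct.lid ℂ W).toLinearMap ∘ₗ
      (Grading.assoc V.grading (Grading.single 1) W.grading ω).toLinearMap =
      TensorProduct.map (TensorProduct.rid ℂ V).toLinearMap LinearMap.id
    apply TensorProduct.ext
    refine lin_single_ext V.grading fun a v => Grading.lin_ext W.grading fun b w => ?_
    have h := Grading.assoc_tmul V.grading (Grading.single 1) W.grading ω a 1 b v (1 : ℂ) w
    rw [Grading.single_proj_self] at h
    simp [h])

end VecG

/-! ### Quasitriangular quasi-Hopf algebras -/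

section Legs

variable (H : Type*) [Ring H] [Algebra ℂ H]

/-- The algebra `H ⊗ (H ⊗ H)`. -/
abbrev Tensor₃ := H ⊗[ℂ] (H ⊗[ℂ] H)

/-- The algebra `H ⊗ (H ⊗ (H ⊗ H))`. -/
abbrev Tensor₄ := H ⊗[ℂ] (H ⊗[ℂ] (H ⊗[ℂ] H))

variable {H}

/-- `x₁ ⊗ x₂ ⊗ x₃ ↦ x₂ ⊗ x₁ ⊗ x₃`. -/
noncomputable def swap₁₂ : Tensor₃ H ≃ₐ[ℂ] Tensor₃ H := Algebra.TensorProduct.leftComm ℂ H H H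

/-- `x₁ ⊗ x₂ ⊗ x₃ ↦ x₁ ⊗ x₃ ⊗ x₂`. -/
noncomputable def swap₂₃ : Tensor₃ H ≃ₐ[ℂ] Tensor₃ H :=
  Algebra.TensorProduct.congr AlgEquiv.refl (Algebra.TensorProduct.comm ℂ H H)

/-- `a ⊗ b ↦ a ⊗ b ⊗ 1`. -/
noncomputable def leg₁₂ (x : H ⊗[ℂ] H) : Tensor₃ H :=
  Algebra.TensorProduct.assoc ℂ ℂ ℂ H H H (x ⊗ₜ 1)

/-- `a ⊗ b ↦ 1 ⊗ a ⊗ b`. -/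
noncomputable def leg₂₃ (x : H ⊗[ℂ] H) : Tensor₃ H := 1 ⊗ₜ x

/-- `a ⊗ b ↦ a ⊗ 1 ⊗ b`. -/
noncomputable def leg₁₃ (x : H ⊗[ℂ] H) : Tensor₃ H := swap₂₃ (leg₁₂ x)

end Legs

/-- A quasitriangular quasi-Hopf algebra over `ℂ`, in the convention
`(Δ ⊗ 1)(Δ(h)) = Φ (1 ⊗ Δ)(Δ(h)) Φ⁻¹`. -/
class QuasiHopf (H : Type*) [Ring H] [Algebra ℂ H] where
  /-- the comultiplication `Δ` -/
  comul : H →ₐ[ℂ] H ⊗[ℂ] H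
  /-- the counit `ε` -/
  counit : H →ₐ[ℂ] ℂ
  /-- the coassociator `Φ` -/
  Φ : (Tensor₃ H)ˣ
  /-- the antipode `S` -/
  antipode : H →ₗ[ℂ] H
  /-- the element `α` -/
  α : H
  /-- the element `β` -/
  β : H
  /-- the universal `R`-matrix -/
  R : (H ⊗[ℂ] H)ˣ
  coassoc : ∀ h : H,
    Algebra.TensorProduct.assoc ℂ ℂ ℂ H H H
        (Algebra.TensorProduct.map comul (AlgHom.id ℂ H) (comul h)) =
      Φ * Algebra.TensorProduct.map (AlgHom.id ℂ H) comul (comul h) * (↑Φ⁻¹ : Tensor₃ H)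
  counit_left : ∀ h : H, Algebra.TensorProduct.lid ℂ H
    (Algebra.TensorProduct.map counit (AlgHom.id ℂ H) (comul h)) = h
  counit_right : ∀ h : H, Algebra.TensorProduct.rid ℂ ℂ H
    (Algebra.TensorProduct.map (AlgHom.id ℂ H) counit (comul h)) = h
  /-- `(1 ⊗ 1 ⊗ Δ)(Φ⁻¹) (Δ ⊗ 1 ⊗ 1)(Φ⁻¹) = (1 ⊗ Φ⁻¹) (1 ⊗ Δ ⊗ 1)(Φ⁻¹) (Φ⁻¹ ⊗ 1)` -/
  pentagon :
    (Algebra.TensorProduct.map (AlgHom.id ℂ H) (Algebra.TensorProduct.map (AlgHom.id ℂ H) comul)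
        (↑Φ⁻¹ : Tensor₃ H) *
      Algebra.TensorProduct.assoc ℂ ℂ ℂ H H (H ⊗[ℂ] H)
        (Algebra.TensorProduct.map comul (AlgHom.id ℂ (H ⊗[ℂ] H)) (↑Φ⁻¹ : Tensor₃ H)) :
        Tensor₄ H) =
    (1 ⊗ₜ (↑Φ⁻¹ : Tensor₃ H)) *
      Algebra.TensorProduct.map (AlgHom.id ℂ H)
        (Algebra.TensorProduct.assoc ℂ ℂ ℂ H H H : (H ⊗[ℂ] H) ⊗[ℂ] H →ₐ[ℂ] Tensor₃ H)
        (Algebra.TensorProduct.map (AlgHom.id ℂ H)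
            (Algebra.TensorProduct.map comul (AlgHom.id ℂ H)) (↑Φ⁻¹ : Tensor₃ H) *
          Algebra.TensorProduct.assoc ℂ ℂ ℂ H (H ⊗[ℂ] H) H ((↑Φ⁻¹ : Tensor₃ H) ⊗ₜ 1))
  /-- `(1 ⊗ ε ⊗ 1)(Φ) = 1` -/
  counit_Φ : Algebra.TensorProduct.map (AlgHom.id ℂ H)
    ((Algebra.TensorProduct.lid ℂ H : ℂ ⊗[ℂ] H →ₐ[ℂ] H).comp
      (Algebra.TensorProduct.map counit (AlgHom.id ℂ H))) (Φ : Tensor₃ H) = 1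
  antipode_one : antipode 1 = 1
  antipode_mul : ∀ a b : H, antipode (a * b) = antipode b * antipode a
  antipode_bijective : Function.Bijective antipode
  /-- `∑ S(h₁) α h₂ = ε(h) α` -/
  antipode_left : ∀ h : H, LinearMap.mul' ℂ H
    (TensorProduct.map antipode (LinearMap.mulLeft ℂ α) (comul h)) = counit h • α
  /-- `∑ h₁ β S(h₂) = ε(h) β` -/
  antipode_right : ∀ h : H, LinearMap.mul' ℂ H
    (TensorProduct.map LinearMap.id (LinearMap.mulLeft ℂ β ∘ₗ antipode) (comul h)) = counit h • β
  /-- `∑ X β S(Y) α Z = 1` for `Φ⁻¹ = ∑ X ⊗ Y ⊗ Z` -/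
  antipode_Φ_inv : LinearMap.mul' ℂ H (TensorProduct.map LinearMap.id
    (LinearMap.mul' ℂ H ∘ₗ TensorProduct.map (LinearMap.mulLeft ℂ β ∘ₗ antipode)
      (LinearMap.mulLeft ℂ α)) (↑Φ⁻¹ : Tensor₃ H)) = 1
  /-- `∑ S(X) α Y β S(Z) = 1` for `Φ = ∑ X ⊗ Y ⊗ Z` -/
  antipode_Φ : LinearMap.mul' ℂ H (TensorProduct.map antipode
    (LinearMap.mul' ℂ H ∘ₗ TensorProduct.map (LinearMap.mulLeft ℂ α)
      (LinearMap.mulLeft ℂ β ∘ₗ antipode)) (Φ : Tensor₃ H)) = 1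
  /-- `Δᵒᵖ(h) R = R Δ(h)` -/
  comul_op : ∀ h : H, Algebra.TensorProduct.comm ℂ H H (comul h) * R = R * comul h
  /-- `(1 ⊗ Δ)(R) = Φ₂₃₁ R₁₃ Φ₂₁₃⁻¹ R₁₂ Φ` -/
  hexagon_right : Algebra.TensorProduct.map (AlgHom.id ℂ H) comul (R : H ⊗[ℂ] H) =
    swap₁₂ (swap₂₃ (Φ : Tensor₃ H)) * leg₁₃ (R : H ⊗[ℂ] H) * swap₁₂ (↑Φ⁻¹ : Tensor₃ H) *
      leg₁₂ (R : H ⊗[ℂ] H) * Φ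
  /-- `(Δ ⊗ 1)(R) = Φ₃₁₂⁻¹ R₁₃ Φ₁₃₂ R₂₃ Φ⁻¹` -/
  hexagon_left : Algebra.TensorProduct.assoc ℂ ℂ ℂ H H H
      (Algebra.TensorProduct.map comul (AlgHom.id ℂ H) (R : H ⊗[ℂ] H)) =
    swap₂₃ (swap₁₂ (↑Φ⁻¹ : Tensor₃ H)) * leg₁₃ (R : H ⊗[ℂ] H) * swap₂₃ (Φ : Tensor₃ H) *
      leg₂₃ (R : H ⊗[ℂ] H) * (↑Φ⁻¹ : Tensor₃ H)

/-- An invertible element `g` of a quasi-Hopf algebra with `S²(h) = g h g⁻¹`; it gives isomorphisms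
of representations `V ≅ V**`, `v ↦ (g v)**`. -/
class QuasiHopf.Pivot (H : Type*) [Ring H] [Algebra ℂ H] [QuasiHopf H] where
  pivot : Hˣ
  antipode_antipode : ∀ h : H,
    QuasiHopf.antipode (QuasiHopf.antipode h) * (pivot : H) = (pivot : H) * h

/-! ### Tensor products of actions -/

section Act

variable {A B C D : Type*} [Ring A] [Algebra ℂ A] [Ring B] [Algebra ℂ B] [Ring C] [Algebra ℂ C]
  [Ring D] [Algebra ℂ D]
variable {V W U X : Type*} [AddCommGroup V] [Module ℂ V] [AddCommGroup W] [Module ℂ W]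
  [AddCommGroup U] [Module ℂ U] [AddCommGroup X] [Module ℂ X]

/-- The action of `A ⊗ B` on `V ⊗ W`. -/
noncomputable def act (ρ : A →ₐ[ℂ] Module.End ℂ V) (σ : B →ₐ[ℂ] Module.End ℂ W) :
    A ⊗[ℂ] B →ₐ[ℂ] Module.End ℂ (V ⊗[ℂ] W) :=
  (Module.endTensorEndAlgHom (R := ℂ) (S := ℂ) (A := ℂ) (M := V) (N := W)).comp
    (Algebra.TensorProduct.map ρ σ)

@[simp] theorem act_tmul (ρ : A →ₐ[ℂ] Module.End ℂ V) (σ : B →ₐ[ℂ] Module.End ℂ W) (a : A) (b : B)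
    (v : V) (w : W) : act ρ σ (a ⊗ₜ b) (v ⊗ₜ w) = ρ a v ⊗ₜ σ b w := rfl

theorem act_tmul' (ρ : A →ₐ[ℂ] Module.End ℂ V) (σ : B →ₐ[ℂ] Module.End ℂ W) (a : A) (b : B) :
    act ρ σ (a ⊗ₜ b) = TensorProduct.map (ρ a) (σ b) := rfl

theorem act_assoc (ρ : A →ₐ[ℂ] Module.End ℂ V) (σ : B →ₐ[ℂ] Module.End ℂ W)
    (τ : C →ₐ[ℂ] Module.End ℂ U) (x : (A ⊗[ℂ] B) ⊗[ℂ] C) (t : (V ⊗[ℂ] W) ⊗[ℂ] U) :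
    TensorProduct.assoc ℂ V W U (act (act ρ σ) τ x t) =
      act ρ (act σ τ) (Algebra.TensorProduct.assoc ℂ ℂ ℂ A B C x)
        (TensorProduct.assoc ℂ V W U t) := by
  induction x with
  | zero => simp
  | add x y hx hy => simp [hx, hy]
  | tmul x c =>
    induction x with
    | zero => simp
    | add x y hx hy => simp [TensorProduct.add_tmul, hx, hy]
    | tmul a b =>
      refine LinearMap.congr_fun (f := (TensorProduct.assoc ℂ V W U).toLinearMap ∘ₗ
        act (act ρ σ) τ ((a ⊗ₜ b) ⊗ₜ c)) (g := act ρ (act σ τ) (a ⊗ₜ (b ⊗ₜ c)) ∘ₗ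
          (TensorProduct.assoc ℂ V W U).toLinearMap) ?_ t
      apply TensorProduct.ext_threefold
      intro v w u
      simp

theorem act_comm (ρ : A →ₐ[ℂ] Module.End ℂ V) (σ : B →ₐ[ℂ] Module.End ℂ W) (x : A ⊗[ℂ] B)
    (t : V ⊗[ℂ] W) : TensorProduct.comm ℂ V W (act ρ σ x t) =
      act σ ρ (Algebra.TensorProduct.comm ℂ A B x) (TensorProduct.comm ℂ V W t) := by
  induction x with
  | zero => simp
  | add x y hx hy => simp [hx, hy]
  | tmul a b =>
    induction t with
    | zero => simp
    | add s t hs ht => simp [hs, ht]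
    | tmul v w => simp

theorem act_comp (ρ : A →ₐ[ℂ] Module.End ℂ V) (σ : B →ₐ[ℂ] Module.End ℂ W) (f : C →ₐ[ℂ] A)
    (g : D →ₐ[ℂ] B) : act (ρ.comp f) (σ.comp g) =
      (act ρ σ).comp (Algebra.TensorProduct.map f g) := by
  ext <;> rfl

/-- Naturality of `act`. -/
theorem act_map (ρ : A →ₐ[ℂ] Module.End ℂ V) (σ : B →ₐ[ℂ] Module.End ℂ W)
    (ρ' : C →ₐ[ℂ] Module.End ℂ U) (σ' : D →ₐ[ℂ] Module.End ℂ X) (f : V →ₗ[ℂ] U) (g : W →ₗ[ℂ] X)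
    (φ : A →ₐ[ℂ] C) (ψ : B →ₐ[ℂ] D) (hf : ∀ a v, f (ρ a v) = ρ' (φ a) (f v))
    (hg : ∀ b w, g (σ b w) = σ' (ψ b) (g w)) (x : A ⊗[ℂ] B) (t : V ⊗[ℂ] W) :
    TensorProduct.map f g (act ρ σ x t) =
      act ρ' σ' (Algebra.TensorProduct.map φ ψ x) (TensorProduct.map f g t) := by
  induction x with
  | zero => simp
  | add x y hx hy => simp [hx, hy]
  | tmul a b =>
    induction t with
    | zero => simp
    | add s t hs ht => rw [map_add, map_add, hs, ht, map_add, map_add]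
    | tmul v w => simp [hf, hg]

/-- An invertible element acts by a linear equivalence. -/
noncomputable def actEquiv (ρ : A →ₐ[ℂ] Module.End ℂ V) (u : Aˣ) : V ≃ₗ[ℂ] V :=
  LinearEquiv.ofLinearMap (ρ u) (ρ (↑u⁻¹ : A))
    (by rw [← Module.End.mul_eq_comp, ← map_mul, Units.mul_inv, map_one]; rfl)
    (by rw [← Module.End.mul_eq_comp, ← map_mul, Units.inv_mul, map_one]; rfl)

@[simp] theorem actEquiv_apply (ρ : A →ₐ[ℂ] Module.End ℂ V) (u : Aˣ) (v : V) :
    actEquiv ρ u v = ρ u v := rfl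

end Act

/-! ### Actions of a quasi-Hopf algebra -/

namespace QuasiHopf

variable {H : Type*} [Ring H] [Algebra ℂ H] [QuasiHopf H]
variable {V W U X V' W' U' : Type*} [AddCommGroup V] [Module ℂ V] [AddCommGroup W] [Module ℂ W]
  [AddCommGroup U] [Module ℂ U] [AddCommGroup X] [Module ℂ X] [AddCommGroup V'] [Module ℂ V']
  [AddCommGroup W'] [Module ℂ W'] [AddCommGroup U'] [Module ℂ U']
variable (ρ : H →ₐ[ℂ] Module.End ℂ V) (σ : H →ₐ[ℂ] Module.End ℂ W) (τ : H →ₐ[ℂ] Module.End ℂ U)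
  (κ : H →ₐ[ℂ] Module.End ℂ X)

variable (H) in
/-- The inverse `Φ⁻¹` of the coassociator. -/
noncomputable abbrev Φinv : Tensor₃ H := ↑(Φ (H := H))⁻¹

variable (H) in
/-- The action on the trivial representation: `h` acts by `ε(h)`. -/
noncomputable def unitAct : H →ₐ[ℂ] Module.End ℂ ℂ := (Algebra.lmul ℂ ℂ).comp counit

@[simp] theorem unitAct_apply (h : H) (c : ℂ) : unitAct H h c = counit h * c := rfl

/-- The action on a tensor product: `h` acts by `Δ(h)`. -/
noncomputable def tensorAct : H →ₐ[ℂ] Module.End ℂ (V ⊗[ℂ] W) := (act ρ σ).comp comul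

theorem tensorAct_apply (h : H) : tensorAct ρ σ h = act ρ σ (comul h) := rfl

theorem act_tensorAct_right (x : H ⊗[ℂ] H) : act ρ (tensorAct σ τ) x = act ρ (act σ τ)
    (Algebra.TensorProduct.map (AlgHom.id ℂ H) comul x) := by
  rw [tensorAct, ← AlgHom.comp_apply, ← act_comp, AlgHom.comp_id]

theorem act_tensorAct_left (x : H ⊗[ℂ] H) : act (tensorAct ρ σ) τ x = act (act ρ σ) τ
    (Algebra.TensorProduct.map comul (AlgHom.id ℂ H) x) := by
  rw [tensorAct, ← AlgHom.comp_apply, ← act_comp, AlgHom.comp_id]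

/-- The associator: the canonical map `(V ⊗ W) ⊗ U → V ⊗ (W ⊗ U)` followed by the action
of `Φ⁻¹`. -/
noncomputable def assocLin : (V ⊗[ℂ] W) ⊗[ℂ] U ≃ₗ[ℂ] V ⊗[ℂ] (W ⊗[ℂ] U) :=
  TensorProduct.assoc ℂ V W U ≪≫ₗ actEquiv (act ρ (act σ τ)) (Φ (H := H))⁻¹

theorem assocLin_apply (t : (V ⊗[ℂ] W) ⊗[ℂ] U) : assocLin ρ σ τ t =
    act ρ (act σ τ) (Φinv H) (TensorProduct.assoc ℂ V W U t) := rfl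

theorem assocLin_act (h : H) (t : (V ⊗[ℂ] W) ⊗[ℂ] U) :
    assocLin ρ σ τ (tensorAct (tensorAct ρ σ) τ h t) =
      tensorAct ρ (tensorAct σ τ) h (assocLin ρ σ τ t) := by
  rw [tensorAct_apply, tensorAct_apply, act_tensorAct_left, act_tensorAct_right, assocLin_apply,
    assocLin_apply, act_assoc, coassoc, ← Module.End.mul_apply, ← Module.End.mul_apply, ← map_mul,
    ← map_mul, ← mul_assoc, ← mul_assoc, Units.inv_mul, one_mul]

theorem lid_act (x : H ⊗[ℂ] H) (t : ℂ ⊗[ℂ] V) :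
    TensorProduct.lid ℂ V (act (unitAct H) ρ x t) = ρ (Algebra.TensorProduct.lid ℂ H
      (Algebra.TensorProduct.map counit (AlgHom.id ℂ H) x)) (TensorProduct.lid ℂ V t) := by
  induction x with
  | zero => simp
  | add x y hx hy => simp [hx, hy]
  | tmul a b =>
    refine LinearMap.congr_fun (f := (TensorProduct.lid ℂ V).toLinearMap ∘ₗ
      act (unitAct H) ρ (a ⊗ₜ b)) (g := ρ (counit a • b) ∘ₗ
        (TensorProduct.lid ℂ V).toLinearMap) ?_ t
    apply TensorProduct.ext'
    intro c v
    simp [mul_smul]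

theorem rid_act (x : H ⊗[ℂ] H) (t : V ⊗[ℂ] ℂ) :
    TensorProduct.rid ℂ V (act ρ (unitAct H) x t) = ρ (Algebra.TensorProduct.rid ℂ ℂ H
      (Algebra.TensorProduct.map (AlgHom.id ℂ H) counit x)) (TensorProduct.rid ℂ V t) := by
  induction x with
  | zero => simp
  | add x y hx hy => simp [hx, hy]
  | tmul a b =>
    refine LinearMap.congr_fun (f := (TensorProduct.rid ℂ V).toLinearMap ∘ₗ
      act ρ (unitAct H) (a ⊗ₜ b)) (g := ρ (counit b • a) ∘ₗ
        (TensorProduct.rid ℂ V).toLinearMap) ?_ t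
    apply TensorProduct.ext'
    intro v c
    simp [mul_smul]

theorem assocLin_naturality (ρ' : H →ₐ[ℂ] Module.End ℂ V') (σ' : H →ₐ[ℂ] Module.End ℂ W')
    (τ' : H →ₐ[ℂ] Module.End ℂ U') (f : V →ₗ[ℂ] V') (g : W →ₗ[ℂ] W') (k : U →ₗ[ℂ] U')
    (hf : ∀ a v, f (ρ a v) = ρ' a (f v)) (hg : ∀ a v, g (σ a v) = σ' a (g v))
    (hk : ∀ a v, k (τ a v) = τ' a (k v)) (t : (V ⊗[ℂ] W) ⊗[ℂ] U) :
    assocLin ρ' σ' τ' (TensorProduct.map (TensorProduct.map f g) k t) =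
    TensorProduct.map f (TensorProduct.map g k) (assocLin ρ σ τ t) := by
  have h₁ : ∀ x s, TensorProduct.map g k (act σ τ x s) =
      act σ' τ' (AlgHom.id ℂ (H ⊗[ℂ] H) x) (TensorProduct.map g k s) := fun x s => by
    rw [act_map σ τ σ' τ' g k (AlgHom.id ℂ H) (AlgHom.id ℂ H) hg hk, Algebra.TensorProduct.map_id]
  rw [assocLin_apply, assocLin_apply, act_map ρ (act σ τ) ρ' (act σ' τ') _ _ (AlgHom.id ℂ H)
    (AlgHom.id ℂ (H ⊗[ℂ] H)) hf h₁, Algebra.TensorProduct.map_id]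
  congr 1
  refine LinearMap.congr_fun (f := (TensorProduct.assoc ℂ V' W' U').toLinearMap ∘ₗ
    TensorProduct.map (TensorProduct.map f g) k) (g := TensorProduct.map f (TensorProduct.map g k)
      ∘ₗ (TensorProduct.assoc ℂ V W U).toLinearMap) ?_ t
  apply TensorProduct.ext_threefold
  intro v w u
  simp

theorem pentagon_lin (t : ((V ⊗[ℂ] W) ⊗[ℂ] U) ⊗[ℂ] X) :
    TensorProduct.map LinearMap.id (assocLin σ τ κ).toLinearMap (assocLin ρ (tensorAct σ τ) κ
      (TensorProduct.map (assocLin ρ σ τ).toLinearMap LinearMap.id t)) =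
    assocLin ρ σ (tensorAct τ κ) (assocLin (tensorAct ρ σ) τ κ t) := by
  have h₁ : TensorProduct.map (assocLin ρ σ τ).toLinearMap LinearMap.id t =
      act (act ρ (act σ τ)) κ (Φinv H ⊗ₜ 1)
        (TensorProduct.map (TensorProduct.assoc ℂ V W U).toLinearMap LinearMap.id t) := by
    rw [act_tmul', map_one, ← LinearMap.comp_apply, ← TensorProduct.map_comp]
    rfl
  have h₂ : ∀ s, assocLin ρ (tensorAct σ τ) κ s =
      act ρ (act (act σ τ) κ) (Algebra.TensorProduct.map (AlgHom.id ℂ H)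
        (Algebra.TensorProduct.map comul (AlgHom.id ℂ H)) (Φinv H))
        (TensorProduct.assoc ℂ V (W ⊗[ℂ] U) X s) := fun s => by
    rw [assocLin_apply, tensorAct, ← AlgHom.comp_apply (act _ _), ← act_comp, ← act_comp,
      AlgHom.comp_id, AlgHom.comp_id]
  have h₃ : ∀ s, TensorProduct.map LinearMap.id (assocLin σ τ κ).toLinearMap s =
      act ρ (act σ (act τ κ)) (1 ⊗ₜ Φinv H)
        (TensorProduct.map LinearMap.id (TensorProduct.assoc ℂ W U X).toLinearMap s) := fun s => by
    rw [act_tmul', map_one, ← LinearMap.comp_apply, ← TensorProduct.map_comp]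
    rfl
  have h₄ : assocLin (tensorAct ρ σ) τ κ t = act (act ρ σ) (act τ κ)
      (Algebra.TensorProduct.map comul (AlgHom.id ℂ (H ⊗[ℂ] H)) (Φinv H))
      (TensorProduct.assoc ℂ (V ⊗[ℂ] W) U X t) := by
    rw [assocLin_apply, tensorAct, ← AlgHom.comp_apply (act _ _), ← act_comp, AlgHom.comp_id]
  have h₅ : ∀ s, assocLin ρ σ (tensorAct τ κ) s = act ρ (act σ (act τ κ))
      (Algebra.TensorProduct.map (AlgHom.id ℂ H)
        (Algebra.TensorProduct.map (AlgHom.id ℂ H) comul) (Φinv H))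
      (TensorProduct.assoc ℂ V W (U ⊗[ℂ] X) s) := fun s => by
    rw [assocLin_apply, tensorAct, ← AlgHom.comp_apply (act _ _), ← act_comp, ← act_comp,
      AlgHom.comp_id, AlgHom.comp_id]
  have h₆ : ∀ x s, TensorProduct.map LinearMap.id (TensorProduct.assoc ℂ W U X).toLinearMap
      (act ρ (act (act σ τ) κ) x s) = act ρ (act σ (act τ κ))
        (Algebra.TensorProduct.map (AlgHom.id ℂ H)
          (Algebra.TensorProduct.assoc ℂ ℂ ℂ H H H : (H ⊗[ℂ] H) ⊗[ℂ] H →ₐ[ℂ] Tensor₃ H) x)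
        (TensorProduct.map LinearMap.id (TensorProduct.assoc ℂ W U X).toLinearMap s) :=
    act_map _ _ _ _ _ _ (AlgHom.id ℂ H) _ (fun _ _ => rfl) (fun x s => act_assoc _ _ _ x s)
  have h₇ : TensorProduct.map LinearMap.id (TensorProduct.assoc ℂ W U X).toLinearMap
      (TensorProduct.assoc ℂ V (W ⊗[ℂ] U) X
        (TensorProduct.map (TensorProduct.assoc ℂ V W U).toLinearMap LinearMap.id t)) =
      TensorProduct.assoc ℂ V W (U ⊗[ℂ] X) (TensorProduct.assoc ℂ (V ⊗[ℂ] W) U X t) := by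
    refine LinearMap.congr_fun (f := TensorProduct.map LinearMap.id
      (TensorProduct.assoc ℂ W U X).toLinearMap ∘ₗ
      (TensorProduct.assoc ℂ V (W ⊗[ℂ] U) X).toLinearMap ∘ₗ
      TensorProduct.map (TensorProduct.assoc ℂ V W U).toLinearMap LinearMap.id)
      (g := (TensorProduct.assoc ℂ V W (U ⊗[ℂ] X)).toLinearMap ∘ₗ
        (TensorProduct.assoc ℂ (V ⊗[ℂ] W) U X).toLinearMap) ?_ t
    apply TensorProduct.ext_fourfold
    intro v w u x
    simp
  rw [h₁, h₂, h₃, h₄, h₅, act_assoc, act_assoc, ← Module.End.mul_apply, ← map_mul, h₆,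
    ← Module.End.mul_apply, ← map_mul, ← Module.End.mul_apply, ← map_mul, h₇, pentagon]

theorem triangle_lin (t : (V ⊗[ℂ] ℂ) ⊗[ℂ] W) :
    TensorProduct.map LinearMap.id (TensorProduct.lid ℂ W).toLinearMap
      (assocLin ρ (unitAct H) σ t) =
    TensorProduct.map (TensorProduct.rid ℂ V).toLinearMap LinearMap.id t := by
  have h : ∀ x s, TensorProduct.map LinearMap.id (TensorProduct.lid ℂ W).toLinearMap
      (act ρ (act (unitAct H) σ) x s) = act ρ σ (Algebra.TensorProduct.map (AlgHom.id ℂ H)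
      ((Algebra.TensorProduct.lid ℂ H : ℂ ⊗[ℂ] H →ₐ[ℂ] H).comp
      (Algebra.TensorProduct.map counit (AlgHom.id ℂ H))) x)
      (TensorProduct.map LinearMap.id (TensorProduct.lid ℂ W).toLinearMap s) :=
    act_map _ _ _ _ _ _ (AlgHom.id ℂ H) _ (fun _ _ => rfl) (fun x s => lid_act σ x s)
  have h' : Algebra.TensorProduct.map (AlgHom.id ℂ H)
      ((Algebra.TensorProduct.lid ℂ H : ℂ ⊗[ℂ] H →ₐ[ℂ] H).comp
      (Algebra.TensorProduct.map counit (AlgHom.id ℂ H))) (Φinv H) = 1 := by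
    have := congrArg (Algebra.TensorProduct.map (AlgHom.id ℂ H)
      ((Algebra.TensorProduct.lid ℂ H : ℂ ⊗[ℂ] H →ₐ[ℂ] H).comp
      (Algebra.TensorProduct.map counit (AlgHom.id ℂ H)))) (Units.mul_inv (Φ : (Tensor₃ H)ˣ))
    rwa [map_mul, counit_Φ, one_mul, map_one] at this
  rw [assocLin_apply, h, h', map_one]
  refine LinearMap.congr_fun (f := TensorProduct.map LinearMap.id
      (TensorProduct.lid ℂ W).toLinearMap ∘ₗ (TensorProduct.assoc ℂ V ℂ W).toLinearMap)
      (g := TensorProduct.map (TensorProduct.rid ℂ V).toLinearMap LinearMap.id) ?_ t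
  apply TensorProduct.ext_threefold
  intro v c w
  simp [TensorProduct.smul_tmul']

end QuasiHopf

/-! ### Finite-dimensional representations of a quasi-Hopf algebra -/

/-- A finite-dimensional representation of the algebra `H`. -/
structure RepCat (H : Type*) [Ring H] [Algebra ℂ H] where
  carrier : Type
  [addCommGroup : AddCommGroup carrier]
  [module : Module ℂ carrier]
  [finite : Module.Finite ℂ carrier]
  ρ : H →ₐ[ℂ] Module.End ℂ carrier

namespace RepCat

section Category

variable {H : Type*} [Ring H] [Algebra ℂ H]

attribute [instance] addCommGroup module finite

instance : CoeSort (RepCat H) Type := ⟨carrier⟩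

/-- A morphism of representations. -/
@[ext]
structure Hom (V W : RepCat H) where
  toLin : V →ₗ[ℂ] W
  comm : ∀ (h : H) (v : V), toLin (V.ρ h v) = W.ρ h (toLin v)

attribute [simp] Hom.comm

instance : Category (RepCat H) where
  Hom V W := Hom V W
  id V := ⟨LinearMap.id, fun _ _ => rfl⟩
  comp f g := ⟨g.toLin ∘ₗ f.toLin, fun _ _ => by simp⟩

@[simp] theorem id_toLin (V : RepCat H) : Hom.toLin (𝟙 V) = LinearMap.id := rfl
@[simp] theorem comp_toLin {V W U : RepCat H} (f : V ⟶ W) (g : W ⟶ U) :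
    Hom.toLin (f ≫ g) = Hom.toLin g ∘ₗ Hom.toLin f := rfl

@[ext] theorem hom_ext {V W : RepCat H} {f g : V ⟶ W} (h : Hom.toLin f = Hom.toLin g) : f = g :=
  Hom.ext h

instance (V W : RepCat H) : Add (V ⟶ W) :=
  ⟨fun f g => ⟨Hom.toLin f + Hom.toLin g, fun _ _ => by simp⟩⟩
instance (V W : RepCat H) : Zero (V ⟶ W) := ⟨⟨0, fun _ _ => by simp⟩⟩
instance (V W : RepCat H) : Neg (V ⟶ W) := ⟨fun f => ⟨-Hom.toLin f, fun _ _ => by simp⟩⟩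
instance (V W : RepCat H) : Sub (V ⟶ W) :=
  ⟨fun f g => ⟨Hom.toLin f - Hom.toLin g, fun _ _ => by simp⟩⟩
instance (V W : RepCat H) : SMul ℕ (V ⟶ W) := ⟨fun c f => ⟨c • Hom.toLin f, fun _ _ => by simp⟩⟩
instance (V W : RepCat H) : SMul ℤ (V ⟶ W) := ⟨fun c f => ⟨c • Hom.toLin f, fun _ _ => by simp⟩⟩
instance (V W : RepCat H) : SMul ℂ (V ⟶ W) := ⟨fun c f => ⟨c • Hom.toLin f, fun _ _ => by simp⟩⟩

instance (V W : RepCat H) : AddCommGroup (V ⟶ W) :=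
  Function.Injective.addCommGroup (fun f : V ⟶ W => Hom.toLin f) (fun _ _ h => Hom.ext h)
    rfl (fun _ _ => rfl) (fun _ => rfl) (fun _ _ => rfl) (fun _ _ => rfl) (fun _ _ => rfl)

@[simp] theorem add_toLin {V W : RepCat H} (f g : V ⟶ W) :
    Hom.toLin (f + g) = Hom.toLin f + Hom.toLin g := rfl

instance (V W : RepCat H) : Module ℂ (V ⟶ W) :=
  Function.Injective.module ℂ (⟨⟨fun f : V ⟶ W => Hom.toLin f, rfl⟩, fun _ _ => rfl⟩ :
    (V ⟶ W) →+ (V →ₗ[ℂ] W)) (fun _ _ h => Hom.ext h) (fun _ _ => rfl)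

@[simp] theorem smul_toLin {V W : RepCat H} (c : ℂ) (f : V ⟶ W) :
    Hom.toLin (c • f) = c • Hom.toLin f := rfl

instance : Preadditive (RepCat H) where
  add_comp _ _ _ f f' g := by ext v; simp
  comp_add _ _ _ f g g' := by ext v; simp

instance : Linear ℂ (RepCat H) where
  smul_comp _ _ _ r f g := by ext v; simp
  comp_smul _ _ _ f r g := by ext v; simp

/-- An isomorphism from an equivariant linear equivalence. -/
def isoMk {V W : RepCat H} (e : V ≃ₗ[ℂ] W)
    (h : ∀ (x : H) (v : V), e (V.ρ x v) = W.ρ x (e v)) : V ≅ W where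
  hom := ⟨e.toLinearMap, h⟩
  inv := ⟨e.symm.toLinearMap, fun x w => by
    apply e.injective
    simp [h]⟩
  hom_inv_id := by ext v; simp
  inv_hom_id := by ext v; simp

end Category

variable {H : Type*} [Ring H] [Algebra ℂ H] [QuasiHopf H]

open QuasiHopf

/-- The tensor product of representations, with `h` acting by `Δ(h)`. -/
noncomputable def tensor (V W : RepCat H) : RepCat H where
  carrier := V ⊗[ℂ] W
  ρ := tensorAct V.ρ W.ρ

variable (H) in
/-- The trivial representation, with `h` acting by `ε(h)`. -/
noncomputable def unit : RepCat H where
  carrier := ℂ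
  ρ := unitAct H

/-- The tensor product of morphisms. -/
noncomputable def tensorMap {V V' W W' : RepCat H} (f : V ⟶ V') (g : W ⟶ W') :
    tensor V W ⟶ tensor V' W' where
  toLin := TensorProduct.map (Hom.toLin f) (Hom.toLin g)
  comm h t := by
    have := act_map V.ρ W.ρ V'.ρ W'.ρ (Hom.toLin f) (Hom.toLin g) (AlgHom.id ℂ H) (AlgHom.id ℂ H)
      (fun a v => Hom.comm f a v) (fun a v => Hom.comm g a v) (comul h) t
    rw [Algebra.TensorProduct.map_id] at this
    exact this

/-- The associator, see `QuasiHopf.assocLin`. -/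
noncomputable def assoc (V W U : RepCat H) : tensor (tensor V W) U ≅ tensor V (tensor W U) :=
  isoMk (assocLin V.ρ W.ρ U.ρ) (assocLin_act V.ρ W.ρ U.ρ)

noncomputable def leftUnitor (V : RepCat H) : tensor (unit H) V ≅ V :=
  isoMk (TensorProduct.lid ℂ V) fun h t =>
    (lid_act V.ρ (comul h) t).trans (by rw [counit_left]; rfl)

noncomputable def rightUnitor (V : RepCat H) : tensor V (unit H) ≅ V :=
  isoMk (TensorProduct.rid ℂ V) fun h t =>
    (rid_act V.ρ (comul h) t).trans (by rw [counit_right]; rfl)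

noncomputable instance : MonoidalCategoryStruct (RepCat H) where
  tensorObj := tensor
  tensorHom := tensorMap
  whiskerLeft V _ _ f := tensorMap (𝟙 V) f
  whiskerRight f W := tensorMap f (𝟙 W)
  tensorUnit := unit H
  associator := assoc
  leftUnitor := leftUnitor
  rightUnitor := rightUnitor

/-- The monoidal category of finite-dimensional representations. -/
noncomputable instance : MonoidalCategory (RepCat H) := MonoidalCategory.ofTensorHom
  (id_tensorHom_id := fun V W => by
    apply hom_ext; exact TensorProduct.map_id)
  (tensorHom_comp_tensorHom := fun f₁ f₂ g₁ g₂ => by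
    apply hom_ext; exact (TensorProduct.map_comp _ _ _ _).symm)
  (associator_naturality := fun f g h => by
    apply hom_ext
    exact LinearMap.ext fun t => assocLin_naturality _ _ _ _ _ _ _ _ _ (Hom.comm f) (Hom.comm g)
      (Hom.comm h) t)
  (leftUnitor_naturality := fun {V W} f => by
    apply hom_ext
    change (TensorProduct.lid ℂ W).toLinearMap ∘ₗ TensorProduct.map LinearMap.id (Hom.toLin f) =
      Hom.toLin f ∘ₗ (TensorProduct.lid ℂ V).toLinearMap
    ext; simp)
  (rightUnitor_naturality := fun {V W} f => by
    apply hom_ext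
    change (TensorProduct.rid ℂ W).toLinearMap ∘ₗ TensorProduct.map (Hom.toLin f) LinearMap.id =
      Hom.toLin f ∘ₗ (TensorProduct.rid ℂ V).toLinearMap
    ext; simp)
  (pentagon := fun V W U X => by
    apply hom_ext
    exact LinearMap.ext fun t => pentagon_lin V.ρ W.ρ U.ρ X.ρ t)
  (triangle := fun V W => by
    apply hom_ext
    exact LinearMap.ext fun t => triangle_lin V.ρ W.ρ t)

end RepCat

namespace QuasiHopf

variable {H : Type*} [Ring H] [Algebra ℂ H] [QuasiHopf H]
variable {V W U : Type*} [AddCommGroup V] [Module ℂ V] [AddCommGroup W] [Module ℂ W]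
  [AddCommGroup U] [Module ℂ U]
variable (ρ : H →ₐ[ℂ] Module.End ℂ V) (σ : H →ₐ[ℂ] Module.End ℂ W) (τ : H →ₐ[ℂ] Module.End ℂ U)

/-- The braiding: the action of `R` followed by the flip. -/
noncomputable def braidLin : V ⊗[ℂ] W ≃ₗ[ℂ] W ⊗[ℂ] V :=
  actEquiv (act ρ σ) (R (H := H)) ≪≫ₗ TensorProduct.comm ℂ V W

theorem braidLin_apply (t : V ⊗[ℂ] W) : braidLin ρ σ t =
    TensorProduct.comm ℂ V W (act ρ σ (R : (H ⊗[ℂ] H)ˣ) t) := rfl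

theorem braidLin_act (h : H) (t : V ⊗[ℂ] W) :
    braidLin ρ σ (tensorAct ρ σ h t) = tensorAct σ ρ h (braidLin ρ σ t) := by
  have hh : ∀ x : H ⊗[ℂ] H, Algebra.TensorProduct.comm ℂ H H (Algebra.TensorProduct.comm ℂ H H x) =
      x := fun x => by
    induction x with
    | zero => simp
    | add x y hx hy => simp [hx, hy]
    | tmul a b => simp
  rw [braidLin_apply, braidLin_apply, tensorAct_apply, tensorAct_apply, ← Module.End.mul_apply,
    ← map_mul, ← comul_op, map_mul, Module.End.mul_apply, act_comm, hh]

theorem braidLin_naturality {V' W' : Type*} [AddCommGroup V'] [Module ℂ V'] [AddCommGroup W']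
    [Module ℂ W'] (ρ' : H →ₐ[ℂ] Module.End ℂ V') (σ' : H →ₐ[ℂ] Module.End ℂ W')
    (f : V →ₗ[ℂ] V') (g : W →ₗ[ℂ] W') (hf : ∀ a v, f (ρ a v) = ρ' a (f v))
    (hg : ∀ a v, g (σ a v) = σ' a (g v)) (t : V ⊗[ℂ] W) :
    braidLin ρ' σ' (TensorProduct.map f g t) = TensorProduct.map g f (braidLin ρ σ t) := by
  have h := act_map ρ σ ρ' σ' f g (AlgHom.id ℂ H) (AlgHom.id ℂ H) hf hg (R (H := H)) t
  rw [Algebra.TensorProduct.map_id] at h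
  rw [braidLin_apply, braidLin_apply, TensorProduct.map_comm, h]
  rfl

/-- The action of a permuted element of `H ⊗ (H ⊗ H)`. -/
theorem act_swap₁₂ (x : H ⊗[ℂ] (H ⊗[ℂ] H)) (t : V ⊗[ℂ] (W ⊗[ℂ] U)) :
    TensorProduct.leftComm ℂ V W U (act ρ (act σ τ) x t) =
      act σ (act ρ τ) (swap₁₂ x) (TensorProduct.leftComm ℂ V W U t) := by
  induction x with
  | zero => simp
  | add x y hx hy => simp [hx, hy]
  | tmul a x =>
    induction x with
    | zero => simp
    | add x y hx hy => simp [TensorProduct.tmul_add, hx, hy]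
    | tmul b c =>
      refine LinearMap.congr_fun (f := (TensorProduct.leftComm ℂ V W U).toLinearMap ∘ₗ
        act ρ (act σ τ) (a ⊗ₜ (b ⊗ₜ c))) (g := act σ (act ρ τ) (b ⊗ₜ (a ⊗ₜ c)) ∘ₗ
          (TensorProduct.leftComm ℂ V W U).toLinearMap) ?_ t
      apply TensorProduct.ext
      ext v : 1
      apply TensorProduct.ext'
      intro w u
      simp

theorem act_swap₂₃ (x : Tensor₃ H) (t : V ⊗[ℂ] (W ⊗[ℂ] U)) :
    TensorProduct.map LinearMap.id (TensorProduct.comm ℂ W U).toLinearMap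
      (act ρ (act σ τ) x t) = act ρ (act τ σ) (swap₂₃ x)
        (TensorProduct.map LinearMap.id (TensorProduct.comm ℂ W U).toLinearMap t) :=
  act_map ρ (act σ τ) ρ (act τ σ) _ _ (AlgHom.id ℂ H)
    (Algebra.TensorProduct.comm ℂ H H : H ⊗[ℂ] H →ₐ[ℂ] H ⊗[ℂ] H) (fun _ _ => rfl)
    (fun x s => act_comm σ τ x s) x t

/-- `v ⊗ (w ⊗ u) ↦ w ⊗ (v ⊗ u)` in terms of associators and the flip. -/
theorem assoc_flip (t : (V ⊗[ℂ] W) ⊗[ℂ] U) : TensorProduct.assoc ℂ W V U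
    (TensorProduct.map (TensorProduct.comm ℂ V W).toLinearMap LinearMap.id t) =
      TensorProduct.leftComm ℂ V W U (TensorProduct.assoc ℂ V W U t) := by
  refine LinearMap.congr_fun (f := (TensorProduct.assoc ℂ W V U).toLinearMap ∘ₗ
    TensorProduct.map (TensorProduct.comm ℂ V W).toLinearMap LinearMap.id)
    (g := (TensorProduct.leftComm ℂ V W U).toLinearMap ∘ₗ
      (TensorProduct.assoc ℂ V W U).toLinearMap) ?_ t
  apply TensorProduct.ext_threefold
  intro v w u
  simp

theorem flip_assoc (t : V ⊗[ℂ] (W ⊗[ℂ] U)) :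
    TensorProduct.assoc ℂ W U V (TensorProduct.comm ℂ V (W ⊗[ℂ] U) t) =
      TensorProduct.map LinearMap.id (TensorProduct.comm ℂ V U).toLinearMap
        (TensorProduct.leftComm ℂ V W U t) := by
  refine LinearMap.congr_fun (f := (TensorProduct.assoc ℂ W U V).toLinearMap ∘ₗ
    (TensorProduct.comm ℂ V (W ⊗[ℂ] U)).toLinearMap) (g := TensorProduct.map LinearMap.id
      (TensorProduct.comm ℂ V U).toLinearMap ∘ₗ (TensorProduct.leftComm ℂ V W U).toLinearMap) ?_ t
  apply TensorProduct.ext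
  ext v : 1
  apply TensorProduct.ext'
  intro w u
  simp

theorem swap₁₂_swap₁₂ (x : H ⊗[ℂ] (H ⊗[ℂ] H)) : swap₁₂ (swap₁₂ x) = x := by
  induction x with
  | zero => simp
  | add x y hx hy => simp [hx, hy]
  | tmul a x =>
    induction x with
    | zero => simp
    | add x y hx hy => simp only [TensorProduct.tmul_add, map_add, hx, hy]
    | tmul b c => simp [swap₁₂]

theorem swap₂₃_swap₂₃ (x : H ⊗[ℂ] (H ⊗[ℂ] H)) : swap₂₃ (swap₂₃ x) = x := by
  induction x with
  | zero => simp
  | add x y hx hy => simp [hx, hy]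
  | tmul a x =>
    induction x with
    | zero => simp
    | add x y hx hy => simp only [TensorProduct.tmul_add, map_add, hx, hy]
    | tmul b c => simp [swap₂₃]

theorem swap₂₃_leg₁₂ (x : H ⊗[ℂ] H) : swap₂₃ (leg₁₂ x) = leg₁₃ x := rfl

theorem swap₁₂_leg₁₃ (x : H ⊗[ℂ] H) : swap₁₂ (leg₁₃ x) = leg₂₃ x := by
  induction x with
  | zero => simp [leg₁₃, leg₂₃, leg₁₂]
  | add x y hx hy =>
    simp only [leg₁₃, leg₂₃, leg₁₂, TensorProduct.add_tmul, TensorProduct.tmul_add,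
      map_add] at hx hy ⊢
    rw [hx, hy]
  | tmul a b => simp [leg₁₃, leg₁₂, leg₂₃, swap₁₂, swap₂₃]

theorem assoc_braid (t : (V ⊗[ℂ] W) ⊗[ℂ] U) : TensorProduct.assoc ℂ W V U
    (TensorProduct.map (braidLin ρ σ).toLinearMap LinearMap.id t) =
      TensorProduct.leftComm ℂ V W U (act ρ (act σ τ) (leg₁₂ (R : (H ⊗[ℂ] H)ˣ))
        (TensorProduct.assoc ℂ V W U t)) := by
  rw [leg₁₂, ← act_assoc, act_tmul', map_one, ← assoc_flip, ← LinearMap.comp_apply (f := _),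
    ← TensorProduct.map_comp]
  rfl

theorem map_braid (t : V ⊗[ℂ] (W ⊗[ℂ] U)) :
    TensorProduct.map LinearMap.id (braidLin σ τ).toLinearMap t =
      TensorProduct.map LinearMap.id (TensorProduct.comm ℂ W U).toLinearMap
        (act ρ (act σ τ) (leg₂₃ (R : (H ⊗[ℂ] H)ˣ)) t) := by
  rw [leg₂₃, act_tmul', map_one, ← LinearMap.comp_apply, ← TensorProduct.map_comp]
  rfl

theorem hexagon_forward_lin (t : (V ⊗[ℂ] W) ⊗[ℂ] U) :
    assocLin σ τ ρ (braidLin ρ (tensorAct σ τ) (assocLin ρ σ τ t)) =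
      TensorProduct.map LinearMap.id (braidLin ρ τ).toLinearMap
        (assocLin σ ρ τ (TensorProduct.map (braidLin ρ σ).toLinearMap LinearMap.id t)) := by
  rw [assocLin_apply, assocLin_apply, assocLin_apply, braidLin_apply, act_tensorAct_right,
    flip_assoc, act_swap₁₂, act_swap₂₃, ← Module.End.mul_apply, ← map_mul]
  rw [act_swap₁₂, act_swap₂₃, ← Module.End.mul_apply, ← map_mul]
  rw [map_braid σ ρ τ, assoc_braid ρ σ τ, act_swap₁₂, act_swap₂₃, act_swap₂₃, act_swap₂₃,
    ← Module.End.mul_apply, ← Module.End.mul_apply, ← map_mul, ← map_mul]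
  congr 2
  rw [hexagon_right, map_mul, map_mul, map_mul, map_mul, map_mul, map_mul, map_mul, map_mul,
    swap₁₂_swap₁₂, swap₂₃_swap₂₃, swap₁₂_swap₁₂, swap₁₂_leg₁₃]
  have : swap₂₃ (swap₁₂ (Φ : (Tensor₃ H)ˣ).val) * swap₂₃ (swap₁₂ (Φinv H)) = 1 := by
    rw [← map_mul, ← map_mul, Units.mul_inv, map_one, map_one]
  have h2 : (Φinv H) * (Φ : (Tensor₃ H)ˣ).val = 1 := Units.inv_mul _
  simp only [mul_assoc, this, mul_one]
  rw [← mul_assoc (Φinv H), h2, one_mul]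

theorem assocLin_symm_apply (t : V ⊗[ℂ] (W ⊗[ℂ] U)) : (assocLin ρ σ τ).symm t =
    (TensorProduct.assoc ℂ V W U).symm (act ρ (act σ τ) (Φ (H := H)) t) := by
  rw [LinearEquiv.symm_apply_eq, assocLin_apply, LinearEquiv.apply_symm_apply,
    ← Module.End.mul_apply, ← map_mul, Units.inv_mul, map_one]
  rfl

theorem flip_assoc_symm (t : V ⊗[ℂ] (W ⊗[ℂ] U)) :
    TensorProduct.comm ℂ (V ⊗[ℂ] W) U ((TensorProduct.assoc ℂ V W U).symm t) =
      TensorProduct.leftComm ℂ V U W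
        (TensorProduct.map LinearMap.id (TensorProduct.comm ℂ W U).toLinearMap t) := by
  refine LinearMap.congr_fun (f := (TensorProduct.comm ℂ (V ⊗[ℂ] W) U).toLinearMap ∘ₗ
    (TensorProduct.assoc ℂ V W U).symm.toLinearMap)
    (g := (TensorProduct.leftComm ℂ V U W).toLinearMap ∘ₗ TensorProduct.map LinearMap.id
      (TensorProduct.comm ℂ W U).toLinearMap) ?_ t
  apply TensorProduct.ext
  ext v : 1
  apply TensorProduct.ext'
  intro w u
  simp

theorem act_assoc_symm (x : (H ⊗[ℂ] H) ⊗[ℂ] H) (t : V ⊗[ℂ] (W ⊗[ℂ] U)) :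
    act (act ρ σ) τ x ((TensorProduct.assoc ℂ V W U).symm t) = (TensorProduct.assoc ℂ V W U).symm
      (act ρ (act σ τ) (Algebra.TensorProduct.assoc ℂ ℂ ℂ H H H x) t) := by
  rw [LinearEquiv.eq_symm_apply, act_assoc, LinearEquiv.apply_symm_apply]

theorem hexagon_reverse_lin (t : V ⊗[ℂ] (W ⊗[ℂ] U)) :
    (assocLin τ ρ σ).symm (braidLin (tensorAct ρ σ) τ ((assocLin ρ σ τ).symm t)) =
      TensorProduct.map (braidLin ρ τ).toLinearMap LinearMap.id
        ((assocLin ρ τ σ).symm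
          (TensorProduct.map LinearMap.id (braidLin σ τ).toLinearMap t)) := by
  rw [LinearEquiv.symm_apply_eq, assocLin_apply, assoc_braid ρ τ σ, assocLin_symm_apply,
    assocLin_symm_apply, LinearEquiv.apply_symm_apply, braidLin_apply, act_tensorAct_left,
    act_assoc_symm, flip_assoc_symm, map_braid ρ σ τ, ← Module.End.mul_apply, ← map_mul,
    act_swap₂₃, act_swap₂₃, act_swap₁₂, ← Module.End.mul_apply (act ρ (act τ σ) _),
    ← Module.End.mul_apply, ← map_mul, ← map_mul, act_swap₁₂,
    ← Module.End.mul_apply, ← map_mul]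
  congr 2
  have h2 : (Φinv H) * (Φ : (Tensor₃ H)ˣ).val = 1 := Units.inv_mul _
  rw [hexagon_left, mul_assoc _ (Φinv H), h2, mul_one]
  simp only [map_mul, swap₁₂_swap₁₂, swap₂₃_swap₂₃, mul_assoc, leg₁₃]

/-- The action on the dual space: `h` acts by the transpose of `S(h)`. -/
noncomputable def dualAct : H →ₐ[ℂ] Module.End ℂ (Module.Dual ℂ V) :=
  AlgHom.ofLinearMap (Module.Dual.transpose ∘ₗ ρ.toLinearMap ∘ₗ antipode)
    (by
      change Module.Dual.transpose (ρ (antipode 1)) = 1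
      rw [antipode_one, map_one]; rfl)
    (fun a b => by
      change Module.Dual.transpose (ρ (antipode (a * b))) = _
      rw [antipode_mul, map_mul]; rfl)

theorem dualAct_apply (h : H) (f : Module.Dual ℂ V) (v : V) :
    dualAct ρ h f v = f (ρ (antipode h) v) := rfl

/-- The evaluation `f ⊗ v ↦ f(α v)`. -/
noncomputable def evLin : Module.Dual ℂ V ⊗[ℂ] V →ₗ[ℂ] ℂ :=
  contractLeft ℂ V ∘ₗ TensorProduct.map LinearMap.id (ρ α)

@[simp] theorem evLin_tmul (f : Module.Dual ℂ V) (v : V) : evLin ρ (f ⊗ₜ v) = f (ρ α v) := rfl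

theorem evLin_act (h : H) (t : Module.Dual ℂ V ⊗[ℂ] V) :
    evLin ρ (tensorAct (dualAct ρ) ρ h t) = unitAct H h (evLin ρ t) := by
  have key : ∀ (x : H ⊗[ℂ] H) (f : Module.Dual ℂ V) (v : V),
      evLin ρ (act (dualAct ρ) ρ x (f ⊗ₜ v)) = f (ρ (LinearMap.mul' ℂ H
        (TensorProduct.map antipode (LinearMap.mulLeft ℂ α) x)) v) := fun x f v => by
    induction x with
    | zero => simp
    | add x y hx hy => simp only [map_add, LinearMap.add_apply, hx, hy]
    | tmul a b => simp [dualAct_apply]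
  induction t with
  | zero => simp
  | add s t hs ht => rw [map_add, map_add, hs, ht, map_add, map_add]
  | tmul f v => rw [tensorAct_apply, key, antipode_left]; simp

variable [Module.Finite ℂ V]

/-- The coevaluation `1 ↦ ∑ β vᵢ ⊗ vⁱ`. -/
noncomputable def coevLin : ℂ →ₗ[ℂ] V ⊗[ℂ] Module.Dual ℂ V :=
  TensorProduct.map (ρ β) LinearMap.id ∘ₗ coevaluation ℂ V

theorem coevaluation_transpose (A : V →ₗ[ℂ] V) :
    TensorProduct.map LinearMap.id (Module.Dual.transpose (R := ℂ) A) (coevaluation ℂ V 1) =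
      TensorProduct.map A LinearMap.id (coevaluation ℂ V 1) := by
  rw [coevaluation_apply_one]
  set b := Module.Basis.ofVectorSpace ℂ V
  simp only [map_sum, TensorProduct.map_tmul, LinearMap.id_apply]
  have h1 : ∀ i, Module.Dual.transpose (R := ℂ) A (b.coord i) =
      ∑ j, b.coord i (A (b j)) • b.coord j := fun i => b.ext fun k => by
    classical
    simp [Module.Dual.transpose_apply, Finsupp.single_apply]
  have h2 : ∀ j, A (b j) = ∑ i, b.coord i (A (b j)) • b i := fun j => (b.sum_repr _).symm
  conv_rhs => enter [2, j]; rw [h2 j]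
  simp only [h1, TensorProduct.tmul_sum, TensorProduct.sum_tmul, TensorProduct.tmul_smul,
    TensorProduct.smul_tmul']
  exact Finset.sum_comm

theorem coevLin_act (h : H) (c : ℂ) :
    coevLin ρ (unitAct H h c) = tensorAct ρ (dualAct ρ) h (coevLin ρ c) := by
  have key : ∀ x : H ⊗[ℂ] H, act ρ (dualAct ρ) x (coevLin ρ 1) =
      TensorProduct.map (ρ (LinearMap.mul' ℂ H (TensorProduct.map LinearMap.id
        (LinearMap.mulLeft ℂ β ∘ₗ antipode) x))) LinearMap.id (coevaluation ℂ V 1) := fun x => by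
    induction x with
    | zero => simp
    | add x y hx hy => simp only [map_add, LinearMap.add_apply, hx, hy, TensorProduct.map_add_left]
    | tmul a b =>
      have h1 : act ρ (dualAct ρ) (a ⊗ₜ b) (coevLin ρ 1) =
          TensorProduct.map (ρ (a * β)) LinearMap.id (TensorProduct.map LinearMap.id
            (Module.Dual.transpose (R := ℂ) (ρ (antipode b))) (coevaluation ℂ V 1)) := by
        rw [act_tmul', coevLin, LinearMap.comp_apply, ← LinearMap.comp_apply (TensorProduct.map _ _),
          ← LinearMap.comp_apply (TensorProduct.map _ _), ← TensorProduct.map_comp,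
          ← TensorProduct.map_comp, map_mul]
        rfl
      rw [h1, coevaluation_transpose, ← LinearMap.comp_apply, ← TensorProduct.map_comp]
      simp only [TensorProduct.map_tmul, LinearMap.id_apply, LinearMap.comp_apply,
        LinearMap.mulLeft_apply, LinearMap.mul'_apply, LinearMap.comp_id]
      rw [← Module.End.mul_eq_comp, ← map_mul, mul_assoc]
  have h1 : coevLin ρ c = c • coevLin ρ 1 := by rw [← map_smul, smul_eq_mul, mul_one]
  have h2 : coevLin ρ (unitAct H h c) = (counit h * c) • coevLin ρ 1 := by
    rw [← map_smul, smul_eq_mul, mul_one, unitAct_apply]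
  rw [h2, h1, map_smul, tensorAct_apply, key, antipode_right, mul_comm, mul_smul]
  congr 1
  rw [map_smul, TensorProduct.map_smul_left]
  rfl

end QuasiHopf

namespace RepCat

open QuasiHopf

section Braided

variable {H : Type*} [Ring H] [Algebra ℂ H] [QuasiHopf H]

/-- The braiding `v ⊗ w ↦ τ(R (v ⊗ w))`. -/
noncomputable instance : BraidedCategory (RepCat H) where
  braiding V W := isoMk (V := tensor V W) (W := tensor W V) (braidLin V.ρ W.ρ)
    (braidLin_act V.ρ W.ρ)
  braiding_naturality_right V {W U} f := by
    apply hom_ext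
    exact LinearMap.ext fun t => braidLin_naturality V.ρ W.ρ V.ρ U.ρ LinearMap.id (Hom.toLin f)
      (fun _ _ => rfl) (Hom.comm f) t
  braiding_naturality_left {V W} f U := by
    apply hom_ext
    exact LinearMap.ext fun t => braidLin_naturality V.ρ U.ρ W.ρ U.ρ (Hom.toLin f) LinearMap.id
      (Hom.comm f) (fun _ _ => rfl) t
  hexagon_forward V W U := by
    apply hom_ext
    exact LinearMap.ext fun t => hexagon_forward_lin V.ρ W.ρ U.ρ t
  hexagon_reverse V W U := by
    apply hom_ext
    exact LinearMap.ext fun t => hexagon_reverse_lin V.ρ W.ρ U.ρ t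

/-- The dual representation. -/
noncomputable def dual (V : RepCat H) : RepCat H where
  carrier := Module.Dual ℂ V
  ρ := dualAct V.ρ

/-- The evaluation `V* ⊗ V ⟶ 𝟙`, `f ⊗ v ↦ f(α v)`. -/
noncomputable def ev (V : RepCat H) : dual V ⊗ V ⟶ 𝟙_ (RepCat H) :=
  (⟨evLin V.ρ, evLin_act V.ρ⟩ : Hom (tensor (dual V) V) (unit H))

/-- The coevaluation `𝟙 ⟶ V ⊗ V*`, `1 ↦ ∑ β vᵢ ⊗ vⁱ`. -/
noncomputable def coev (V : RepCat H) : 𝟙_ (RepCat H) ⟶ V ⊗ dual V :=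
  (⟨coevLin V.ρ, coevLin_act V.ρ⟩ : Hom (unit H) (tensor V (dual V)))

/-- The pivotal morphism `V ⟶ V**`, `v ↦ (g v)**`. -/
noncomputable def pivotal [Pivot H] (V : RepCat H) : V ⟶ dual (dual V) :=
  (⟨Module.Dual.eval ℂ V ∘ₗ V.ρ (Pivot.pivot (H := H)), fun h v => by
    refine LinearMap.ext fun f : Module.Dual ℂ V => ?_
    change f (V.ρ _ (V.ρ h v)) = f (V.ρ (antipode (antipode h)) (V.ρ _ v))
    rw [← Module.End.mul_apply, ← Module.End.mul_apply, ← map_mul, ← map_mul,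
      Pivot.antipode_antipode]⟩ : Hom V (dual (dual V)))

end Braided

end RepCat

/-! ### The twisted Drinfeld double -/

/-- The underlying space of the twisted Drinfeld double `D^ωG`: the coefficient of the basis vector
`δ_g x̄` of the element `a` is `a g x`. -/
def TwistedDouble {G : Type*} [Group G] (_ω : NormalizedCocycle G) : Type _ := G → G → ℂ

namespace TwistedDouble

variable {G : Type*} [Group G] {ω : NormalizedCocycle G}

/-- Addition is pointwise. -/
noncomputable abbrev addCommGroup : AddCommGroup (TwistedDouble ω) :=
  inferInstanceAs (AddCommGroup (G → G → ℂ))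

@[ext] theorem ext' {a b : TwistedDouble ω} (h : ∀ g x, a g x = b g x) : a = b :=
  funext fun g => funext fun x => h g x

variable [Fintype G]

/-- The product is determined by `δ_g x̄ · δ_h ȳ = θ_g(x, y) δ_{g, xhx⁻¹} δ_g \overline{xy}`. -/
noncomputable instance : Mul (TwistedDouble ω) where
  mul a b := fun g z =>
    ∑ x : G, (ω.θ g x (x⁻¹ * z) : ℂ) * a g x * b (x⁻¹ * g * x) (x⁻¹ * z)

open scoped Classical in
/-- The unit is `∑_g δ_g ē`. -/
noncomputable instance : One (TwistedDouble ω) where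
  one := fun _ x => if x = 1 then 1 else 0

theorem mul_apply' (a b : TwistedDouble ω) (g z : G) : (a * b) g z =
    ∑ x : G, (ω.θ g x (x⁻¹ * z) : ℂ) * a g x * b (x⁻¹ * g * x) (x⁻¹ * z) := rfl

open scoped Classical in
theorem one_apply' (g x : G) : (1 : TwistedDouble ω) g x = if x = 1 then 1 else 0 := rfl

protected theorem mul_assoc' (a b c : TwistedDouble ω) : a * b * c = a * (b * c) := by
  ext g z
  simp only [mul_apply', Finset.mul_sum, Finset.sum_mul]
  rw [Finset.sum_comm]
  refine Finset.sum_congr rfl fun x _ => ?_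
  refine Fintype.sum_equiv (Equiv.mulLeft x⁻¹) _ _ fun w => ?_
  have h := congrArg Units.val (ω.θ_cocycle g x (x⁻¹ * w) (w⁻¹ * z))
  have e2 : x⁻¹ * w * (w⁻¹ * z) = x⁻¹ * z := by group
  have e3 : w⁻¹ * x * (x⁻¹ * g * x) * (x⁻¹ * w) = w⁻¹ * g * w := by group
  have e4 : w⁻¹ * x * (x⁻¹ * z) = w⁻¹ * z := by group
  rw [mul_inv_cancel_left, e2] at h
  simp only [Equiv.coe_mulLeft, mul_inv_rev, inv_inv, e3, e4]
  push_cast at h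
  linear_combination (a g x * b (x⁻¹ * g * x) (x⁻¹ * w) * c (w⁻¹ * g * w) (w⁻¹ * z)) * h

noncomputable instance : Ring (TwistedDouble ω) :=
  { addCommGroup (ω := ω),
    (inferInstance : Mul (TwistedDouble ω)),
    (inferInstance : One (TwistedDouble ω)) with
    left_distrib := fun a b c => by
      ext g z
      refine Eq.trans ?_ Finset.sum_add_distrib
      exact Finset.sum_congr rfl fun x _ => mul_add _ _ _
    right_distrib := fun a b c => by
      ext g z
      refine Eq.trans ?_ Finset.sum_add_distrib
      exact Finset.sum_congr rfl fun x _ =>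
        (congrArg (· * _) (mul_add _ _ _)).trans (add_mul _ _ _)
    zero_mul := fun a => by
      ext g z
      exact Finset.sum_eq_zero fun x _ => (congrArg (· * _) (mul_zero _)).trans (zero_mul _)
    mul_zero := fun a => by
      ext g z
      exact Finset.sum_eq_zero fun x _ => mul_zero _
    mul_assoc := TwistedDouble.mul_assoc'
    one_mul := fun a => by
      ext g z
      simp only [mul_apply', one_apply']
      rw [Finset.sum_eq_single 1] <;> simp +contextual
    mul_one := fun a => by
      ext g z
      simp only [mul_apply', one_apply']
      rw [Finset.sum_eq_single z]
      · simp
      · intro x _ hx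
        rw [if_neg, mul_zero]
        rwa [inv_mul_eq_one]
      · simp }

theorem add_apply' (a b : TwistedDouble ω) (g x : G) : (a + b) g x = a g x + b g x := rfl
theorem zero_apply' (g x : G) : (0 : TwistedDouble ω) g x = 0 := rfl

/-- Scalar multiplication is pointwise. -/
noncomputable abbrev module' : Module ℂ (TwistedDouble ω) :=
  { smul := fun c a g x => c * a g x
    one_smul := fun a => by ext g x; exact one_mul _
    mul_smul := fun c d a => by ext g x; exact mul_assoc _ _ _
    smul_zero := fun c => by ext g x; exact mul_zero _
    smul_add := fun c a b => by ext g x; exact mul_add _ _ _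
    add_smul := fun c d a => by ext g x; exact add_mul _ _ _
    zero_smul := fun a => by ext g x; exact zero_mul _ }

noncomputable instance : Algebra ℂ (TwistedDouble ω) :=
  letI := module' (ω := ω)
  Algebra.ofModule
    (fun r a b => by
      ext g z
      refine Eq.trans ?_ (Finset.mul_sum _ _ r).symm
      exact Finset.sum_congr rfl fun x _ => by
        change _ * (r * _) * _ = _
        ring)
    (fun r a b => by
      ext g z
      refine Eq.trans ?_ (Finset.mul_sum _ _ r).symm
      exact Finset.sum_congr rfl fun x _ => by
        change _ * (r * _) = _
        ring)

theorem smul_apply' (c : ℂ) (a : TwistedDouble ω) (g x : G) : (c • a) g x = c * a g x := rfl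

open scoped Classical in
/-- The basis vector `δ_g x̄`. -/
noncomputable def δ (ω : NormalizedCocycle G) (g x : G) : TwistedDouble ω :=
  fun h y => if h = g ∧ y = x then 1 else 0

theorem sum_apply' {ι : Type*} (s : Finset ι) (f : ι → TwistedDouble ω) (g x : G) :
    (∑ i ∈ s, f i) g x = ∑ i ∈ s, f i g x := by
  classical
  induction s using Finset.induction_on with
  | empty => simp [zero_apply']
  | insert i s hi ih => rw [Finset.sum_insert hi, Finset.sum_insert hi, add_apply', ih]

theorem eq_sum (a : TwistedDouble ω) : a = ∑ g : G, ∑ x : G, a g x • δ ω g x := by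
  classical
  ext h y
  simp only [sum_apply', smul_apply']
  rw [Finset.sum_eq_single h, Finset.sum_eq_single y]
  · simp [δ]
  · intro x _ hx; simp [δ, hx.symm]
  · simp
  · intro g _ hg; simp [δ, hg.symm]
  · simp

theorem lin_ext {M : Type*} [AddCommGroup M] [Module ℂ M] {f f' : TwistedDouble ω →ₗ[ℂ] M}
    (h : ∀ g x, f (δ ω g x) = f' (δ ω g x)) : f = f' := by
  ext a
  rw [eq_sum a]
  simp [h]

/-- The linear map with prescribed values on the basis vectors. -/
noncomputable def lift {M : Type*} [AddCommGroup M] [Module ℂ M] (f : G → G → M) :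
    TwistedDouble ω →ₗ[ℂ] M where
  toFun a := ∑ g : G, ∑ x : G, a g x • f g x
  map_add' a b := by simp [add_apply', add_smul, Finset.sum_add_distrib]
  map_smul' c a := by simp [smul_apply', mul_smul, Finset.smul_sum]

@[simp] theorem lift_δ {M : Type*} [AddCommGroup M] [Module ℂ M] (f : G → G → M) (g x : G) :
    lift f (δ ω g x) = f g x := by
  change ∑ h : G, ∑ y : G, δ ω g x h y • f h y = _
  rw [Finset.sum_eq_single g, Finset.sum_eq_single x]
  · simp [δ]
  · intro y _ hy; simp [δ, hy]
  · simp
  · intro h _ hh; simp [δ, hh]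
  · simp

theorem δ_mul_of_eq {g x h : G} (y : G) (e : x⁻¹ * g * x = h) :
    δ ω g x * δ ω h y = (ω.θ g x y : ℂ) • δ ω g (x * y) := by
  classical
  subst e
  ext k z
  rw [mul_apply', smul_apply', Finset.sum_eq_single x]
  · by_cases hk : k = g
    · subst hk
      by_cases hz : z = x * y
      · subst hz; simp [δ]
      · have : ¬ x⁻¹ * z = y := fun h => hz (by rw [← h, mul_inv_cancel_left])
        simp [δ, hz, this]
    · simp [δ, hk]
  · intro w _ hw; simp [δ, hw]
  · simp

theorem δ_mul_of_ne {g x h : G} (y : G) (e : x⁻¹ * g * x ≠ h) : δ ω g x * δ ω h y = 0 := by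
  classical
  ext k z
  rw [mul_apply', zero_apply']
  refine Finset.sum_eq_zero fun w _ => ?_
  by_cases hk : k = g
  · by_cases hw : w = x
    · subst hk hw; simp [δ, e]
    · simp [δ, hw]
  · simp [δ, hk]

theorem δ_mul [DecidableEq G] (g x h y : G) : δ ω g x * δ ω h y =
    if x⁻¹ * g * x = h then (ω.θ g x y : ℂ) • δ ω g (x * y) else 0 := by
  split_ifs with e
  · exact δ_mul_of_eq y e
  · exact δ_mul_of_ne y e

theorem one_eq : (1 : TwistedDouble ω) = ∑ g : G, δ ω g 1 := by
  classical
  rw [eq_sum 1]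
  refine Finset.sum_congr rfl fun g _ => ?_
  rw [Finset.sum_eq_single 1] <;> simp +contextual [one_apply']

end TwistedDouble

namespace NormalizedCocycle

variable {G : Type*} [Group G] (ω : NormalizedCocycle G)

theorem θ_add (g x y z : G) : Additive.ofMul (ω.θ g x y) + Additive.ofMul (ω.θ g (x * y) z) =
    Additive.ofMul (ω.θ g x (y * z)) + Additive.ofMul (ω.θ (x⁻¹ * g * x) y z) := by
  simpa only [ofMul_mul] using congrArg Additive.ofMul (ω.θ_cocycle g x y z)

theorem θ_γ_add (g h x y : G) : Additive.ofMul (ω.θ g x y) + Additive.ofMul (ω.θ h x y) +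
    Additive.ofMul (ω.γ x g h) + Additive.ofMul (ω.γ y (x⁻¹ * g * x) (x⁻¹ * h * x)) =
      Additive.ofMul (ω.θ (g * h) x y) + Additive.ofMul (ω.γ (x * y) g h) := by
  simpa only [ofMul_mul] using congrArg Additive.ofMul (ω.θ_γ g h x y)

theorem θ_inv (g x : G) : ω.θ g x x⁻¹ = ω.θ (x⁻¹ * g * x) x⁻¹ x := by
  have h := ω.θ_cocycle g x x⁻¹ x
  simpa using h

theorem γ_θ_swap (x a b : G) : ω.γ x a b * ω.θ a x (x⁻¹ * b * x) =
    ω.γ x b (b⁻¹ * a * b) * ω.θ a b x := by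
  apply Additive.ofMul.injective
  simp only [θ, γ, ofMul_mul, ofMul_div, mul_inv_rev, mul_assoc, inv_mul_cancel_left,
    mul_inv_cancel_left, inv_inv]
  abel

/-- The scalar in the antipode: `S(δ_h ḡ) = sc_g(h) δ_{g⁻¹h⁻¹g} \overline{g⁻¹}`. -/
def sc (h g : G) : ℂˣ := (ω.θ h⁻¹ g g⁻¹)⁻¹ * (ω.γ g h h⁻¹)⁻¹

theorem sc_mul (h g y : G) : ω.θ h g y * ω.sc h (g * y) =
    ω.sc (g⁻¹ * h * g) y * ω.sc h g * ω.θ ((g * y)⁻¹ * h⁻¹ * (g * y)) y⁻¹ g⁻¹ := by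
  have h1 := ω.θ_γ_add h h⁻¹ g y
  have h2 := ω.θ_add h⁻¹ g y (y⁻¹ * g⁻¹)
  have h3 := ω.θ_add (g⁻¹ * h⁻¹ * g) y y⁻¹ g⁻¹
  apply Additive.ofMul.injective
  simp only [sc, ofMul_mul, ofMul_inv, mul_inv_rev, mul_assoc, inv_mul_cancel_left,
    mul_inv_cancel_left, inv_inv, mul_inv_cancel, θ_one, θ_one_left, ofMul_one, zero_add,
    add_zero] at h1 h2 h3 ⊢
  linear_combination (norm := abel) h1 - h2 + h3

theorem sc_sc (h g : G) : ω.sc h g * ω.sc (g⁻¹ * h⁻¹ * g) g⁻¹ * ω h h⁻¹ h =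
    ω (g⁻¹ * h * g) (g⁻¹ * h * g)⁻¹ (g⁻¹ * h * g) := by
  have h1 := ω.θ_γ_add h h⁻¹ g g⁻¹
  have h2 := congrArg Additive.ofMul (ω.γ_cocycle g⁻¹ (g⁻¹ * h * g) (g⁻¹ * h⁻¹ * g) (g⁻¹ * h * g))
  have h3 := congrArg Additive.ofMul (ω.θ_inv h g)
  apply Additive.ofMul.injective
  simp only [sc, ofMul_mul, ofMul_inv, mul_inv_rev, mul_assoc, inv_mul_cancel_left,
    mul_inv_cancel_left, inv_inv, mul_inv_cancel, θ_one, θ_one_left, ofMul_one, zero_add,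
    add_zero, γ_one, γ_one_left, γ_one_right, mul_one, inv_mul_cancel] at h1 h2 h3 ⊢
  linear_combination (norm := abel) h2 - h1 + h3

end NormalizedCocycle

namespace TwistedDouble

variable {G : Type*} [Group G] [Fintype G] {ω : NormalizedCocycle G}

theorem map_mul_of_δ {A : Type*} [Ring A] [Algebra ℂ A] (f : TwistedDouble ω →ₗ[ℂ] A)
    (h : ∀ g x k y, f (δ ω g x * δ ω k y) = f (δ ω g x) * f (δ ω k y)) (a b : TwistedDouble ω) :
    f (a * b) = f a * f b := by
  rw [eq_sum a, eq_sum b]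
  simp only [map_sum, Finset.sum_mul, Finset.mul_sum, map_smul, smul_mul_assoc, mul_smul_comm, h]

theorem sum_inv_mul {M : Type*} [AddCommMonoid M] (F : G → G → M) :
    ∑ g : G, ∑ h : G, F h (h⁻¹ * g) = ∑ a : G, ∑ b : G, F a b := by
  rw [Finset.sum_comm]
  exact Finset.sum_congr rfl fun h _ => Fintype.sum_equiv (Equiv.mulLeft h⁻¹) _ _ fun _ => rfl

theorem θ_γ_val (g h x y : G) : (ω.θ g x y * ω.θ h x y * ω.γ x g h *
    ω.γ y (x⁻¹ * g * x) (x⁻¹ * h * x) : ℂ) = ω.θ (g * h) x y * ω.γ (x * y) g h := by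
  exact_mod_cast congrArg Units.val (ω.θ_γ g h x y)

/-- The comultiplication on basis vectors:
`Δ(δ_g x̄) = ∑_h γ_x(h, h⁻¹g) δ_h x̄ ⊗ δ_{h⁻¹g} x̄`. -/
noncomputable def comulδ (ω : NormalizedCocycle G) (g x : G) :
    TwistedDouble ω ⊗[ℂ] TwistedDouble ω :=
  ∑ h : G, (ω.γ x h (h⁻¹ * g) : ℂ) • (δ ω h x ⊗ₜ δ ω (h⁻¹ * g) x)

theorem comul_mul_aux (g x k y : G) : lift (ω := ω) (comulδ ω) (δ ω g x * δ ω k y) =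
    comulδ ω g x * comulδ ω k y := by
  classical
  have key : ∀ h, ∑ l : G, ((ω.γ x h (h⁻¹ * g) : ℂ) • (δ ω h x ⊗ₜ[ℂ] δ ω (h⁻¹ * g) x)) *
      ((ω.γ y l (l⁻¹ * k) : ℂ) • (δ ω l y ⊗ₜ[ℂ] δ ω (l⁻¹ * k) y)) =
      if x⁻¹ * g * x = k then (ω.θ g x y : ℂ) • (ω.γ (x * y) h (h⁻¹ * g) : ℂ) •
        (δ ω h (x * y) ⊗ₜ δ ω (h⁻¹ * g) (x * y)) else 0 := fun h => by
    rw [Finset.sum_eq_single (x⁻¹ * h * x)]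
    · rw [smul_mul_smul_comm, Algebra.TensorProduct.tmul_mul_tmul, δ_mul_of_eq y rfl]
      split_ifs with hk
      · subst hk
        have e : (x⁻¹ * h * x)⁻¹ * (x⁻¹ * g * x) = x⁻¹ * (h⁻¹ * g) * x := by group
        have := θ_γ_val (ω := ω) h (h⁻¹ * g) x y
        rw [mul_inv_cancel_left] at this
        rw [e, δ_mul_of_eq y rfl, TensorProduct.smul_tmul_smul, smul_smul, smul_smul, ← this]
        congr 1
        ring
      · have e : x⁻¹ * (h⁻¹ * g) * x ≠ (x⁻¹ * h * x)⁻¹ * k := fun e => hk (by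
          rw [eq_inv_mul_iff_mul_eq] at e
          rw [← e]; group)
        rw [δ_mul_of_ne y e]
        simp
    · intro l _ hl
      rw [smul_mul_smul_comm, Algebra.TensorProduct.tmul_mul_tmul, δ_mul_of_ne y hl.symm]
      simp
    · simp
  rw [comulδ, comulδ, Finset.sum_mul_sum, Finset.sum_congr rfl fun h _ => key h, δ_mul]
  split_ifs with hk
  · rw [map_smul, lift_δ, comulδ, Finset.smul_sum]
  · simp

/-- The comultiplication. -/
noncomputable def comul (ω : NormalizedCocycle G) :
    TwistedDouble ω →ₐ[ℂ] TwistedDouble ω ⊗[ℂ] TwistedDouble ω :=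
  AlgHom.ofLinearMap (lift (comulδ ω))
    (by
      rw [one_eq, map_sum]
      simp only [lift_δ, comulδ, NormalizedCocycle.γ_one, Units.val_one, one_smul]
      rw [sum_inv_mul (fun a b => δ ω a 1 ⊗ₜ[ℂ] δ ω b 1), Algebra.TensorProduct.one_def, one_eq]
      simp only [TensorProduct.sum_tmul, TensorProduct.tmul_sum]
      exact Finset.sum_comm)
    (map_mul_of_δ _ fun g x k y => by rw [comul_mul_aux, lift_δ, lift_δ])

theorem comul_δ (g x : G) : comul ω (δ ω g x) = comulδ ω g x := lift_δ _ g x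

open scoped Classical in
/-- The counit, `ε(δ_g x̄) = δ_{g,e}`. -/
noncomputable def counit (ω : NormalizedCocycle G) : TwistedDouble ω →ₐ[ℂ] ℂ :=
  AlgHom.ofLinearMap (lift fun g _ => if g = 1 then 1 else 0)
    (by rw [one_eq, map_sum]; simp)
    (map_mul_of_δ _ fun g x k y => by
      rw [δ_mul]
      split_ifs with h
      · subst h
        rw [map_smul, lift_δ, lift_δ, lift_δ]
        by_cases hg : g = 1
        · subst hg; simp
        · simp [hg]
      · rw [map_zero, lift_δ, lift_δ]
        by_cases hg : g = 1
        · subst hg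
          have : k ≠ 1 := fun hk => h (by simp [hk])
          simp [this]
        · simp [hg])

theorem counit_δ [DecidableEq G] (g x : G) : counit ω (δ ω g x) = if g = 1 then 1 else 0 := by
  refine (lift_δ (ω := ω) _ g x).trans ?_
  congr

/-- The antipode, `S(δ_h ḡ) = θ_{h⁻¹}(g, g⁻¹)⁻¹ γ_g(h, h⁻¹)⁻¹ δ_{g⁻¹h⁻¹g} \overline{g⁻¹}`. -/
noncomputable def antipode (ω : NormalizedCocycle G) : TwistedDouble ω →ₗ[ℂ] TwistedDouble ω :=
  lift fun h g => (ω.sc h g : ℂ) • δ ω (g⁻¹ * h⁻¹ * g) g⁻¹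

theorem antipode_δ (h g : G) :
    antipode ω (δ ω h g) = (ω.sc h g : ℂ) • δ ω (g⁻¹ * h⁻¹ * g) g⁻¹ := lift_δ _ h g

theorem antipode_e (h : G) : antipode ω (δ ω h 1) = δ ω h⁻¹ 1 := by
  simp [antipode_δ, NormalizedCocycle.sc]

theorem antipode_mul_aux (g x k y : G) : antipode ω (δ ω g x * δ ω k y) =
    antipode ω (δ ω k y) * antipode ω (δ ω g x) := by
  classical
  rw [antipode_δ, antipode_δ, smul_mul_smul_comm, δ_mul, δ_mul]
  have e : (y⁻¹)⁻¹ * (y⁻¹ * k⁻¹ * y) * y⁻¹ = x⁻¹ * g⁻¹ * x ↔ x⁻¹ * g * x = k := by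
    have h1 : (y⁻¹)⁻¹ * (y⁻¹ * k⁻¹ * y) * y⁻¹ = k⁻¹ := by group
    have h2 : x⁻¹ * g⁻¹ * x = (x⁻¹ * g * x)⁻¹ := by simp [mul_assoc]
    rw [h1, h2, inv_inj, eq_comm]
  by_cases h : x⁻¹ * g * x = k
  · rw [if_pos h, if_pos (e.2 h), map_smul, antipode_δ, smul_smul, smul_smul]
    subst h
    have h1 : y⁻¹ * (x⁻¹ * g * x)⁻¹ * y = (x * y)⁻¹ * g⁻¹ * (x * y) := by group
    rw [h1, mul_inv_rev x y]
    congr 1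
    have := congrArg Units.val (ω.sc_mul g x y)
    rw [mul_inv_rev x y] at this
    exact_mod_cast this
  · rw [if_neg h, if_neg (fun h' => h (e.1 h')), map_zero, smul_zero]

theorem antipode_mul (a b : TwistedDouble ω) :
    antipode ω (a * b) = antipode ω b * antipode ω a := by
  refine LinearMap.congr_fun (f := antipode ω ∘ₗ LinearMap.mulRight ℂ b)
    (g := LinearMap.mulLeft ℂ (antipode ω b) ∘ₗ antipode ω) (lin_ext fun g x => ?_) a
  exact LinearMap.congr_fun (f := antipode ω ∘ₗ LinearMap.mulLeft ℂ (δ ω g x))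
    (g := LinearMap.mulRight ℂ (antipode ω (δ ω g x)) ∘ₗ antipode ω)
    (lin_ext fun k y => antipode_mul_aux g x k y) b

/-- The element `∑_g f(g) δ_g ē`. -/
noncomputable def diag (f : G → ℂˣ) : TwistedDouble ω := ∑ g : G, (f g : ℂ) • δ ω g 1

theorem diag_mul_δ (f : G → ℂˣ) (g x : G) :
    diag f * δ ω g x = (f g : ℂ) • δ ω g x := by
  rw [diag, Finset.sum_mul, Finset.sum_eq_single g]
  · rw [smul_mul_assoc, δ_mul_of_eq x (by group)]
    simp
  · intro h _ hh
    rw [smul_mul_assoc, δ_mul_of_ne x (by simpa using hh), smul_zero]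
  · simp

theorem δ_mul_diag (f : G → ℂˣ) (g x : G) :
    δ ω g x * diag f = (f (x⁻¹ * g * x) : ℂ) • δ ω g x := by
  rw [diag, Finset.mul_sum, Finset.sum_eq_single (x⁻¹ * g * x)]
  · rw [mul_smul_comm, δ_mul_of_eq 1 rfl]
    simp
  · intro h _ hh
    rw [mul_smul_comm, δ_mul_of_ne 1 hh.symm, smul_zero]
  · simp

theorem diag_mul_diag (f f' : G → ℂˣ) :
    diag (ω := ω) f * diag f' = diag fun g => f g * f' g := by
  conv_lhs => rw [diag, Finset.sum_mul]
  simp only [smul_mul_assoc, δ_mul_diag, smul_smul]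
  simp [diag]

theorem diag_one : diag (ω := ω) (fun _ => 1) = 1 := by
  simp [diag, one_eq]

/-- The element `β = ∑_g ω(g, g⁻¹, g) δ_g ē`, as a unit. -/
noncomputable def β (ω : NormalizedCocycle G) : (TwistedDouble ω)ˣ where
  val := diag fun g => ω g g⁻¹ g
  inv := diag fun g => (ω g g⁻¹ g)⁻¹
  val_inv := by simp [diag_mul_diag, diag_one]
  inv_val := by simp [diag_mul_diag, diag_one]

theorem antipode_antipode_aux (h : TwistedDouble ω) :
    antipode ω (antipode ω h) * (↑(β ω)⁻¹ : TwistedDouble ω) = (↑(β ω)⁻¹ : TwistedDouble ω) * h := by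
  refine LinearMap.congr_fun (f := LinearMap.mulRight ℂ (↑(β ω)⁻¹ : TwistedDouble ω) ∘ₗ antipode ω
    ∘ₗ antipode ω) (g := LinearMap.mulLeft ℂ (↑(β ω)⁻¹ : TwistedDouble ω)) (lin_ext fun g x => ?_) h
  change antipode ω (antipode ω (δ ω g x)) * diag (fun g => (ω g g⁻¹ g)⁻¹) =
    diag (fun g => (ω g g⁻¹ g)⁻¹) * δ ω g x
  have e : (x⁻¹)⁻¹ * (x⁻¹ * g⁻¹ * x)⁻¹ * x⁻¹ = g := by group
  rw [antipode_δ, map_smul, antipode_δ, e, inv_inv, smul_smul, smul_mul_assoc, δ_mul_diag,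
    diag_mul_δ, smul_smul]
  congr 1
  have := congrArg Units.val (ω.sc_sc g x)
  push_cast at this ⊢
  rw [← this]
  field_simp

theorem antipode_bijective : Function.Bijective (antipode ω) := by
  have : Function.Bijective (antipode ω ∘ antipode ω) := by
    have e : (antipode ω ∘ antipode ω) = fun h : TwistedDouble ω =>
        (↑(β ω)⁻¹ : TwistedDouble ω) * h * (β ω : TwistedDouble ω) := by
      funext h
      rw [← antipode_antipode_aux, mul_assoc, Units.inv_mul, mul_one]
      rfl
    rw [e]
    exact ⟨fun a b h => by simpa using h, fun b => ⟨β ω * b * (↑(β ω)⁻¹ : TwistedDouble ω), by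
      simp [mul_assoc]⟩⟩
  exact ⟨this.1.of_comp, this.2.of_comp⟩

end TwistedDouble

namespace TwistedDouble

variable {G : Type*} [Group G] [Fintype G] {ω : NormalizedCocycle G}

theorem δ_one_mul (g x : G) : δ ω g 1 * δ ω g x = δ ω g x := by
  rw [δ_mul_of_eq x (by group)]; simp

theorem δ_mul_one (g x : G) : δ ω g x * δ ω (x⁻¹ * g * x) 1 = δ ω g x := by
  rw [δ_mul_of_eq 1 rfl]; simp

/-- The element `∑ f(g, h, k) δ_g ē ⊗ δ_h ē ⊗ δ_k ē`. -/
noncomputable def diag₃ (ω : NormalizedCocycle G) (f : G → G → G → ℂˣ) : Tensor₃ (TwistedDouble ω) :=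
  ∑ g : G, ∑ h : G, ∑ k : G, (f g h k : ℂ) • (δ ω g 1 ⊗ₜ (δ ω h 1 ⊗ₜ δ ω k 1))

/-- The element `∑ f(g, h, k, l) δ_g ē ⊗ δ_h ē ⊗ δ_k ē ⊗ δ_l ē`. -/
noncomputable def diag₄ (ω : NormalizedCocycle G) (f : G → G → G → G → ℂˣ) :
    Tensor₄ (TwistedDouble ω) := ∑ g : G, δ ω g 1 ⊗ₜ diag₃ ω (f g)

theorem tmul_mul_diag₃ (f : G → G → G → ℂˣ) (a b c x y z : G) :
    (δ ω a x ⊗ₜ[ℂ] (δ ω b y ⊗ₜ[ℂ] δ ω c z)) * diag₃ ω f =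
      (f (x⁻¹ * a * x) (y⁻¹ * b * y) (z⁻¹ * c * z) : ℂ) •
        (δ ω a x ⊗ₜ[ℂ] (δ ω b y ⊗ₜ[ℂ] δ ω c z)) := by
  simp only [diag₃, Finset.mul_sum, mul_smul_comm, Algebra.TensorProduct.tmul_mul_tmul]
  rw [Finset.sum_eq_single (x⁻¹ * a * x), Finset.sum_eq_single (y⁻¹ * b * y),
    Finset.sum_eq_single (z⁻¹ * c * z)]
  · simp [δ_mul_one]
  · intro k _ hk; simp [δ_mul_of_ne 1 hk.symm]
  · simp
  · intro k _ hk; simp [δ_mul_of_ne 1 hk.symm]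
  · simp
  · intro k _ hk; simp [δ_mul_of_ne 1 hk.symm]
  · simp

theorem diag₃_mul_tmul (f : G → G → G → ℂˣ) (a b c x y z : G) :
    diag₃ ω f * (δ ω a x ⊗ₜ[ℂ] (δ ω b y ⊗ₜ[ℂ] δ ω c z)) =
      (f a b c : ℂ) • (δ ω a x ⊗ₜ[ℂ] (δ ω b y ⊗ₜ[ℂ] δ ω c z)) := by
  have h : ∀ {a k x : G}, k ≠ a → δ ω k 1 * δ ω a x = 0 := fun hk =>
    δ_mul_of_ne _ (by simpa using hk)
  simp only [diag₃, Finset.sum_mul, smul_mul_assoc, Algebra.TensorProduct.tmul_mul_tmul]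
  rw [Finset.sum_eq_single a, Finset.sum_eq_single b, Finset.sum_eq_single c]
  · simp [δ_one_mul]
  · intro k _ hk; simp [h hk]
  · simp
  · intro k _ hk; simp [h hk]
  · simp
  · intro k _ hk; simp [h hk]
  · simp

theorem diag₃_mul (f f' : G → G → G → ℂˣ) :
    diag₃ ω f * diag₃ ω f' = diag₃ ω fun a b c => f a b c * f' a b c := by
  conv_lhs => rw [diag₃]
  simp only [Finset.sum_mul, smul_mul_assoc, tmul_mul_diag₃, smul_smul]
  simp [diag₃]

theorem sum_tmul_mul {A : Type*} [Ring A] [Algebra ℂ A] (F F' : G → A) :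
    (∑ g : G, δ ω g 1 ⊗ₜ[ℂ] F g) * (∑ g : G, δ ω g 1 ⊗ₜ[ℂ] F' g) =
      ∑ g : G, δ ω g 1 ⊗ₜ[ℂ] (F g * F' g) := by
  rw [Finset.sum_mul]
  refine Finset.sum_congr rfl fun g _ => ?_
  rw [Finset.mul_sum, Finset.sum_eq_single g]
  · rw [Algebra.TensorProduct.tmul_mul_tmul, δ_one_mul]
  · intro h _ hh
    rw [Algebra.TensorProduct.tmul_mul_tmul, δ_mul_of_ne _ (by simpa using hh.symm),
      TensorProduct.zero_tmul]
  · simp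

theorem diag₄_mul (f f' : G → G → G → G → ℂˣ) :
    (diag₄ ω f * diag₄ ω f' : Tensor₄ (TwistedDouble ω)) =
      diag₄ ω fun a b c d => f a b c d * f' a b c d :=
  (sum_tmul_mul (fun g => diag₃ ω (f g)) (fun g => diag₃ ω (f' g))).trans <|
    Finset.sum_congr rfl fun g _ => by rw [diag₃_mul]

theorem one_tensor₃ : (1 : Tensor₃ (TwistedDouble ω)) =
    ∑ g : G, ∑ h : G, ∑ k : G, δ ω g 1 ⊗ₜ (δ ω h 1 ⊗ₜ δ ω k 1) := by
  rw [Algebra.TensorProduct.one_def, Algebra.TensorProduct.one_def, one_eq]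
  simp only [TensorProduct.sum_tmul, TensorProduct.tmul_sum]
  rw [Finset.sum_comm]
  rw [Finset.sum_congr rfl fun x _ => Finset.sum_comm]
  rw [Finset.sum_comm]

theorem diag₃_one : diag₃ ω (fun _ _ _ => 1) = 1 := by
  simp [diag₃, one_tensor₃]

/-- The coassociator `Φ = ∑ ω(g, h, k) δ_g ē ⊗ δ_h ē ⊗ δ_k ē`. -/
noncomputable def Φ (ω : NormalizedCocycle G) : (Tensor₃ (TwistedDouble ω))ˣ where
  val := diag₃ ω ω
  inv := diag₃ ω fun g h k => (ω g h k)⁻¹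
  val_inv := by simp [diag₃_mul, diag₃_one]
  inv_val := by simp [diag₃_mul, diag₃_one]

theorem tmul_mul_tmul_R (f : G → G → ℂˣ) (a b x y : G) :
    (δ ω b x ⊗ₜ[ℂ] δ ω a y) * (∑ g : G, ∑ h : G, (f g h : ℂ) • (δ ω g 1 ⊗ₜ[ℂ] δ ω h g)) =
      ((f (x⁻¹ * b * x) (y⁻¹ * a * y) : ℂ) * ω.θ a y (x⁻¹ * b * x)) •
        (δ ω b x ⊗ₜ[ℂ] δ ω a (y * (x⁻¹ * b * x))) := by
  simp only [Finset.mul_sum, mul_smul_comm, Algebra.TensorProduct.tmul_mul_tmul]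
  rw [Finset.sum_eq_single (x⁻¹ * b * x), Finset.sum_eq_single (y⁻¹ * a * y)]
  · rw [δ_mul_of_eq _ rfl, δ_mul_of_eq _ rfl]
    simp [TensorProduct.tmul_smul, smul_smul]
  · intro k _ hk; simp [δ_mul_of_ne _ hk.symm]
  · simp
  · intro k _ hk; simp [δ_mul_of_ne 1 hk.symm]
  · simp

theorem one_tensor₂ : (1 : TwistedDouble ω ⊗[ℂ] TwistedDouble ω) =
    ∑ g : G, ∑ h : G, δ ω g 1 ⊗ₜ δ ω h 1 := by
  rw [Algebra.TensorProduct.one_def, one_eq]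
  simp only [TensorProduct.sum_tmul, TensorProduct.tmul_sum]
  rw [Finset.sum_comm]

/-- The element `∑ δ_g ē ⊗ δ_h ḡ`. -/
noncomputable def Rel (ω : NormalizedCocycle G) : TwistedDouble ω ⊗[ℂ] TwistedDouble ω :=
  ∑ g : G, ∑ h : G, δ ω g 1 ⊗ₜ δ ω h g

theorem tmul_mul_Rel (a b x y : G) : (δ ω b x ⊗ₜ[ℂ] δ ω a y) * Rel ω =
    (ω.θ a y (x⁻¹ * b * x) : ℂ) • (δ ω b x ⊗ₜ[ℂ] δ ω a (y * (x⁻¹ * b * x))) := by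
  have h := tmul_mul_tmul_R (ω := ω) (fun _ _ => 1) a b x y
  simpa [Rel] using h

/-- The inverse of `∑ δ_g ē ⊗ δ_h ḡ`. -/
noncomputable def Rinv (ω : NormalizedCocycle G) : TwistedDouble ω ⊗[ℂ] TwistedDouble ω :=
  ∑ g : G, ∑ h : G, (((ω.θ h g⁻¹ g)⁻¹ : ℂˣ) : ℂ) • (δ ω g 1 ⊗ₜ δ ω h g⁻¹)

theorem tmul_mul_Rinv (a b x y : G) : (δ ω b x ⊗ₜ[ℂ] δ ω a y) * Rinv ω =
    ((((ω.θ (y⁻¹ * a * y) (x⁻¹ * b * x)⁻¹ (x⁻¹ * b * x))⁻¹ : ℂˣ) : ℂ) *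
      ω.θ a y (x⁻¹ * b * x)⁻¹) •
        (δ ω b x ⊗ₜ[ℂ] δ ω a (y * (x⁻¹ * b * x)⁻¹)) := by
  simp only [Rinv, Finset.mul_sum, mul_smul_comm, Algebra.TensorProduct.tmul_mul_tmul]
  rw [Finset.sum_eq_single (x⁻¹ * b * x), Finset.sum_eq_single (y⁻¹ * a * y)]
  · rw [δ_mul_of_eq _ rfl, δ_mul_of_eq _ rfl]
    simp [TensorProduct.tmul_smul, smul_smul]
  · intro k _ hk; simp [δ_mul_of_ne _ hk.symm]
  · simp
  · intro k _ hk; simp [δ_mul_of_ne 1 hk.symm]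
  · simp

/-- The universal `R`-matrix `R = ∑ δ_g ē ⊗ δ_h ḡ`. -/
noncomputable def R (ω : NormalizedCocycle G) :
    (TwistedDouble ω ⊗[ℂ] TwistedDouble ω)ˣ where
  val := Rel ω
  inv := Rinv ω
  val_inv := by
    conv_lhs => rw [Rel]
    rw [one_tensor₂]
    simp only [Finset.sum_mul, tmul_mul_Rinv]
    refine Finset.sum_congr rfl fun g _ => Finset.sum_congr rfl fun h _ => ?_
    simp [ω.θ_inv h g]
  inv_val := by
    conv_lhs => rw [Rinv]
    rw [one_tensor₂]
    simp only [Finset.sum_mul, smul_mul_assoc, tmul_mul_Rel]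
    refine Finset.sum_congr rfl fun g _ => Finset.sum_congr rfl fun h _ => ?_
    simp [smul_smul]

theorem R_mul_tmul (a b x y : G) : Rel ω * (δ ω a x ⊗ₜ[ℂ] δ ω b y) =
    (ω.θ (a * b * a⁻¹) a y : ℂ) • (δ ω a x ⊗ₜ[ℂ] δ ω (a * b * a⁻¹) (a * y)) := by
  simp only [Rel, Finset.sum_mul, Algebra.TensorProduct.tmul_mul_tmul]
  rw [Finset.sum_eq_single a, Finset.sum_eq_single (a * b * a⁻¹)]
  · rw [δ_one_mul, δ_mul_of_eq _ (by group), TensorProduct.tmul_smul]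
  · intro k _ hk
    rw [δ_mul_of_ne y (fun e => hk (by rw [← e]; group)), TensorProduct.tmul_zero]
  · simp
  · intro k _ hk
    have : δ ω k 1 * δ ω a x = 0 := δ_mul_of_ne _ (by simpa using hk)
    simp [this]
  · simp

section Laws

theorem coassoc_δ (g x : G) :
    Algebra.TensorProduct.assoc ℂ ℂ ℂ _ _ _ (Algebra.TensorProduct.map (comul ω)
      (AlgHom.id ℂ (TwistedDouble ω)) (comul ω (δ ω g x))) =
      diag₃ ω ω * Algebra.TensorProduct.map (AlgHom.id ℂ (TwistedDouble ω)) (comul ω)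
        (comul ω (δ ω g x)) * diag₃ ω fun g h k => (ω g h k)⁻¹ := by
  rw [comul_δ, comulδ]
  simp only [map_sum, map_smul, Algebra.TensorProduct.map_tmul, AlgHom.id_apply, comul_δ, comulδ,
    TensorProduct.sum_tmul, TensorProduct.tmul_sum, TensorProduct.tmul_smul, Finset.smul_sum,
    ← TensorProduct.smul_tmul', Algebra.TensorProduct.assoc_tmul, smul_smul, Finset.mul_sum,
    Finset.sum_mul, mul_smul_comm, smul_mul_assoc, diag₃_mul_tmul, tmul_mul_diag₃]
  rw [Finset.sum_comm]
  refine Finset.sum_congr rfl fun k _ => Fintype.sum_equiv (Equiv.mulLeft k⁻¹) _ _ fun h => ?_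
  have e : (k⁻¹ * h)⁻¹ * (k⁻¹ * g) = h⁻¹ * g := by group
  have e2 : k⁻¹ * h * (h⁻¹ * g) = k⁻¹ * g := by group
  simp only [Equiv.coe_mulLeft, e]
  congr 1
  have := congrArg Units.val (ω.γ_cocycle x k (k⁻¹ * h) (h⁻¹ * g))
  rw [mul_inv_cancel_left, e2] at this
  push_cast at this ⊢
  field_simp
  linear_combination this

theorem comul_op_δ (g x : G) :
    Algebra.TensorProduct.comm ℂ _ _ (comul ω (δ ω g x)) * Rel ω = Rel ω * comul ω (δ ω g x) := by
  rw [comul_δ, comulδ]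
  simp only [map_sum, map_smul, Algebra.TensorProduct.comm_tmul, Finset.sum_mul, Finset.mul_sum,
    smul_mul_assoc, mul_smul_comm, tmul_mul_Rel, R_mul_tmul, smul_smul]
  refine Fintype.sum_equiv ((Equiv.inv G).trans (Equiv.mulRight g)) _ _ fun h => ?_
  have e1 : x * (x⁻¹ * (h⁻¹ * g) * x) = h⁻¹ * g * x := by group
  have e2 : h⁻¹ * g * ((h⁻¹ * g)⁻¹ * g) * (h⁻¹ * g)⁻¹ = h := by group
  have e3 : (h⁻¹ * g)⁻¹ * h * (h⁻¹ * g) = (h⁻¹ * g)⁻¹ * g := by group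
  simp only [Equiv.trans_apply, Equiv.inv_apply, Equiv.coe_mulRight, e1, e2]
  congr 1
  have := congrArg Units.val (ω.γ_θ_swap x h (h⁻¹ * g))
  rw [e3] at this
  exact_mod_cast this

theorem counit_left_δ (g x : G) : Algebra.TensorProduct.lid ℂ _
    (Algebra.TensorProduct.map (counit ω) (AlgHom.id ℂ _) (comul ω (δ ω g x))) = δ ω g x := by
  classical
  rw [comul_δ, comulδ]
  simp only [map_sum, map_smul, Algebra.TensorProduct.map_tmul, counit_δ, AlgHom.id_apply,
    Algebra.TensorProduct.lid_tmul]
  rw [Finset.sum_eq_single 1] <;> simp +contextual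

theorem counit_right_δ (g x : G) : Algebra.TensorProduct.rid ℂ ℂ _
    (Algebra.TensorProduct.map (AlgHom.id ℂ _) (counit ω) (comul ω (δ ω g x))) = δ ω g x := by
  classical
  rw [comul_δ, comulδ]
  simp only [map_sum, map_smul, Algebra.TensorProduct.map_tmul, counit_δ, AlgHom.id_apply,
    Algebra.TensorProduct.rid_tmul]
  rw [Finset.sum_eq_single g]
  · simp
  · intro h _ hh
    rw [if_neg (by rw [inv_mul_eq_one]; exact hh)]; simp
  · simp

theorem sum_mul_eq {M : Type*} [AddCommMonoid M] [Module ℂ M] (f : G → ℂˣ) (F : G → G → M) :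
    ∑ g : G, (f g : ℂ) • ∑ h : G, F h (h⁻¹ * g) = ∑ a : G, ∑ b : G, (f (a * b) : ℂ) • F a b := by
  rw [← sum_inv_mul]
  simp [Finset.smul_sum]

theorem comul_e (g : G) : comul ω (δ ω g 1) = ∑ h : G, δ ω h 1 ⊗ₜ δ ω (h⁻¹ * g) 1 := by
  rw [comul_δ, comulδ]; simp

theorem map₁ (f : G → G → G → ℂˣ) : Algebra.TensorProduct.map (AlgHom.id ℂ (TwistedDouble ω))
    (Algebra.TensorProduct.map (AlgHom.id ℂ (TwistedDouble ω)) (comul ω)) (diag₃ ω f) =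
      diag₄ ω fun a b c d => f a b (c * d) := by
  simp only [diag₃, diag₄, TensorProduct.tmul_sum, TensorProduct.tmul_smul, map_sum, map_smul, Algebra.TensorProduct.map_tmul, AlgHom.id_apply,
    comul_e, TensorProduct.tmul_sum]
  refine Finset.sum_congr rfl fun a _ => Finset.sum_congr rfl fun b _ => ?_
  exact sum_mul_eq (fun k => f a b k)
    (fun c d => (δ ω a 1 ⊗ₜ[ℂ] (δ ω b 1 ⊗ₜ[ℂ] (δ ω c 1 ⊗ₜ[ℂ] δ ω d 1))))

theorem map₂ (f : G → G → G → ℂˣ) :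
    Algebra.TensorProduct.assoc ℂ ℂ ℂ _ _ _ (Algebra.TensorProduct.map (comul ω)
      (AlgHom.id ℂ (TwistedDouble ω ⊗[ℂ] TwistedDouble ω)) (diag₃ ω f)) =
      diag₄ ω fun a b c d => f (a * b) c d := by
  simp only [diag₃, diag₄, TensorProduct.tmul_sum, TensorProduct.tmul_smul, map_sum, map_smul, Algebra.TensorProduct.map_tmul, AlgHom.id_apply,
    comul_e, TensorProduct.sum_tmul, Algebra.TensorProduct.assoc_tmul]
  have h : ∀ c d : G, ∑ g : G, (f g c d : ℂ) • ∑ h : G, (δ ω h 1 ⊗ₜ[ℂ] (δ ω (h⁻¹ * g) 1 ⊗ₜ[ℂ]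
      (δ ω c 1 ⊗ₜ[ℂ] δ ω d 1))) = ∑ a : G, ∑ b : G, (f (a * b) c d : ℂ) •
        (δ ω a 1 ⊗ₜ[ℂ] (δ ω b 1 ⊗ₜ[ℂ] (δ ω c 1 ⊗ₜ[ℂ] δ ω d 1))) := fun c d =>
    sum_mul_eq (fun k => f k c d)
      (fun a b => (δ ω a 1 ⊗ₜ[ℂ] (δ ω b 1 ⊗ₜ[ℂ] (δ ω c 1 ⊗ₜ[ℂ] δ ω d 1))))
  rw [Finset.sum_comm, Finset.sum_congr rfl fun c _ => Finset.sum_comm,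
    Finset.sum_congr rfl fun c _ => Finset.sum_congr rfl fun d _ => h c d]
  rw [Finset.sum_congr rfl fun c _ => Finset.sum_comm]
  rw [Finset.sum_comm]
  refine Finset.sum_congr rfl fun a _ => ?_
  rw [Finset.sum_congr rfl fun c _ => Finset.sum_comm]
  rw [Finset.sum_comm]

theorem map₃ (f : G → G → G → ℂˣ) : Algebra.TensorProduct.map (AlgHom.id ℂ (TwistedDouble ω))
    (Algebra.TensorProduct.assoc ℂ ℂ ℂ (TwistedDouble ω) (TwistedDouble ω) (TwistedDouble ω) :
      (TwistedDouble ω ⊗[ℂ] TwistedDouble ω) ⊗[ℂ] TwistedDouble ω →ₐ[ℂ] Tensor₃ (TwistedDouble ω))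
      (Algebra.TensorProduct.map (AlgHom.id ℂ (TwistedDouble ω))
    (Algebra.TensorProduct.map (comul ω) (AlgHom.id ℂ (TwistedDouble ω))) (diag₃ ω f)) =
      diag₄ ω fun a b c d => f a (b * c) d := by
  simp only [diag₃, diag₄, TensorProduct.tmul_sum, TensorProduct.tmul_smul, map_sum, map_smul, Algebra.TensorProduct.map_tmul, AlgHom.id_apply,
    comul_e, TensorProduct.sum_tmul, TensorProduct.tmul_sum, AlgEquiv.coe_toAlgHom,
    Algebra.TensorProduct.assoc_tmul]
  refine Finset.sum_congr rfl fun a _ => ?_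
  have h : ∀ d : G, ∑ g : G, (f a g d : ℂ) • ∑ h : G, (δ ω a 1 ⊗ₜ[ℂ] (δ ω h 1 ⊗ₜ[ℂ]
      (δ ω (h⁻¹ * g) 1 ⊗ₜ[ℂ] δ ω d 1))) = ∑ b : G, ∑ c : G, (f a (b * c) d : ℂ) •
        (δ ω a 1 ⊗ₜ[ℂ] (δ ω b 1 ⊗ₜ[ℂ] (δ ω c 1 ⊗ₜ[ℂ] δ ω d 1))) := fun d =>
    sum_mul_eq (fun k => f a k d)
      (fun b c => (δ ω a 1 ⊗ₜ[ℂ] (δ ω b 1 ⊗ₜ[ℂ] (δ ω c 1 ⊗ₜ[ℂ] δ ω d 1))))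
  rw [Finset.sum_comm, Finset.sum_congr rfl fun d _ => h d, Finset.sum_comm]
  exact Finset.sum_congr rfl fun b _ => Finset.sum_comm

theorem map₄ (f : G → G → G → ℂˣ) : Algebra.TensorProduct.map (AlgHom.id ℂ (TwistedDouble ω))
    (Algebra.TensorProduct.assoc ℂ ℂ ℂ (TwistedDouble ω) (TwistedDouble ω) (TwistedDouble ω) :
      (TwistedDouble ω ⊗[ℂ] TwistedDouble ω) ⊗[ℂ] TwistedDouble ω →ₐ[ℂ] Tensor₃ (TwistedDouble ω))
    (Algebra.TensorProduct.assoc ℂ ℂ ℂ _ _ _ (diag₃ ω f ⊗ₜ[ℂ] (1 : TwistedDouble ω))) =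
      diag₄ ω fun a b c _ => f a b c := by
  simp only [diag₃, diag₄, TensorProduct.tmul_sum, TensorProduct.tmul_smul, TensorProduct.tmul_sum, one_eq, map_sum, map_smul, Algebra.TensorProduct.map_tmul,
    AlgHom.id_apply, TensorProduct.sum_tmul, TensorProduct.tmul_sum, AlgEquiv.coe_toAlgHom,
    Algebra.TensorProduct.assoc_tmul, ← TensorProduct.smul_tmul']
  rw [Finset.sum_comm]
  refine Finset.sum_congr rfl fun a _ => ?_
  rw [Finset.sum_comm]
  refine Finset.sum_congr rfl fun b _ => ?_
  rw [Finset.sum_comm]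

theorem map₅ (f : G → G → G → ℂˣ) : ((1 : TwistedDouble ω) ⊗ₜ[ℂ] diag₃ ω f) =
      diag₄ ω fun _ b c d => f b c d := by
  rw [one_eq, TensorProduct.sum_tmul, diag₄]

end Laws

end TwistedDouble

namespace TwistedDouble

variable {G : Type*} [Group G] [Fintype G] {ω : NormalizedCocycle G}

theorem pentagon_diag : (diag₄ ω (fun a b c d => (ω a b (c * d))⁻¹) *
    diag₄ ω (fun a b c d => (ω (a * b) c d)⁻¹) : Tensor₄ (TwistedDouble ω)) =
    diag₄ ω (fun _ b c d => (ω b c d)⁻¹) *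
      (diag₄ ω (fun a b c d => (ω a (b * c) d)⁻¹) * diag₄ ω (fun a b c _ => (ω a b c)⁻¹)) := by
  rw [diag₄_mul, diag₄_mul, diag₄_mul]
  congr 1
  funext a b c d
  rw [← mul_inv, ← mul_inv, ← mul_inv, inv_inj, mul_comm, ← ω.cocycle, mul_assoc]

theorem counit_Φ_aux : Algebra.TensorProduct.map (AlgHom.id ℂ (TwistedDouble ω))
    ((Algebra.TensorProduct.lid ℂ (TwistedDouble ω) :
      ℂ ⊗[ℂ] TwistedDouble ω →ₐ[ℂ] TwistedDouble ω).comp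
      (Algebra.TensorProduct.map (counit ω) (AlgHom.id ℂ (TwistedDouble ω)))) (diag₃ ω ω) = 1 := by
  classical
  simp only [diag₃, map_sum, map_smul, Algebra.TensorProduct.map_tmul, AlgHom.comp_apply,
    counit_δ, AlgHom.id_apply]
  rw [one_tensor₂]
  refine Finset.sum_congr rfl fun a _ => ?_
  rw [Finset.sum_eq_single 1]
  · simp
  · intro b _ hb
    simp [hb]
  · simp

theorem antipode_left_aux (h : TwistedDouble ω) : LinearMap.mul' ℂ (TwistedDouble ω)
    (TensorProduct.map (antipode ω) (LinearMap.mulLeft ℂ 1) (comul ω h)) =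
      counit ω h • (1 : TwistedDouble ω) := by
  classical
  refine LinearMap.congr_fun (f := LinearMap.mul' ℂ (TwistedDouble ω) ∘ₗ
    TensorProduct.map (antipode ω) (LinearMap.mulLeft ℂ 1) ∘ₗ (comul ω).toLinearMap)
    (g := (counit ω).toLinearMap.smulRight 1) (lin_ext fun g x => ?_) h
  simp only [LinearMap.comp_apply, AlgHom.toLinearMap_apply, LinearMap.smulRight_apply, comul_δ,
    comulδ, counit_δ, map_sum, map_smul, TensorProduct.map_tmul, LinearMap.mul'_apply,
    LinearMap.mulLeft_apply, one_mul, antipode_δ, smul_mul_assoc]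
  split_ifs with hg
  · subst hg
    rw [one_smul, one_eq, ← Fintype.sum_equiv (Equiv.inv G |>.trans (MulAut.conj x⁻¹).toEquiv) _
      (fun g => δ ω g 1) fun _ => rfl]
    refine Finset.sum_congr rfl fun h _ => ?_
    have h1 := congrArg Units.val (ω.θ_inv h⁻¹ x)
    rw [mul_one, δ_mul_of_eq x (by group), NormalizedCocycle.sc, ← h1, smul_smul, smul_smul]
    have h2 : (Equiv.inv G |>.trans (MulAut.conj x⁻¹).toEquiv) h = x⁻¹ * h⁻¹ * x := by simp
    rw [h2, inv_mul_cancel]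
    convert one_smul ℂ _ using 2
    push_cast
    field_simp
  · rw [zero_smul]
    refine Finset.sum_eq_zero fun h _ => ?_
    rw [δ_mul_of_ne x, smul_zero, smul_zero]
    intro e
    apply hg
    have h3 : (x⁻¹)⁻¹ * (x⁻¹ * h⁻¹ * x) * x⁻¹ = h⁻¹ := by group
    rw [h3] at e
    exact (mul_eq_left.1 e.symm)

theorem antipode_right_aux (h : TwistedDouble ω) : LinearMap.mul' ℂ (TwistedDouble ω)
    (TensorProduct.map LinearMap.id (LinearMap.mulLeft ℂ (β ω : TwistedDouble ω) ∘ₗ antipode ω)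
      (comul ω h)) = counit ω h • (β ω : TwistedDouble ω) := by
  classical
  refine LinearMap.congr_fun (f := LinearMap.mul' ℂ (TwistedDouble ω) ∘ₗ
    TensorProduct.map LinearMap.id (LinearMap.mulLeft ℂ (β ω : TwistedDouble ω) ∘ₗ antipode ω) ∘ₗ
      (comul ω).toLinearMap)
    (g := (counit ω).toLinearMap.smulRight (β ω : TwistedDouble ω)) (lin_ext fun g x => ?_) h
  have hb : (β ω : TwistedDouble ω) = diag fun g => ω g g⁻¹ g := rfl
  simp only [LinearMap.comp_apply, AlgHom.toLinearMap_apply, LinearMap.smulRight_apply, comul_δ,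
    comulδ, counit_δ, map_sum, map_smul, TensorProduct.map_tmul, LinearMap.mul'_apply,
    LinearMap.mulLeft_apply, antipode_δ, LinearMap.id_apply, hb, mul_smul_comm,
    diag_mul_δ]
  split_ifs with hg
  · subst hg
    rw [one_smul, diag]
    refine Finset.sum_congr rfl fun h _ => ?_
    have h1 : x⁻¹ * h * x = x⁻¹ * (h⁻¹ * 1)⁻¹ * x := by group
    rw [δ_mul_of_eq x⁻¹ h1, NormalizedCocycle.sc, mul_one, inv_inv, smul_smul, smul_smul,
      smul_smul, mul_inv_cancel]
    congr 1
    have h2 := congrArg Units.val (ω.γ_cocycle x h h⁻¹ h)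
    have h3 : x⁻¹ * h⁻¹ * x = (x⁻¹ * h * x)⁻¹ := by simp [mul_assoc]
    simp only [mul_inv_cancel, inv_mul_cancel, NormalizedCocycle.γ_one_left,
      NormalizedCocycle.γ_one_right, mul_one, h3] at h2
    push_cast at h2 ⊢
    field_simp
    linear_combination h2
  · rw [zero_smul]
    refine Finset.sum_eq_zero fun h _ => ?_
    rw [δ_mul_of_ne x⁻¹, smul_zero, smul_zero, smul_zero]
    intro e
    apply hg
    have e' := mul_left_cancel (mul_right_cancel e)
    rw [mul_inv_rev, inv_inv] at e'
    exact inv_eq_one.1 (mul_eq_right.1 e'.symm)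

theorem antipode_Φ_inv_aux : LinearMap.mul' ℂ (TwistedDouble ω) (TensorProduct.map LinearMap.id
    (LinearMap.mul' ℂ (TwistedDouble ω) ∘ₗ TensorProduct.map
      (LinearMap.mulLeft ℂ (β ω : TwistedDouble ω) ∘ₗ antipode ω)
      (LinearMap.mulLeft ℂ 1)) (diag₃ ω fun g h k => (ω g h k)⁻¹)) = 1 := by
  have hb : (β ω : TwistedDouble ω) = diag fun g => ω g g⁻¹ g := rfl
  simp only [diag₃, map_sum, map_smul, TensorProduct.map_tmul, LinearMap.mul'_apply,
    LinearMap.mulLeft_apply, antipode_e, LinearMap.id_apply, hb, mul_smul_comm, one_mul,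
    diag_mul_δ, LinearMap.comp_apply, smul_mul_assoc]
  rw [one_eq]
  refine Finset.sum_congr rfl fun g _ => ?_
  rw [Finset.sum_eq_single g⁻¹, Finset.sum_eq_single g]
  · simp [δ_one_mul, smul_smul]
  · intro h _ hh
    rw [δ_mul_of_ne (g := g⁻¹⁻¹) _ (by simpa using hh.symm)]; simp
  · simp
  · intro h _ hh
    refine Finset.sum_eq_zero fun k _ => ?_
    rw [← mul_assoc, δ_mul_of_ne (g := g) (h := h⁻¹) _ (fun e => hh (by
      have e' : g = h⁻¹ := by simpa using e
      rw [e', inv_inv]))]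
    simp
  · simp

theorem antipode_Φ_aux : LinearMap.mul' ℂ (TwistedDouble ω) (TensorProduct.map (antipode ω)
    (LinearMap.mul' ℂ (TwistedDouble ω) ∘ₗ TensorProduct.map (LinearMap.mulLeft ℂ 1)
      (LinearMap.mulLeft ℂ (β ω : TwistedDouble ω) ∘ₗ antipode ω)) (diag₃ ω ω)) = 1 := by
  have hb : (β ω : TwistedDouble ω) = diag fun g => ω g g⁻¹ g := rfl
  simp only [diag₃, map_sum, map_smul, TensorProduct.map_tmul, LinearMap.mul'_apply,
    LinearMap.mulLeft_apply, antipode_e, hb, mul_smul_comm, one_mul,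
    diag_mul_δ, LinearMap.comp_apply, smul_mul_assoc]
  rw [one_eq, ← Fintype.sum_equiv (Equiv.inv G) _ (fun g => δ ω g 1) fun _ => rfl]
  refine Finset.sum_congr rfl fun g _ => ?_
  rw [Finset.sum_eq_single g⁻¹, Finset.sum_eq_single g]
  · have := congrArg Units.val (ω.apply_inv g)
    push_cast at this
    simp only [δ_one_mul, smul_smul, Equiv.inv_apply, inv_inv]
    rw [mul_comm, this, one_smul]
  · intro h _ hh
    rw [δ_mul_of_ne (g := g⁻¹) (h := h⁻¹) _ (by simpa using hh.symm)]; simp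
  · simp
  · intro h _ hh
    refine Finset.sum_eq_zero fun k _ => ?_
    rw [← mul_assoc, δ_mul_of_ne (g := g⁻¹) (h := h) _ (by simpa using hh.symm)]
    simp
  · simp

theorem swap₁₂_diag₃ (f : G → G → G → ℂˣ) :
    swap₁₂ (diag₃ ω f) = diag₃ ω fun a b c => f b a c := by
  simp only [diag₃, map_sum, map_smul]
  rw [Finset.sum_comm]
  rfl

theorem swap₂₃_diag₃ (f : G → G → G → ℂˣ) :
    swap₂₃ (diag₃ ω f) = diag₃ ω fun a b c => f a c b := by
  simp only [diag₃, map_sum, map_smul]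
  refine Finset.sum_congr rfl fun a _ => ?_
  rw [Finset.sum_comm]
  rfl

theorem tmul_mul_leg₂₃ (a b c x y z : G) :
    (δ ω a x ⊗ₜ[ℂ] (δ ω b y ⊗ₜ[ℂ] δ ω c z)) * leg₂₃ (Rel ω) =
      (ω.θ c z (y⁻¹ * b * y) : ℂ) •
        (δ ω a x ⊗ₜ[ℂ] (δ ω b y ⊗ₜ[ℂ] δ ω c (z * (y⁻¹ * b * y)))) := by
  rw [leg₂₃, Algebra.TensorProduct.tmul_mul_tmul, mul_one, tmul_mul_Rel, TensorProduct.tmul_smul]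

theorem tmul_mul_leg₁₂ (a b c x y z : G) :
    (δ ω a x ⊗ₜ[ℂ] (δ ω b y ⊗ₜ[ℂ] δ ω c z)) * leg₁₂ (Rel ω) =
      (ω.θ b y (x⁻¹ * a * x) : ℂ) •
        (δ ω a x ⊗ₜ[ℂ] (δ ω b (y * (x⁻¹ * a * x)) ⊗ₜ[ℂ] δ ω c z)) := by
  have h : (δ ω a x ⊗ₜ[ℂ] (δ ω b y ⊗ₜ[ℂ] δ ω c z)) = Algebra.TensorProduct.assoc ℂ ℂ ℂ _ _ _
    ((δ ω a x ⊗ₜ[ℂ] δ ω b y) ⊗ₜ[ℂ] δ ω c z) := rfl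
  rw [h, leg₁₂, ← map_mul, Algebra.TensorProduct.tmul_mul_tmul, mul_one, tmul_mul_Rel,
    ← TensorProduct.smul_tmul', map_smul]
  rfl

theorem tmul_mul_leg₁₃ (a b c x y z : G) :
    (δ ω a x ⊗ₜ[ℂ] (δ ω b y ⊗ₜ[ℂ] δ ω c z)) * leg₁₃ (Rel ω) =
      (ω.θ c z (x⁻¹ * a * x) : ℂ) •
        (δ ω a x ⊗ₜ[ℂ] (δ ω b y ⊗ₜ[ℂ] δ ω c (z * (x⁻¹ * a * x)))) := by
  have h : (δ ω a x ⊗ₜ[ℂ] (δ ω b y ⊗ₜ[ℂ] δ ω c z)) =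
    swap₂₃ (δ ω a x ⊗ₜ[ℂ] (δ ω c z ⊗ₜ[ℂ] δ ω b y)) := rfl
  rw [h, leg₁₃, ← map_mul, tmul_mul_leg₁₂, map_smul]
  rfl

theorem hexagon_right_aux : Algebra.TensorProduct.map (AlgHom.id ℂ (TwistedDouble ω)) (comul ω)
      (Rel ω) = swap₁₂ (swap₂₃ (diag₃ ω ω)) * leg₁₃ (Rel ω) *
        swap₁₂ (diag₃ ω fun g h k => (ω g h k)⁻¹) * leg₁₂ (Rel ω) * diag₃ ω ω := by
  have hl : Algebra.TensorProduct.map (AlgHom.id ℂ (TwistedDouble ω)) (comul ω) (Rel ω) =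
      ∑ a : G, ∑ b : G, ∑ c : G, (ω.γ a b c : ℂ) • (δ ω a 1 ⊗ₜ (δ ω b a ⊗ₜ δ ω c a)) := by
    simp only [Rel, map_sum, Algebra.TensorProduct.map_tmul, AlgHom.id_apply, comul_δ, comulδ,
      TensorProduct.tmul_sum, TensorProduct.tmul_smul]
    exact Finset.sum_congr rfl fun a _ => sum_inv_mul (fun b c => (ω.γ a b c : ℂ) •
      (δ ω a 1 ⊗ₜ[ℂ] (δ ω b a ⊗ₜ[ℂ] δ ω c a)))
  rw [hl, swap₂₃_diag₃, swap₁₂_diag₃, swap₁₂_diag₃]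
  conv_rhs => rw [diag₃]
  simp only [Finset.sum_mul, smul_mul_assoc, tmul_mul_leg₁₃, tmul_mul_leg₁₂, tmul_mul_diag₃,
    smul_smul]
  refine Finset.sum_congr rfl fun a _ => Finset.sum_congr rfl fun b _ =>
    Finset.sum_congr rfl fun c _ => ?_
  simp only [inv_one, one_mul, mul_one, NormalizedCocycle.θ_one_left]
  congr 1
  simp only [NormalizedCocycle.γ]
  push_cast
  ring

theorem hexagon_left_aux : Algebra.TensorProduct.assoc ℂ ℂ ℂ _ _ _
      (Algebra.TensorProduct.map (comul ω) (AlgHom.id ℂ (TwistedDouble ω)) (Rel ω)) =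
    swap₂₃ (swap₁₂ (diag₃ ω fun g h k => (ω g h k)⁻¹)) * leg₁₃ (Rel ω) *
      swap₂₃ (diag₃ ω ω) * leg₂₃ (Rel ω) * diag₃ ω fun g h k => (ω g h k)⁻¹ := by
  have hl : Algebra.TensorProduct.assoc ℂ ℂ ℂ _ _ _
      (Algebra.TensorProduct.map (comul ω) (AlgHom.id ℂ (TwistedDouble ω)) (Rel ω)) =
      ∑ a : G, ∑ b : G, ∑ c : G, (δ ω a 1 ⊗ₜ (δ ω b 1 ⊗ₜ δ ω c (a * b))) := by
    simp only [Rel, map_sum, Algebra.TensorProduct.map_tmul, AlgHom.id_apply, comul_e,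
      TensorProduct.sum_tmul, Algebra.TensorProduct.assoc_tmul]
    rw [← sum_inv_mul (fun a b => ∑ c : G, (δ ω a 1 ⊗ₜ[ℂ] (δ ω b 1 ⊗ₜ[ℂ] δ ω c (a * b))))]
    simp only [mul_inv_cancel_left]
    exact Finset.sum_congr rfl fun a _ => Finset.sum_comm
  rw [hl, swap₁₂_diag₃, swap₂₃_diag₃, swap₂₃_diag₃]
  conv_rhs => rw [diag₃]
  simp only [Finset.sum_mul, smul_mul_assoc, tmul_mul_leg₁₃, tmul_mul_leg₂₃, tmul_mul_diag₃,
    smul_smul]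
  refine Finset.sum_congr rfl fun a _ => Finset.sum_congr rfl fun b _ =>
    Finset.sum_congr rfl fun c _ => ?_
  simp only [inv_one, one_mul, mul_one, NormalizedCocycle.θ_one_left]
  rw [eq_comm]
  convert one_smul ℂ _ using 2
  simp only [NormalizedCocycle.θ]
  push_cast
  field_simp

/-- The twisted Drinfeld double `D^ωG` as a quasitriangular quasi-Hopf algebra. -/
noncomputable instance : QuasiHopf (TwistedDouble ω) where
  comul := comul ω
  counit := counit ω
  Φ := Φ ω
  antipode := antipode ω
  α := 1
  β := β ω
  R := R ω
  coassoc h := LinearMap.congr_fun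
    (f := (Algebra.TensorProduct.assoc ℂ ℂ ℂ _ _ _).toLinearMap ∘ₗ
      (Algebra.TensorProduct.map (comul ω) (AlgHom.id ℂ (TwistedDouble ω))).toLinearMap ∘ₗ
        (comul ω).toLinearMap)
    (g := LinearMap.mulRight ℂ (diag₃ ω fun g h k => (ω g h k)⁻¹) ∘ₗ
      LinearMap.mulLeft ℂ (diag₃ ω ω) ∘ₗ
      (Algebra.TensorProduct.map (AlgHom.id ℂ (TwistedDouble ω)) (comul ω)).toLinearMap ∘ₗ
        (comul ω).toLinearMap) (lin_ext coassoc_δ) h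
  counit_left h := LinearMap.congr_fun
    (f := (Algebra.TensorProduct.lid ℂ _).toLinearMap ∘ₗ
      (Algebra.TensorProduct.map (counit ω) (AlgHom.id ℂ (TwistedDouble ω))).toLinearMap ∘ₗ
        (comul ω).toLinearMap) (g := LinearMap.id) (lin_ext counit_left_δ) h
  counit_right h := LinearMap.congr_fun
    (f := (Algebra.TensorProduct.rid ℂ ℂ _).toLinearMap ∘ₗ
      (Algebra.TensorProduct.map (AlgHom.id ℂ (TwistedDouble ω)) (counit ω)).toLinearMap ∘ₗ
        (comul ω).toLinearMap) (g := LinearMap.id) (lin_ext counit_right_δ) h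
  pentagon := by
    change Algebra.TensorProduct.map (AlgHom.id ℂ _)
      (Algebra.TensorProduct.map (AlgHom.id ℂ _) (comul ω)) (diag₃ ω fun g h k => (ω g h k)⁻¹) *
      Algebra.TensorProduct.assoc ℂ ℂ ℂ _ _ _ (Algebra.TensorProduct.map (comul ω)
        (AlgHom.id ℂ (TwistedDouble ω ⊗[ℂ] TwistedDouble ω)) (diag₃ ω fun g h k => (ω g h k)⁻¹)) =
      (1 ⊗ₜ[ℂ] (diag₃ ω fun g h k => (ω g h k)⁻¹)) * Algebra.TensorProduct.map (AlgHom.id ℂ _) _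
        (Algebra.TensorProduct.map (AlgHom.id ℂ _) (Algebra.TensorProduct.map (comul ω)
          (AlgHom.id ℂ _)) (diag₃ ω fun g h k => (ω g h k)⁻¹) *
          Algebra.TensorProduct.assoc ℂ ℂ ℂ _ _ _ ((diag₃ ω fun g h k => (ω g h k)⁻¹) ⊗ₜ[ℂ] 1))
    rw [map_mul, map₁, map₂, map₃, map₄, map₅]
    exact pentagon_diag
  counit_Φ := counit_Φ_aux
  antipode_one := by rw [one_eq, map_sum]; simp only [antipode_e]; exact
    Fintype.sum_equiv (Equiv.inv G) _ _ fun _ => rfl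
  antipode_mul := antipode_mul
  antipode_bijective := antipode_bijective
  antipode_left := antipode_left_aux
  antipode_right := antipode_right_aux
  antipode_Φ_inv := antipode_Φ_inv_aux
  antipode_Φ := antipode_Φ_aux
  comul_op h := LinearMap.congr_fun
    (f := LinearMap.mulRight ℂ (Rel ω) ∘ₗ (Algebra.TensorProduct.comm ℂ _ _).toLinearMap ∘ₗ
        (comul ω).toLinearMap)
    (g := LinearMap.mulLeft ℂ (Rel ω) ∘ₗ (comul ω).toLinearMap) (lin_ext comul_op_δ) h
  hexagon_right := hexagon_right_aux
  hexagon_left := hexagon_left_aux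

/-- The pivotal element `β⁻¹` of `D^ωG`: the isomorphism `V ≅ V**` is `v ↦ (β⁻¹ v)**`. -/
noncomputable instance : QuasiHopf.Pivot (TwistedDouble ω) where
  pivot := (β ω)⁻¹
  antipode_antipode := antipode_antipode_aux

end TwistedDouble

/-! ### Partial traces and duals of graded vector spaces -/

/-- The right partial trace of an endomorphism of `X ⊗ X`, with respect to a coevaluation
`𝟙 ⟶ X ⊗ Y` and an evaluation `X ⊗ Y ⟶ 𝟙`. -/
def partialTrace {C : Type*} [Category C] [MonoidalCategory C] {X Y : C} (c : X ⊗ X ⟶ X ⊗ X)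
    (coev : 𝟙_ C ⟶ X ⊗ Y) (ev : X ⊗ Y ⟶ 𝟙_ C) : X ⟶ X :=
  (ρ_ X).inv ≫ X ◁ coev ≫ (α_ X X Y).inv ≫ c ▷ Y ≫ (α_ X X Y).hom ≫ X ◁ ev ≫ (ρ_ X).hom

namespace Grading

variable {G : Type*} [Fintype G] [Group G] {V : Type*} [AddCommGroup V] [Module ℂ V]
  (p : Grading G V)

theorem dual_proj (g : G) (f : Module.Dual ℂ V) (v : V) :
    p.dual.proj g f v = f (p.proj g⁻¹ v) := rfl

theorem dual_proj_apply [DecidableEq G] (g h : G) (f : Module.Dual ℂ V) (v : V) :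
    p.dual.proj g f (p.proj h v) = if g * h = 1 then p.dual.proj g f (p.proj h v) else 0 := by
  split_ifs with hgh
  · rfl
  · rw [dual_proj, p.proj_ne _ _ _ (fun e => hgh (by rw [← e, mul_inv_cancel])), map_zero]

/-- Multiplication of the component of degree `g` by `f g`. -/
noncomputable def diag (f : G → ℂˣ) : V →ₗ[ℂ] V := ∑ g : G, (f g : ℂ) • p.proj g

theorem diag_proj (f : G → ℂˣ) (g : G) (v : V) :
    p.diag f (p.proj g v) = (f g : ℂ) • p.proj g v := by
  simp only [diag, LinearMap.sum_apply, LinearMap.smul_apply]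
  rw [Finset.sum_eq_single g]
  · simp
  · intro h _ hh; rw [p.proj_ne _ _ _ hh, smul_zero]
  · simp

theorem proj_diag (f : G → ℂˣ) (g : G) (v : V) :
    p.proj g (p.diag f v) = (f g : ℂ) • p.proj g v := by
  conv_lhs => rw [← p.sum_proj v]
  simp only [map_sum, diag_proj, map_smul]
  rw [Finset.sum_eq_single g]
  · simp
  · intro h _ hh; rw [p.proj_ne _ _ _ hh.symm, smul_zero]
  · simp

variable [Module.Finite ℂ V]

/-- The element `∑ f(g) (vᵢ)_g ⊗ vⁱ`. -/
noncomputable def coevElt (f : G → ℂˣ) : V ⊗[ℂ] Module.Dual ℂ V :=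
  TensorProduct.map (p.diag f) LinearMap.id (coevaluation ℂ V 1)

theorem coevElt_eq (f : G → ℂˣ) : p.coevElt f = ∑ g : G, (f g : ℂ) •
    TensorProduct.map (p.proj g) (p.dual.proj g⁻¹) (coevaluation ℂ V 1) := by
  have h1 : ∀ g : G, TensorProduct.map (p.proj g) (p.dual.proj g⁻¹) (coevaluation ℂ V 1) =
      TensorProduct.map (p.proj g) LinearMap.id (coevaluation ℂ V 1) := fun g => by
    have h2 : TensorProduct.map (p.proj g) (p.dual.proj g⁻¹) =
        TensorProduct.map (p.proj g) LinearMap.id ∘ₗ TensorProduct.map LinearMap.id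
          (Module.Dual.transpose (R := ℂ) (p.proj g)) := by
      rw [← TensorProduct.map_comp, LinearMap.comp_id, LinearMap.id_comp]
      simp [dual]
    rw [h2, LinearMap.comp_apply, QuasiHopf.coevaluation_transpose, ← LinearMap.comp_apply,
      ← TensorProduct.map_comp, LinearMap.id_comp]
    congr 2
    ext v
    simp
  simp only [h1, coevElt, diag]
  induction coevaluation ℂ V 1 with
  | zero => simp
  | add x y hx hy => simp only [map_add, hx, hy, smul_add, Finset.sum_add_distrib]
  | tmul v f => simp [LinearMap.sum_apply, TensorProduct.sum_tmul, TensorProduct.smul_tmul']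

theorem coevElt_proj (f : G → ℂˣ) (g : G) (c : ℂ) :
    LinearMap.toSpanSingleton ℂ _ (p.coevElt f) ((single 1).proj g c) =
      (p.tensor p.dual).proj g (LinearMap.toSpanSingleton ℂ _ (p.coevElt f) c) := by
  classical
  rw [LinearMap.toSpanSingleton_apply, LinearMap.toSpanSingleton_apply, map_smul, single_proj]
  have key : (p.tensor p.dual).proj g (p.coevElt f) = if g = 1 then p.coevElt f else 0 := by
    rw [coevElt_eq, map_sum]
    simp only [map_smul]
    have : ∀ h : G, (p.tensor p.dual).proj g
        (TensorProduct.map (p.proj h) (p.dual.proj h⁻¹) (coevaluation ℂ V 1)) =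
        if g = 1 then TensorProduct.map (p.proj h) (p.dual.proj h⁻¹)
          (coevaluation ℂ V 1) else 0 := fun h => by
      rw [coevaluation_apply_one, map_sum, map_sum]
      simp only [TensorProduct.map_tmul, tensor_proj, mul_inv_cancel]
      split_ifs <;> simp
    simp only [this]
    split_ifs <;> simp
  rw [key]
  split_ifs <;> simp

end Grading

namespace VecG

variable {G : Type*} [Group G] [Fintype G] {α : NormalizedCocycle G}

/-- The dual graded vector space. -/
noncomputable def dual (V : VecG α) : VecG α where
  carrier := Module.Dual ℂ V
  grading := V.grading.dual

/-- The evaluation `V* ⊗ V ⟶ 𝟙`, `f ⊗ v ↦ f(v)`. -/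
noncomputable def ev (V : VecG α) : dual V ⊗ V ⟶ 𝟙_ (VecG α) :=
  (⟨contractLeft ℂ V, fun g => by
    classical
    refine LinearMap.congr_fun (f := contractLeft ℂ V ∘ₗ
      (V.grading.dual.tensor V.grading).proj g) (g := (Grading.single 1).proj g ∘ₗ
        contractLeft ℂ V) (Grading.lin_ext₂ V.grading.dual V.grading fun a b f v => ?_)
    simp only [LinearMap.comp_apply, Grading.tensor_proj, Grading.single_proj]
    have h := Grading.dual_proj_apply V.grading a b f v
    split_ifs with h1 h2 h2
    · rfl
    · have h3 : ¬ a * b = 1 := fun e => h2 (h1.trans e)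
      rw [if_neg h3] at h
      rw [contractLeft_apply, h]
    · have h3 : ¬ a * b = 1 := fun e => h1 (h2.trans e.symm)
      rw [if_neg h3] at h
      rw [contractLeft_apply, h, map_zero]
    · rw [map_zero]⟩ : Hom (tensor (dual V) V) (single 1))

/-- The coevaluation `𝟙 ⟶ V ⊗ V*`, `1 ↦ ∑ α(g, g⁻¹, g)⁻¹ (vᵢ)_g ⊗ vⁱ`. -/
noncomputable def coev (V : VecG α) : 𝟙_ (VecG α) ⟶ V ⊗ dual V :=
  (⟨LinearMap.toSpanSingleton ℂ _ (V.grading.coevElt fun g => (α g g⁻¹ g)⁻¹),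
    V.grading.coevElt_proj fun g => (α g g⁻¹ g)⁻¹⟩ : Hom (single 1) (tensor V (dual V)))

/-- The pivotal morphism `V ⟶ V**`, `v ↦ α(g, g⁻¹, g) v**` for `v` of degree `g`. -/
noncomputable def pivotal (V : VecG α) : V ⟶ dual (dual V) :=
  (⟨Module.Dual.eval ℂ V ∘ₗ V.grading.diag fun g => α g g⁻¹ g, fun g v => by
    refine LinearMap.ext fun f : Module.Dual ℂ V => ?_
    change f (V.grading.diag _ (V.grading.proj g v)) =
      f (V.grading.proj (g⁻¹)⁻¹ (V.grading.diag _ v))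
    rw [inv_inv, Grading.diag_proj, Grading.proj_diag]⟩ : Hom V (dual (dual V)))

end VecG

namespace Grading

variable {G : Type*} [Fintype G] [Group G] {V : Type*} [AddCommGroup V] [Module ℂ V]
  [Module.Finite ℂ V]

/-- The partial trace of `c : V ⊗ V → V ⊗ V`, as a linear map. -/
noncomputable def traceLin (p : Grading G V) (α : NormalizedCocycle G)
    (c : V ⊗[ℂ] V →ₗ[ℂ] V ⊗[ℂ] V) : V →ₗ[ℂ] V :=
  (TensorProduct.rid ℂ V).toLinearMap ∘ₗ
    TensorProduct.map LinearMap.id (contractLeft ℂ (Module.Dual ℂ V) ∘ₗ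
      TensorProduct.map (Module.Dual.eval ℂ V ∘ₗ p.diag fun g => α g g⁻¹ g) LinearMap.id) ∘ₗ
    (assoc p p p.dual α).toLinearMap ∘ₗ TensorProduct.map c LinearMap.id ∘ₗ
    (assoc p p p.dual α).symm.toLinearMap ∘ₗ
    TensorProduct.map LinearMap.id
      (LinearMap.toSpanSingleton ℂ _ (p.coevElt fun g => (α g g⁻¹ g)⁻¹)) ∘ₗ
    (TensorProduct.rid ℂ V).symm.toLinearMap

theorem traceLin_proj (p : Grading G V) (α : NormalizedCocycle G)
    (c : V ⊗[ℂ] V →ₗ[ℂ] V ⊗[ℂ] V) (a : G → V →ₗ[ℂ] V)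
    (ha : ∀ g h v, a g (p.proj h v) = p.proj (g * h * g⁻¹) (a g v))
    (hc : ∀ g v w, c (p.proj g v ⊗ₜ w) = a g w ⊗ₜ p.proj g v) (g : G) (v : V) :
    traceLin p α c (p.proj g v) = a g (p.proj g v) := by
  classical
  have h1 : traceLin p α c (p.proj g v) = (TensorProduct.rid ℂ V)
    (TensorProduct.map LinearMap.id (contractLeft ℂ (Module.Dual ℂ V) ∘ₗ
      TensorProduct.map (Module.Dual.eval ℂ V ∘ₗ p.diag fun g => α g g⁻¹ g) LinearMap.id)
    (assoc p p p.dual α (TensorProduct.map c LinearMap.id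
    ((assoc p p p.dual α).symm (p.proj g v ⊗ₜ p.coevElt fun g => (α g g⁻¹ g)⁻¹))))) := by
    simp [traceLin]
  rw [h1, coevElt_eq]
  simp only [coevaluation_apply_one, map_sum, TensorProduct.map_tmul, Finset.smul_sum,
    TensorProduct.tmul_sum, TensorProduct.tmul_smul, map_smul, assoc_symm_tmul, hc,
    LinearMap.id_apply, ha, assoc_tmul, LinearMap.comp_apply, diag_proj,
    TensorProduct.rid_tmul, ← TensorProduct.smul_tmul', contractLeft_apply, LinearMap.smul_apply]
  simp only [Module.Dual.eval_apply]
  rw [Finset.sum_eq_single g]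
  · set b := Module.Basis.ofVectorSpace ℂ V
    have h2 : g * g * g⁻¹ = g := by group
    have h3 : ∀ i, p.dual.proj g⁻¹ (b.coord i) (p.proj g v) = b.coord i (p.proj g v) := fun i => by
      rw [dual_proj, inv_inv, proj_self]
    simp only [h2, h3]
    have h4 : a g (p.proj g v) = ∑ i, b.coord i (p.proj g v) • p.proj g (a g (b i)) := by
      have h5 : p.proj g v = ∑ i, b.coord i (p.proj g v) • p.proj g (b i) := by
        have h6 := congrArg (p.proj g) (b.sum_repr (p.proj g v))
        simp only [map_sum, map_smul, proj_self] at h6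
        exact h6.symm
      conv_lhs => rw [h5]
      simp only [map_sum, map_smul, ha, h2]
    rw [ha, h2] at h4
    rw [h4]
    refine Finset.sum_congr rfl fun i _ => ?_
    simp only [smul_smul, smul_eq_mul]
    congr 1
    push_cast
    field_simp
  · intro h _ hh
    refine Finset.sum_eq_zero fun i _ => ?_
    rw [dual_proj_apply, if_neg (fun e => hh (inv_mul_eq_one.1 e))]
    simp
  · simp

end Grading

namespace VecG

variable {G : Type*} [Group G] [Fintype G] {α : NormalizedCocycle G}

variable {V : VecG α} (b : HalfBraiding V)

/-- The half braiding `V ⊗ U ≅ U ⊗ V`, as a linear equivalence. -/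
noncomputable def hb (U : VecG α) :
    V.carrier ⊗[ℂ] U.carrier ≃ₗ[ℂ] U.carrier ⊗[ℂ] V.carrier :=
  LinearEquiv.ofLinearMap (Hom.toLin (b.β U).hom) (Hom.toLin (b.β U).inv)
    (congrArg Hom.toLin (b.β U).inv_hom_id) (congrArg Hom.toLin (b.β U).hom_inv_id)

theorem hb_naturality {U U' : VecG α} (f : U ⟶ U') (v : V.carrier)
    (u : U.carrier) : hb b U' (v ⊗ₜ Hom.toLin f u) =
      TensorProduct.map (Hom.toLin f) LinearMap.id (hb b U (v ⊗ₜ u)) :=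
  LinearMap.congr_fun (congrArg Hom.toLin (b.naturality f)) (v ⊗ₜ[ℂ] u)

theorem hb_proj (U : VecG α) (g : G) (t : V.carrier ⊗[ℂ] U.carrier) :
    hb b U ((V.grading.tensor U.grading).proj g t) =
      (U.grading.tensor V.grading).proj g (hb b U t) :=
  Hom.comm (b.β U).hom g t

/-- The half braiding with the one-dimensional space in degree `k`. -/
noncomputable def hbs (k : G) : V.carrier ⊗[ℂ] ℂ ≃ₗ[ℂ] ℂ ⊗[ℂ] V.carrier := hb b (single k)

/-- The automorphism `a_k` of `V` with `v ⊗ 1 ↦ 1 ⊗ a_k v` under the half braiding with the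
one-dimensional space in degree `k`. -/
noncomputable def hbEnd (k : G) : V.carrier ≃ₗ[ℂ] V.carrier :=
  (TensorProduct.rid ℂ V.carrier).symm ≪≫ₗ hbs b k ≪≫ₗ TensorProduct.lid ℂ V.carrier

theorem hbs_tmul (k : G) (v : V.carrier) :
    hbs b k (v ⊗ₜ (1 : ℂ)) = (1 : ℂ) ⊗ₜ hbEnd b k v := by
  apply (TensorProduct.lid ℂ V.carrier).injective
  rw [TensorProduct.lid_tmul, one_smul]
  rfl

theorem point_comm {W : Type*} [AddCommGroup W] [Module ℂ W] (p : Grading G W) (k : G) (u : W)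
    (g : G) (c : ℂ) : LinearMap.toSpanSingleton ℂ W (p.proj k u) ((Grading.single k).proj g c) =
      p.proj g (LinearMap.toSpanSingleton ℂ W (p.proj k u) c) := by
  classical
  rw [LinearMap.toSpanSingleton_apply, LinearMap.toSpanSingleton_apply, map_smul,
    Grading.single_proj, Grading.proj_proj]
  split_ifs <;> simp

/-- The morphism `1 ↦ u_k` from the one-dimensional space in degree `k`. -/
noncomputable def point (U : VecG α) (k : G) (u : U.carrier) : (single k : VecG α) ⟶ U :=
  (⟨LinearMap.toSpanSingleton ℂ _ (U.grading.proj k u), point_comm U.grading k u⟩ :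
    Hom (single k) U)

theorem hb_tmul (U : VecG α) (k : G) (v : V.carrier) (u : U.carrier) :
    hb b U (v ⊗ₜ U.grading.proj k u) = U.grading.proj k u ⊗ₜ hbEnd b k v := by
  have h : hb b U (v ⊗ₜ LinearMap.toSpanSingleton ℂ _ (U.grading.proj k u) (1 : ℂ)) =
      TensorProduct.map (LinearMap.toSpanSingleton ℂ _ (U.grading.proj k u)) LinearMap.id
        (hbs b k (v ⊗ₜ (1 : ℂ))) := hb_naturality b (point U k u) v (1 : ℂ)
  rw [hbs_tmul, TensorProduct.map_tmul, LinearMap.toSpanSingleton_apply, one_smul] at h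
  exact h

theorem hbEnd_proj (k g : G) (v : V.carrier) :
    hbEnd b k (V.grading.proj g v) = V.grading.proj (k⁻¹ * g * k) (hbEnd b k v) := by
  classical
  have key : ∀ h : G, hbs b k ((V.grading.tensor (Grading.single k)).proj (h * k)
      (v ⊗ₜ (1 : ℂ))) = 1 ⊗ₜ hbEnd b k (V.grading.proj h v) := fun h => by
    have : (V.grading.tensor (Grading.single k)).proj (h * k) (v ⊗ₜ (1 : ℂ)) =
        V.grading.proj h v ⊗ₜ 1 := by
      conv_lhs => rw [← V.grading.sum_proj v]
      simp only [TensorProduct.sum_tmul, map_sum]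
      have h1 : ∀ a, (V.grading.tensor (Grading.single k)).proj (h * k)
          (V.grading.proj a v ⊗ₜ (1 : ℂ)) = if h = a then V.grading.proj a v ⊗ₜ 1 else 0 :=
        fun a => by
          have := Grading.tensor_proj V.grading (Grading.single k) (h * k) a k v (1 : ℂ)
          rw [Grading.single_proj_self] at this
          simpa using this
      simp [h1]
    rw [this, hbs_tmul]
  have key2 : ((Grading.single k).tensor V.grading).proj (g * k) ((1 : ℂ) ⊗ₜ hbEnd b k v) =
      1 ⊗ₜ V.grading.proj (k⁻¹ * g * k) (hbEnd b k v) := by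
    set w := hbEnd b k v
    conv_lhs => rw [← V.grading.sum_proj w]
    simp only [TensorProduct.tmul_sum, map_sum]
    have h1 : ∀ a, ((Grading.single k).tensor V.grading).proj (g * k)
        ((1 : ℂ) ⊗ₜ V.grading.proj a w) = if k⁻¹ * g * k = a then 1 ⊗ₜ V.grading.proj a w else 0 :=
      fun a => by
        have := Grading.tensor_proj (Grading.single k) V.grading (g * k) k a (1 : ℂ) w
        rw [Grading.single_proj_self] at this
        rw [this]
        simp only [mul_assoc, inv_mul_eq_iff_eq_mul]
    simp [h1]
  have h := hb_proj b (single k) (g * k) (v ⊗ₜ[ℂ] (1 : ℂ))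
  have h' : hbs b k ((V.grading.tensor (Grading.single k)).proj (g * k) (v ⊗ₜ (1 : ℂ))) =
    ((Grading.single k).tensor V.grading).proj (g * k) (hbs b k (v ⊗ₜ (1 : ℂ))) := h
  rw [key, hbs_tmul, key2] at h'
  have := congrArg (TensorProduct.lid ℂ V.carrier) h'
  simpa using this

theorem hbEnd_mul (k l g : G) (v : V.carrier) :
    hbEnd b (k * l) (V.grading.proj g v) =
      (((α.θ g k l)⁻¹ : ℂˣ) : ℂ) • hbEnd b l (hbEnd b k (V.grading.proj g v)) := by
  classical
  let s : ∀ m : G, Grading G ℂ := fun m => Grading.single m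
  have h := LinearMap.congr_fun (congrArg Hom.toLin (b.monoidal (single k) (single l)))
    (V.grading.proj g v ⊗ₜ[ℂ] ((1 : ℂ) ⊗ₜ[ℂ] (1 : ℂ)))
  have hl : hb b (tensor (single k) (single l))
      (V.grading.proj g v ⊗ₜ[ℂ] ((1 : ℂ) ⊗ₜ[ℂ] (1 : ℂ))) =
      ((1 : ℂ) ⊗ₜ[ℂ] (1 : ℂ)) ⊗ₜ[ℂ] hbEnd b (k * l) (V.grading.proj g v) := by
    have h1 := hb_tmul b (tensor (single k) (single l)) (k * l) (V.grading.proj g v)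
      ((1 : ℂ) ⊗ₜ[ℂ] (1 : ℂ))
    have h2 := Grading.tensor_proj_mul (Grading.single k) (Grading.single l) k l (1 : ℂ) (1 : ℂ)
    rw [Grading.single_proj_self, Grading.single_proj_self] at h2
    exact (congrArg (fun t => hb b (tensor (single k) (single l))
      (V.grading.proj g v ⊗ₜ[ℂ] t)) h2.symm).trans (h1.trans
        (congrArg (fun t => t ⊗ₜ[ℂ] hbEnd b (k * l) (V.grading.proj g v)) h2))
  have h' : hb b (tensor (single k) (single l))
      (V.grading.proj g v ⊗ₜ[ℂ] ((1 : ℂ) ⊗ₜ[ℂ] (1 : ℂ))) =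
    (Grading.assoc (s k) (s l) V.grading α).symm
      (TensorProduct.map LinearMap.id (hbs b l).toLinearMap
        (Grading.assoc (s k) V.grading (s l) α
          (TensorProduct.map (hbs b k).toLinearMap LinearMap.id
            ((Grading.assoc V.grading (s k) (s l) α).symm
              (V.grading.proj g v ⊗ₜ[ℂ] ((1 : ℂ) ⊗ₜ[ℂ] (1 : ℂ))))))) := h
  have a1 := Grading.assoc_symm_tmul V.grading (s k) (s l) α g k l v (1 : ℂ) (1 : ℂ)
  have a2 := Grading.assoc_tmul (s k) V.grading (s l) α k (k⁻¹ * g * k) l (1 : ℂ)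
    (hbEnd b k v) (1 : ℂ)
  have a3 := Grading.assoc_symm_tmul (s k) (s l) V.grading α k l (l⁻¹ * (k⁻¹ * g * k) * l)
    (1 : ℂ) (1 : ℂ) (hbEnd b l (hbEnd b k v))
  have e : (k * l)⁻¹ * g * (k * l) = l⁻¹ * (k⁻¹ * g * k) * l := by group
  simp only [s, Grading.single_proj_self] at a1 a2 a3
  rw [hl] at h'
  simp only [s, a1, map_smul, TensorProduct.map_tmul, LinearEquiv.coe_coe, hbs_tmul,
    hbEnd_proj b k g, LinearMap.id_apply, a2, hbEnd_proj b l, a3, smul_smul] at h'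
  have h2 := congrArg (TensorProduct.lid ℂ V.carrier ∘ TensorProduct.map
    (TensorProduct.lid ℂ ℂ).toLinearMap LinearMap.id) h'
  simp only [Function.comp_apply, map_smul, TensorProduct.map_tmul, LinearEquiv.coe_coe,
    TensorProduct.lid_tmul, one_smul, LinearMap.id_apply] at h2
  rw [h2, hbEnd_proj b k, hbEnd_proj b l]
  congr 1
  simp only [NormalizedCocycle.θ, e]
  push_cast
  field_simp

theorem hbEnd_comm (k g : G) (v : V.carrier) :
    hbEnd b (k⁻¹ * g * k) (hbEnd b k (V.grading.proj g v)) =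
      hbEnd b k (hbEnd b g (V.grading.proj g v)) := by
  have h1 := hbEnd_mul b k (k⁻¹ * g * k) g v
  have h2 := hbEnd_mul b g k g v
  have e : k * (k⁻¹ * g * k) = g * k := by group
  have e' : α.θ g k (k⁻¹ * g * k) = α.θ g g k := by
    simp [NormalizedCocycle.θ, mul_assoc]
  rw [e, h2, e'] at h1
  exact (smul_right_injective _ (Units.ne_zero _) h1).symm

theorem hb_symm_tmul (g : G) (v w : V.carrier) :
    (hb b V).symm (V.grading.proj g v ⊗ₜ w) = (hbEnd b g).symm w ⊗ₜ V.grading.proj g v := by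
  rw [LinearEquiv.symm_apply_eq, hb_tmul, LinearEquiv.apply_symm_apply]

/-- The twist `v ↦ a_g⁻¹ v`, as the partial trace of the inverse half braiding of `V` with
itself. -/
noncomputable def twist : V ⟶ V :=
  partialTrace (b.β V).inv (coev V) (pivotal V ▷ dual V ≫ ev (dual V))

theorem twist_proj (g : G) (v : V.carrier) :
    Hom.toLin (twist b) (V.grading.proj g v) = (hbEnd b g).symm (V.grading.proj g v) := by
  refine Eq.trans (b := Grading.traceLin V.grading α (hb b V).symm.toLinearMap
    (V.grading.proj g v)) rfl ?_
  exact Grading.traceLin_proj V.grading α (hb b V).symm.toLinearMap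
    (fun g => (hbEnd b g).symm.toLinearMap)
    (fun g h v => by
      rw [LinearEquiv.coe_coe, LinearEquiv.symm_apply_eq, hbEnd_proj,
        LinearEquiv.apply_symm_apply]
      congr 2
      group)
    (fun g v w => hb_symm_tmul b g v w) g v

theorem twist_comm (U : VecG α) :
    twist b ▷ U ≫ (b.β U).hom = (b.β U).hom ≫ U ◁ twist b := by
  apply hom_ext
  change (hb b U).toLinearMap ∘ₗ TensorProduct.map (Hom.toLin (twist b)) LinearMap.id =
    TensorProduct.map LinearMap.id (Hom.toLin (twist b)) ∘ₗ (hb b U).toLinearMap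
  refine Grading.lin_ext₂ V.grading U.grading fun g k v u => ?_
  simp only [LinearMap.comp_apply, TensorProduct.map_tmul, LinearEquiv.coe_coe, hb_tmul,
    LinearMap.id_apply]
  rw [hbEnd_proj, twist_proj, twist_proj, ← hbEnd_proj]
  congr 1
  rw [LinearEquiv.eq_symm_apply]
  have h : (hbEnd b g).symm (V.grading.proj g v) =
      V.grading.proj g ((hbEnd b g).symm v) := by
    rw [LinearEquiv.symm_apply_eq, hbEnd_proj, LinearEquiv.apply_symm_apply]
    congr 2
    group
  rw [h, hbEnd_comm, ← h, LinearEquiv.apply_symm_apply]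

end VecG

/-! ### Linear structure on the Drinfeld center -/

namespace VecG

variable {G : Type*} [Group G] [Fintype G] {α : NormalizedCocycle G}

instance : MonoidalPreadditive (VecG α) where
  whiskerLeft_zero {X Y Z} := by
    apply hom_ext; exact TensorProduct.map_zero_right (LinearMap.id : X.carrier →ₗ[ℂ] X.carrier)
  zero_whiskerRight {X Y Z} := by
    apply hom_ext; exact TensorProduct.map_zero_left (LinearMap.id : X.carrier →ₗ[ℂ] X.carrier)
  whiskerLeft_add {X Y Z} f g := by
    apply hom_ext
    exact TensorProduct.map_add_right (LinearMap.id : X.carrier →ₗ[ℂ] X.carrier) _ _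
  add_whiskerRight {X Y Z} f g := by
    apply hom_ext
    exact TensorProduct.map_add_left _ _ (LinearMap.id : X.carrier →ₗ[ℂ] X.carrier)

instance : MonoidalLinear ℂ (VecG α) where
  whiskerLeft_smul X Y Z r f := by
    apply hom_ext
    exact TensorProduct.map_smul_right r (LinearMap.id : X.carrier →ₗ[ℂ] X.carrier) _
  smul_whiskerRight r Y Z f X := by
    apply hom_ext
    exact TensorProduct.map_smul_left r _ (LinearMap.id : X.carrier →ₗ[ℂ] X.carrier)

end VecG

namespace CenterLinear

variable {C : Type*} [Category C] [Preadditive C] [Linear ℂ C] [MonoidalCategory C]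
  [MonoidalPreadditive C] [MonoidalLinear ℂ C]

/-- The morphisms of the center as a subspace of the morphisms of `C`. -/
def homSubmodule (X Y : Center C) : Submodule ℂ (X.1 ⟶ Y.1) where
  carrier := {f | ∀ U, (f ▷ U) ≫ (Y.2.β U).hom = (X.2.β U).hom ≫ (U ◁ f)}
  add_mem' {f g} hf hg U := by
    rw [MonoidalPreadditive.add_whiskerRight, MonoidalPreadditive.whiskerLeft_add,
      Preadditive.add_comp, Preadditive.comp_add, hf U, hg U]
  zero_mem' U := by
    rw [MonoidalPreadditive.zero_whiskerRight, MonoidalPreadditive.whiskerLeft_zero,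
      Limits.zero_comp, Limits.comp_zero]
  smul_mem' r f hf U := by
    rw [MonoidalLinear.smul_whiskerRight, MonoidalLinear.whiskerLeft_smul, Linear.smul_comp,
      Linear.comp_smul, hf U]

/-- The identification of the morphisms of the center with a subspace. -/
def homEquiv (X Y : Center C) : (X ⟶ Y) ≃ homSubmodule X Y where
  toFun f := ⟨f.f, f.comm⟩
  invFun f := ⟨f.1, f.2⟩
  left_inv _ := rfl
  right_inv _ := rfl

instance (X Y : Center C) : AddCommGroup (X ⟶ Y) := (homEquiv X Y).addCommGroup

instance (X Y : Center C) : Module ℂ (X ⟶ Y) := (homEquiv X Y).module ℂ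

theorem add_f {X Y : Center C} (f g : X ⟶ Y) : (f + g).f = f.f + g.f := rfl
theorem smul_f {X Y : Center C} (c : ℂ) (f : X ⟶ Y) : (c • f).f = c • f.f := rfl

/-- Addition of morphisms of the center is addition of the underlying morphisms. -/
instance : Preadditive (Center C) where
  add_comp _ _ _ f f' g := Center.ext _ _ (Preadditive.add_comp _ _ _ f.f f'.f g.f)
  comp_add _ _ _ f g g' := Center.ext _ _ (Preadditive.comp_add _ _ _ f.f g.f g'.f)

instance : Linear ℂ (Center C) where
  smul_comp _ _ _ r f g := Center.ext _ _ (Linear.smul_comp _ _ _ r f.f g.f)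
  comp_smul _ _ _ f r g := Center.ext _ _ (Linear.comp_smul _ _ _ f.f r g.f)

end CenterLinear

/-- The braided category with the same underlying monoidal category as `C` and the reversed
braiding `c_{Y,X}⁻¹ : X ⊗ Y ≅ Y ⊗ X`. -/
def Bop (C : Type*) : Type _ := C

namespace Bop

variable (C : Type*) [Category C]

instance : Category (Bop C) := inferInstanceAs (Category C)
instance [Preadditive C] : Preadditive (Bop C) := inferInstanceAs (Preadditive C)
instance [Preadditive C] [Linear ℂ C] : Linear ℂ (Bop C) := inferInstanceAs (Linear ℂ C)
instance [MonoidalCategory C] : MonoidalCategory (Bop C) := inferInstanceAs (MonoidalCategory C)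
instance [MonoidalCategory C] [BraidedCategory C] : BraidedCategory (Bop C) := reverseBraiding C

end Bop

/-! ### The two twists -/

/-- The twist of a representation `V`: the partial trace of the braiding of `V` with itself, with
respect to the pivotal structure. -/
noncomputable def RepCat.twist {H : Type*} [Ring H] [Algebra ℂ H] [QuasiHopf H]
    [QuasiHopf.Pivot H] (V : RepCat H) : V ⟶ V :=
  partialTrace (β_ V V).hom (coev V) (pivotal V ▷ dual V ≫ ev (dual V))

/-- The twist on the center of graded vector spaces with the reversed braiding: the partial trace
of the reversed braiding of an object with itself, with respect to the pivotal structure. -/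
noncomputable def bopTwist {G : Type*} [Group G] [Fintype G] {α : NormalizedCocycle G}
    (X : Bop (Center (VecG α))) : X ⟶ X :=
  show Center.Hom (C := VecG α) X X from
    ⟨VecG.twist (Sigma.snd (α := VecG α) (β := HalfBraiding) X), VecG.twist_comm _⟩

/-! ### Ribbon fusion categories and their modular data -/

section Ribbon

open Limits

variable (C : Type*) [Category C] [Preadditive C] [Linear ℂ C]

/-- Isomorphism of simple objects. -/
def simpleSetoid : Setoid {X : C // Simple X} where
  r X Y := Nonempty (X.1 ≅ Y.1)
  iseqv :=
    { refl := fun X => ⟨Iso.refl X.1⟩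
      symm := fun ⟨e⟩ => ⟨e.symm⟩
      trans := fun ⟨e⟩ ⟨f⟩ => ⟨e ≪≫ f⟩ }

/-- The set of isomorphism classes of simple objects. -/
def SimpleClass : Type _ := Quotient (simpleSetoid C)

variable {C}

/-- A representative of a class of simple objects. -/
noncomputable def SimpleClass.rep (i : SimpleClass C) : C := (Quotient.out i).1

open scoped Classical in
/-- The scalar by which an endomorphism acts, or `0` if it is not a scalar. -/
noncomputable def endScalar {X : C} (f : X ⟶ X) : ℂ :=
  if h : ∃ c : ℂ, f = c • 𝟙 X then h.choose else 0

variable [MonoidalCategory C] [BraidedCategory C]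

/-- `C` is a ribbon fusion category over `ℂ` with twist `θ`: it is an abelian, `ℂ`-linear,
semisimple, rigid braided category with finitely many simple objects, finite-dimensional morphism
spaces and simple unit, and `θ` is a natural automorphism of the identity functor with
`θ_{X ⊗ Y} = (θ_X ⊗ θ_Y) c_{Y,X} c_{X,Y}` and `θ_{X*} = (θ_X)*`. -/
structure IsRibbonFusion (θ : ∀ X : C, X ⟶ X) : Prop where
  [monoidalPreadditive : MonoidalPreadditive C]
  monoidalLinear : MonoidalLinear ℂ C
  hasFiniteProducts : HasFiniteProducts C
  hasKernels : HasKernels C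
  hasCokernels : HasCokernels C
  normalMono : IsNormalMonoCategory C
  normalEpi : IsNormalEpiCategory C
  finite_hom : ∀ X Y : C, Module.Finite ℂ (X ⟶ Y)
  end_simple : ∀ X : C, Simple X → ∀ f : X ⟶ X, ∃ c : ℂ, f = c • 𝟙 X
  semisimple : ∀ X : C, ∃ (n : ℕ) (F : Fin n → C) (b : Bicone F),
    (∀ i, Simple (F i)) ∧ Nonempty b.IsBilimit ∧ Nonempty (b.pt ≅ X)
  finite_simple : Finite (SimpleClass C)
  simple_unit : Simple (𝟙_ C)
  exists_right_dual : ∀ X : C, ∃ Y : C, Nonempty (ExactPairing X Y)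
  exists_left_dual : ∀ X : C, ∃ Y : C, Nonempty (ExactPairing Y X)
  twist_naturality : ∀ {X Y : C} (f : X ⟶ Y), f ≫ θ Y = θ X ≫ f
  twist_isIso : ∀ X : C, IsIso (θ X)
  twist_tensor : ∀ X Y : C, θ (X ⊗ Y) = (β_ X Y).hom ≫ (β_ Y X).hom ≫ (θ X ⊗ₘ θ Y)
  twist_dual : ∀ (X Y : C) [ExactPairing X Y], η_ X Y ≫ θ X ▷ Y = η_ X Y ≫ X ◁ θ Y

/-- The evaluation `X ⊗ X* ⟶ 𝟙` obtained from the evaluation `X* ⊗ X ⟶ 𝟙` and the twist. -/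
def twistedEv (θ : ∀ X : C, X ⟶ X) (X X' : C) [ExactPairing X X'] : X ⊗ X' ⟶ 𝟙_ C :=
  θ X ▷ X' ≫ (β_ X X').hom ≫ ε_ X X'

/-- The endomorphism of the unit obtained from the double braiding of `X*` and `Y` by closing the
strands of `X` and `Y`. -/
def sMorphism (θ : ∀ X : C, X ⟶ X) (X X' Y Y' : C) [ExactPairing X X'] [ExactPairing Y Y'] :
    𝟙_ C ⟶ 𝟙_ C :=
  (λ_ (𝟙_ C)).inv ≫ (η_ X X' ⊗ₘ η_ Y Y') ≫ (α_ X X' (Y ⊗ Y')).hom ≫ X ◁ (α_ X' Y Y').inv ≫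
    X ◁ (((β_ X' Y).hom ≫ (β_ Y X').hom) ▷ Y') ≫ X ◁ (α_ X' Y Y').hom ≫
      (α_ X X' (Y ⊗ Y')).inv ≫ (twistedEv θ X X' ⊗ₘ twistedEv θ Y Y') ≫ (λ_ (𝟙_ C)).hom

open scoped Classical in
/-- The entry of the unnormalized `S`-matrix at the objects `X` and `Y`. -/
noncomputable def sEntry (θ : ∀ X : C, X ⟶ X) (X Y : C) : ℂ :=
  if h : (∃ X' : C, Nonempty (ExactPairing X X')) ∧ ∃ Y' : C, Nonempty (ExactPairing Y Y') then
    haveI := h.1.choose_spec.some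
    haveI := h.2.choose_spec.some
    endScalar (sMorphism θ X h.1.choose Y h.2.choose)
  else 0

/-- The `S`-matrix, with normalization `1 / D`. -/
noncomputable def sMatrix (θ : ∀ X : C, X ⟶ X) (D : ℂ) :
    Matrix (SimpleClass C) (SimpleClass C) ℂ :=
  fun i j => D⁻¹ * sEntry θ i.rep j.rep

open scoped Classical in
/-- The `T`-matrix: the diagonal matrix of the twists of the simple objects. -/
noncomputable def tMatrix (θ : ∀ X : C, X ⟶ X) : Matrix (SimpleClass C) (SimpleClass C) ℂ :=
  Matrix.diagonal fun i => endScalar (θ i.rep)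

end Ribbon

/-! The two categories describe the same data. A representation of the twisted double is a
`G`-graded space, the projection to degree `g` being the action of `δ_g ē`, together with
automorphisms `tr x`, the action of `∑_g δ_g x̄`, that carry degree `g` to degree `xgx⁻¹` and
satisfy `x̄ ȳ = θ · \overline{xy}` on each component. A half-braiding on a graded space is natural,
so it is determined by its values at the one-dimensional spaces of degree `k`, that is, by
automorphisms `a_k` (`VecG.hbEnd`). Preservation of degrees says that `a_k` carries degree `g` to
`k⁻¹gk`, and compatibility with tensor products says that `a_{kl} = θ⁻¹ a_l a_k`. Setting `a_k = (tr
k)⁻¹` turns one kind of data into the other: inversion reverses the order of composition, and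
replacing `ω` by `ω⁻¹` inverts `θ`.

The resulting functor `RepCat.toCenter` is the identity on spaces and linear maps, and an
equivalence. Its monoidal constraints are identities: the scalar `γ` enters one tensor product
through the comultiplication and the other through the three associators in a half-braiding of a
tensor product, and both associators multiply by `ω⁻¹`. For `v` of degree `g`, the braiding `v ⊗ w ↦
gw ⊗ v` is inverse to the half-braiding `w ⊗ v ↦ v ⊗ g⁻¹w`, which is why the braiding of the center
is reversed. Both twists are the same partial trace in graded terms, which `Grading.traceLin_proj`
evaluates: on degree `g` it is the action of `g`.

The ribbon fusion axioms are checked on representations only. The abelian structure is that of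
modules, semisimplicity is Maschke averaging over the elements `δ_g x̄`
(`TwistedDouble.conjSum_δ_smul`), and the zigzag identities are the antipode axioms involving `Φ`.
The twist is the action of `∑_g δ_g ḡ`, so it is natural; it is compatible with duals because the
antipode fixes this element (`sc_self`), and with tensor products because of the scalar identity
`γ_mul_self`. `IsRibbonFusion.transfer` carries the axioms over to the center.

A braided functor that respects twists carries the morphism defining an entry of `S` to a conjugate
of the corresponding morphism (`sMorphism_map`). By naturality that morphism depends neither on the
chosen duals nor on the chosen representatives (`sMorphism_congr`), so the bijection of simple
classes induced by the equivalence preserves `S`, and likewise `T`. -/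

namespace RepCat

open Limits

/-! ### Representations as modules: abelian structure and semisimple decompositions -/

section Module

variable {H : Type*} [Ring H] [Algebra ℂ H]

/-- The `H`-module underlying a representation of `H`. -/
abbrev moduleOfRep (V : RepCat H) : Module H V.carrier := Module.compHom V.carrier V.ρ.toRingHom

attribute [local instance] moduleOfRep

theorem smul_eq (V : RepCat H) (h : H) (v : V.carrier) : h • v = V.ρ h v := rfl

instance isScalarTower_rep (V : RepCat H) : IsScalarTower ℂ H V.carrier :=
  ⟨fun c h v => by rw [smul_eq, smul_eq, map_smul]; rfl⟩

/-- A finite-dimensional `H`-module as a representation. -/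
noncomputable def ofModule (M : Type) [AddCommGroup M] [Module ℂ M] [Module H M]
    [IsScalarTower ℂ H M] [Module.Finite ℂ M] : RepCat H where
  carrier := M
  ρ := Algebra.lsmul ℂ ℂ M

/-- The `H`-linear map underlying a morphism. -/
def Hom.toModuleHom {V W : RepCat H} (f : V ⟶ W) : V.carrier →ₗ[H] W.carrier where
  toFun := Hom.toLin f
  map_add' := map_add _
  map_smul' := Hom.comm f

instance finite_submodule (V : RepCat H) (N : Submodule H V.carrier) : Module.Finite ℂ N :=
  inferInstanceAs (Module.Finite ℂ (N.restrictScalars ℂ))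

instance finite_quotient (V : RepCat H) (N : Submodule H V.carrier) :
    Module.Finite ℂ (V.carrier ⧸ N) :=
  Module.Finite.of_surjective (N.mkQ.restrictScalars ℂ) N.mkQ_surjective

/-- The subrepresentation carried by a submodule. -/
noncomputable abbrev sub (V : RepCat H) (N : Submodule H V.carrier) : RepCat H := ofModule N

/-- The quotient representation by a submodule. -/
noncomputable abbrev quot (V : RepCat H) (N : Submodule H V.carrier) : RepCat H :=
  ofModule (V.carrier ⧸ N)

/-- The inclusion of a subrepresentation. -/
noncomputable def subι (V : RepCat H) (N : Submodule H V.carrier) : sub V N ⟶ V :=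
  (⟨N.subtype.restrictScalars ℂ, fun _ _ => rfl⟩ : Hom (sub V N) V)

/-- The projection to a quotient representation. -/
noncomputable def quotπ (V : RepCat H) (N : Submodule H V.carrier) : V ⟶ quot V N :=
  (⟨N.mkQ.restrictScalars ℂ, fun _ _ => rfl⟩ : Hom V (quot V N))

/-- The lift of a morphism to a subrepresentation. -/
noncomputable def subLift {U V : RepCat H} (N : Submodule H V.carrier) (f : U ⟶ V)
    (h : ∀ u : U.carrier, Hom.toLin f u ∈ N) : U ⟶ sub V N :=
  (⟨(LinearMap.codRestrict N (Hom.toModuleHom f) h).restrictScalars ℂ,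
    fun x u => (LinearMap.codRestrict N (Hom.toModuleHom f) h).map_smul x u⟩ : Hom U (sub V N))

/-- The morphism from a quotient representation. -/
noncomputable def quotDesc {V U : RepCat H} (N : Submodule H V.carrier) (f : V ⟶ U)
    (h : N ≤ LinearMap.ker (Hom.toModuleHom f)) : quot V N ⟶ U :=
  (⟨(N.liftQ (Hom.toModuleHom f) h).restrictScalars ℂ,
    fun x u => (N.liftQ (Hom.toModuleHom f) h).map_smul x u⟩ : Hom (quot V N) U)

theorem subι_injective (V : RepCat H) (N : Submodule H V.carrier) :
    Function.Injective (Hom.toLin (subι V N)) := Subtype.val_injective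

theorem quotπ_surjective (V : RepCat H) (N : Submodule H V.carrier) :
    Function.Surjective (Hom.toLin (quotπ V N)) := N.mkQ_surjective

theorem subLift_subι {U V : RepCat H} (N : Submodule H V.carrier) (f : U ⟶ V)
    (h : ∀ u : U.carrier, Hom.toLin f u ∈ N) : subLift N f h ≫ subι V N = f := rfl

theorem quotπ_quotDesc {V U : RepCat H} (N : Submodule H V.carrier) (f : V ⟶ U)
    (h : N ≤ LinearMap.ker (Hom.toModuleHom f)) : quotπ V N ≫ quotDesc N f h = f := rfl

theorem mono_of_injective {V W : RepCat H} (f : V ⟶ W) (h : Function.Injective (Hom.toLin f)) :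
    Mono f :=
  ⟨fun _ _ e => hom_ext <| LinearMap.ext fun v =>
    h (LinearMap.congr_fun (congrArg Hom.toLin e) v)⟩

theorem epi_of_surjective {V W : RepCat H} (f : V ⟶ W) (h : Function.Surjective (Hom.toLin f)) :
    Epi f :=
  ⟨fun _ _ e => hom_ext <| LinearMap.ext fun w => by
    obtain ⟨v, rfl⟩ := h w
    exact LinearMap.congr_fun (congrArg Hom.toLin e) v⟩

theorem toLin_apply_eq_zero {U V W : RepCat H} {f : U ⟶ V} {g : V ⟶ W} (w : f ≫ g = 0)
    (u : U.carrier) : Hom.toLin g (Hom.toLin f u) = 0 :=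
  LinearMap.congr_fun (congrArg Hom.toLin w) u

/-- The inclusion of the kernel and the zero morphism agree after composition with `f`; cancelling
`f` makes the kernel zero. -/
theorem injective_of_mono {V W : RepCat H} (f : V ⟶ W) [Mono f] :
    Function.Injective (Hom.toLin f) := by
  rw [injective_iff_map_eq_zero]
  intro v hv
  have h : subι V (LinearMap.ker (Hom.toModuleHom f)) ≫ f = 0 ≫ f :=
    hom_ext <| LinearMap.ext fun x => x.2.trans (map_zero (Hom.toLin f)).symm
  have h' := (cancel_mono f).1 h
  exact LinearMap.congr_fun (congrArg Hom.toLin h')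
    (⟨v, hv⟩ : LinearMap.ker (Hom.toModuleHom f))

/-- The projection to the quotient by the range and the zero morphism agree on the range; cancelling
`f` makes the quotient zero. -/
theorem surjective_of_epi {V W : RepCat H} (f : V ⟶ W) [Epi f] :
    Function.Surjective (Hom.toLin f) := by
  intro w
  have h : f ≫ quotπ W (LinearMap.range (Hom.toModuleHom f)) = f ≫ 0 :=
    hom_ext <| LinearMap.ext fun x =>
      (Submodule.Quotient.mk_eq_zero _).2 (LinearMap.mem_range_self (Hom.toModuleHom f) x)
  have h' := (cancel_epi f).1 h
  have h'' := LinearMap.congr_fun (congrArg Hom.toLin h') w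
  exact (Submodule.Quotient.mk_eq_zero _).1 h''

/-- An isomorphism from a bijective morphism. -/
noncomputable def isoOfBijective {V W : RepCat H} (f : V ⟶ W)
    (h : Function.Bijective (Hom.toLin f)) : V ≅ W :=
  isoMk (LinearEquiv.ofBijective (Hom.toLin f) h) (Hom.comm f)

theorem isIso_of_bijective {V W : RepCat H} (f : V ⟶ W) (h : Function.Bijective (Hom.toLin f)) :
    IsIso f := (isoOfBijective f h).isIso_hom

/-- The inclusion of the kernel is a kernel. -/
noncomputable def isLimitKer {V W : RepCat H} (f : V ⟶ W) :
    IsLimit (KernelFork.ofι (f := f) (subι V (LinearMap.ker (Hom.toModuleHom f)))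
      (hom_ext <| LinearMap.ext fun x => x.2)) :=
  KernelFork.IsLimit.ofι _ _ (fun g w => subLift _ g (toLin_apply_eq_zero w))
    (fun _ _ => rfl) (fun g w m hm => by
      have := mono_of_injective _ (subι_injective V (LinearMap.ker (Hom.toModuleHom f)))
      rw [← cancel_mono (subι V (LinearMap.ker (Hom.toModuleHom f))), hm]
      rfl)

instance : HasKernels (RepCat H) := ⟨fun f => ⟨⟨⟨_, isLimitKer f⟩⟩⟩⟩

theorem range_le_ker {V W U : RepCat H} {f : V ⟶ W} {g : W ⟶ U} (w : f ≫ g = 0) :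
    LinearMap.range (Hom.toModuleHom f) ≤ LinearMap.ker (Hom.toModuleHom g) := by
  rintro _ ⟨v, rfl⟩
  exact toLin_apply_eq_zero w v

/-- The projection to the quotient by the range is a cokernel. -/
noncomputable def isColimitCoker {V W : RepCat H} (f : V ⟶ W) :
    IsColimit (CokernelCofork.ofπ (f := f) (quotπ W (LinearMap.range (Hom.toModuleHom f)))
      (hom_ext <| LinearMap.ext fun x => (Submodule.Quotient.mk_eq_zero _).2
        (LinearMap.mem_range_self (Hom.toModuleHom f) x))) :=
  CokernelCofork.IsColimit.ofπ _ _ (fun g w => quotDesc _ g (range_le_ker w))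
    (fun _ _ => rfl) (fun g w m hm => by
      have := epi_of_surjective _ (quotπ_surjective W (LinearMap.range (Hom.toModuleHom f)))
      rw [← cancel_epi (quotπ W (LinearMap.range (Hom.toModuleHom f))), hm]
      rfl)

instance : HasCokernels (RepCat H) := ⟨fun f => ⟨⟨⟨_, isColimitCoker f⟩⟩⟩⟩

/-- The factorization of `g` through an injective morphism. -/
noncomputable def liftOfInjective {V W U : RepCat H} (f : V ⟶ W)
    (hf : Function.Injective (Hom.toLin f)) (g : U ⟶ W)
    (h : ∀ u, Hom.toLin g u ∈ LinearMap.range (Hom.toModuleHom f)) : U ⟶ V :=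
  subLift _ g h ≫ (isoOfBijective (subLift (LinearMap.range (Hom.toModuleHom f)) f
    fun v => ⟨v, rfl⟩) ⟨fun v v' e => hf (congrArg Subtype.val e), by
      rintro ⟨_, v, rfl⟩
      exact ⟨v, rfl⟩⟩).inv

theorem liftOfInjective_comp {V W U : RepCat H} (f : V ⟶ W)
    (hf : Function.Injective (Hom.toLin f)) (g : U ⟶ W)
    (h : ∀ u, Hom.toLin g u ∈ LinearMap.range (Hom.toModuleHom f)) :
    liftOfInjective f hf g h ≫ f = g := by
  -- An injective `f` is an isomorphism onto its range followed by the inclusion; the lift contains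
  -- the inverse of that isomorphism, which then cancels.
  have h1 : f = (isoOfBijective (subLift (LinearMap.range (Hom.toModuleHom f)) f
    fun v => ⟨v, rfl⟩) ⟨fun v v' e => hf (congrArg Subtype.val e), by
      rintro ⟨_, v, rfl⟩
      exact ⟨v, rfl⟩⟩).hom ≫ subι _ _ := rfl
  conv_lhs => enter [2]; rw [h1]
  rw [liftOfInjective, Category.assoc, Iso.inv_hom_id_assoc, subLift_subι]

/-- A monomorphism is injective, hence a kernel of the projection to the quotient by its range. -/
instance : IsNormalMonoCategory (RepCat H) where
  normalMonoOfMono {V W} f _ := ⟨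
    { Z := quot W (LinearMap.range (Hom.toModuleHom f))
      g := quotπ W _
      w := hom_ext <| LinearMap.ext fun x => (Submodule.Quotient.mk_eq_zero _).2
        (LinearMap.mem_range_self (Hom.toModuleHom f) x)
      isLimit := KernelFork.IsLimit.ofι _ _
        (fun g w => liftOfInjective f (injective_of_mono f) g fun u =>
          (Submodule.Quotient.mk_eq_zero _).1 (toLin_apply_eq_zero w u))
        (fun g w => liftOfInjective_comp _ _ _ _)
        (fun _ _ _ hm => by rw [← cancel_mono f, hm, liftOfInjective_comp]) }⟩

theorem quotDesc_ker_injective {V W : RepCat H} (f : V ⟶ W) : Function.Injective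
    (Hom.toLin (quotDesc (LinearMap.ker (Hom.toModuleHom f)) f le_rfl)) := by
  have h := LinearMap.ker_eq_bot.1 (Submodule.ker_liftQ_eq_bot _ (Hom.toModuleHom f) le_rfl le_rfl)
  exact h

/-- The factorization of `g` through a surjective morphism. -/
noncomputable def descOfSurjective {V W U : RepCat H} (f : V ⟶ W)
    (hf : Function.Surjective (Hom.toLin f)) (g : V ⟶ U)
    (h : LinearMap.ker (Hom.toModuleHom f) ≤ LinearMap.ker (Hom.toModuleHom g)) : W ⟶ U :=
  (isoOfBijective (quotDesc (LinearMap.ker (Hom.toModuleHom f)) f le_rfl)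
    ⟨quotDesc_ker_injective f,
      fun w => by
        obtain ⟨v, rfl⟩ := hf w
        exact ⟨Submodule.Quotient.mk v, rfl⟩⟩).inv ≫ quotDesc _ g h

theorem comp_descOfSurjective {V W U : RepCat H} (f : V ⟶ W)
    (hf : Function.Surjective (Hom.toLin f)) (g : V ⟶ U)
    (h : LinearMap.ker (Hom.toModuleHom f) ≤ LinearMap.ker (Hom.toModuleHom g)) :
    f ≫ descOfSurjective f hf g h = g := by
  have h1 : f = quotπ _ _ ≫ (isoOfBijective (quotDesc (LinearMap.ker (Hom.toModuleHom f)) f le_rfl)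
    ⟨quotDesc_ker_injective f,
      fun w => by
        obtain ⟨v, rfl⟩ := hf w
        exact ⟨Submodule.Quotient.mk v, rfl⟩⟩).hom := rfl
  conv_lhs => enter [1]; rw [h1]
  rw [descOfSurjective, Category.assoc, Iso.hom_inv_id_assoc, quotπ_quotDesc]

/-- An epimorphism is surjective, hence a cokernel of the inclusion of its kernel. -/
instance : IsNormalEpiCategory (RepCat H) where
  normalEpiOfEpi {V _} f _ := ⟨
    { W := sub V (LinearMap.ker (Hom.toModuleHom f))
      g := subι V _
      w := hom_ext <| LinearMap.ext fun x => x.2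
      isColimit := CokernelCofork.IsColimit.ofπ _ _
        (fun g w => descOfSurjective f (surjective_of_epi f) g fun v hv =>
          toLin_apply_eq_zero w (⟨v, hv⟩ : LinearMap.ker (Hom.toModuleHom f)))
        (fun _ _ => comp_descOfSurjective _ _ _ _)
        (fun _ _ _ hm => (cancel_epi f).1 (hm.trans (comp_descOfSurjective _ _ _ _).symm)) }⟩

/-- The linear map underlying a morphism, as a linear function of the morphism. -/
def toLinₗ (V W : RepCat H) : (V ⟶ W) →ₗ[ℂ] (V.carrier →ₗ[ℂ] W.carrier) where
  toFun f := Hom.toLin f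
  map_add' _ _ := rfl
  map_smul' _ _ := rfl

section Products

variable {n : ℕ} (F : Fin n → RepCat H)

/-- The product of finitely many representations, with its projections and inclusions. -/
noncomputable def piBicone : Bicone F where
  pt := ofModule (∀ i, (F i).carrier)
  π i := (⟨LinearMap.proj i, fun _ _ => rfl⟩ : Hom (ofModule (∀ i, (F i).carrier)) (F i))
  ι i := (⟨LinearMap.single ℂ (fun i => (F i).carrier) i, fun h v =>
    (LinearMap.single H (fun i => (F i).carrier) i).map_smul h v⟩ :
      Hom (F i) (ofModule (∀ i, (F i).carrier)))
  ι_π i j := by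
    split_ifs with h
    · subst h
      exact hom_ext <| LinearMap.ext fun v =>
        Pi.single_eq_same (M := fun i => (F i).carrier) i v
    · exact hom_ext <| LinearMap.ext fun v =>
        Pi.single_eq_of_ne (M := fun i => (F i).carrier) (Ne.symm h) v

theorem sum_toLin {V W : RepCat H} {ι : Type*} (s : Finset ι) (f : ι → (V ⟶ W)) :
    Hom.toLin (∑ i ∈ s, f i : V ⟶ W) = ∑ i ∈ s, Hom.toLin (f i) :=
  map_sum (toLinₗ V W) f s

theorem piBicone_total : ∑ i, (piBicone F).π i ≫ (piBicone F).ι i = 𝟙 (piBicone F).pt := by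
  apply hom_ext
  rw [sum_toLin]
  refine LinearMap.ext fun v => ?_
  rw [LinearMap.sum_apply]
  exact Finset.univ_sum_single (M := fun i => (F i).carrier) v

/-- The product is a biproduct. -/
noncomputable def piBiconeIsBilimit : (piBicone F).IsBilimit :=
  isBilimitOfTotal _ (piBicone_total F)

end Products

instance : HasFiniteBiproducts (RepCat H) :=
  ⟨fun _ => ⟨fun F => hasBiproduct_of_total _ (piBicone_total F)⟩⟩

instance finite_hom (V W : RepCat H) : Module.Finite ℂ (V ⟶ W) :=
  Module.Finite.of_injective (toLinₗ V W) fun _ _ h => hom_ext h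

/-- A submodule gives a monomorphism into `V`, which is zero or an isomorphism; these are the cases
`⊥` and `⊤`. -/
theorem isSimpleModule_of_simple (V : RepCat H) [Simple V] : IsSimpleModule H V.carrier := by
  have : Nontrivial V.carrier := by
    by_contra h
    rw [not_nontrivial_iff_subsingleton] at h
    exact id_nonzero V (hom_ext <| LinearMap.ext fun v => Subsingleton.elim _ _)
  refine { toIsSimpleOrder := ⟨fun N => ?_⟩ }
  have := mono_of_injective _ (subι_injective V N)
  by_cases h : subι V N = 0
  · left
    rw [eq_bot_iff]
    intro v hv
    exact LinearMap.congr_fun (congrArg Hom.toLin h) (⟨v, hv⟩ : N)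
  · right
    have := isIso_of_mono_of_nonzero h
    rw [eq_top_iff]
    intro v _
    obtain ⟨⟨w, hw⟩, rfl⟩ := surjective_of_epi (subι V N) v
    exact hw

/-- The range of a monomorphism into `V` is `⊥` or `⊤`, so a nonzero one is bijective. -/
theorem simple_of_isSimpleModule (V : RepCat H) [IsSimpleModule H V.carrier] : Simple V where
  mono_isIso_iff_nonzero {W} f _ := by
    constructor
    · rintro _ rfl
      have := IsSimpleModule.nontrivial H V.carrier
      obtain ⟨v, hv⟩ := exists_ne (0 : V.carrier)
      obtain ⟨w, rfl⟩ := surjective_of_epi (0 : W ⟶ V) v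
      exact hv rfl
    · intro h
      refine isIso_of_bijective f ⟨injective_of_mono f, ?_⟩
      rcases eq_bot_or_eq_top (LinearMap.range (Hom.toModuleHom f)) with h' | h'
      · exact absurd (hom_ext <| LinearMap.ext fun w => LinearMap.congr_fun
          (LinearMap.range_eq_bot.1 h') w) h
      · have h'' := LinearMap.range_eq_top.1 h'
        exact h''

/-- The isomorphism of representations given by an `H`-linear equivalence. -/
noncomputable def isoOfModuleEquiv {V W : RepCat H} (e : V.carrier ≃ₗ[H] W.carrier) : V ≅ W :=
  isoMk (e.restrictScalars ℂ) e.map_smul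

/-- A finite-dimensional representation is a finitely generated module over a semisimple ring, hence
a finite direct sum of simple submodules. A direct sum over `Fin n` is the product that underlies
`piBicone`. -/
theorem semisimple [IsSemisimpleRing H] (V : RepCat H) : ∃ (n : ℕ) (F : Fin n → RepCat H)
    (b : Bicone F), (∀ i, Simple (F i)) ∧ Nonempty b.IsBilimit ∧ Nonempty (b.pt ≅ V) := by
  have : Module.Finite H V.carrier := Module.Finite.of_restrictScalars_finite ℂ H V.carrier
  obtain ⟨n, S, e, hS⟩ := IsSemisimpleModule.exists_linearEquiv_fin_dfinsupp H V.carrier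
  refine ⟨n, fun i => sub V (S i), piBicone _, fun i => ?_, ⟨piBiconeIsBilimit _⟩, ⟨?_⟩⟩
  · have : IsSimpleModule H (sub V (S i)).carrier := hS i
    exact simple_of_isSimpleModule _
  · exact isoOfModuleEquiv (V := (piBicone fun i => sub V (S i)).pt)
      ((e.trans (DFinsupp.linearEquivFunOnFintype (R := H) (M := fun i => S i))).symm)

/-- The regular module is a finite direct sum of simple submodules. Every simple module receives a
nonzero map from it, so by Schur's lemma it is isomorphic to one of these summands, and the index of
the summand determines the class. -/
theorem finite_simpleClass [IsSemisimpleRing H] : Finite (SimpleClass (RepCat H)) := by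
  obtain ⟨n, S, e, hS⟩ := IsSemisimpleModule.exists_linearEquiv_fin_dfinsupp H H
  have key : ∀ V : {V : RepCat H // Simple V}, ∃ i, Nonempty (S i ≃ₗ[H] V.1.carrier) := by
    rintro ⟨V, hV⟩
    have := isSimpleModule_of_simple V
    have := IsSimpleModule.nontrivial H V.carrier
    obtain ⟨v, hv⟩ := exists_ne (0 : V.carrier)
    let f : H →ₗ[H] V.carrier := LinearMap.toSpanSingleton H _ v
    have hf : f ≠ 0 := fun h => hv (by simpa [f] using LinearMap.congr_fun h 1)
    by_contra hc
    push Not at hc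
    apply hf
    -- If no summand is isomorphic to `V`, Schur's lemma kills the restriction of `f` to every
    -- summand, hence `f` itself.
    have h0 : f ∘ₗ e.symm.toLinearMap = 0 := by
      apply DFinsupp.lhom_ext'
      intro i
      have := hS i
      rcases LinearMap.bijective_or_eq_zero ((f ∘ₗ e.symm.toLinearMap) ∘ₗ
        DFinsupp.lsingle (R := H) i) with h | h
      · exact ((hc i).false (LinearEquiv.ofBijective _ h)).elim
      · rw [h, LinearMap.zero_comp]
    ext
    have := LinearMap.congr_fun h0 (e 1)
    simpa using this
  choose i hi using key
  refine Finite.of_injective (fun c : SimpleClass (RepCat H) => i (Quotient.out c)) ?_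
  intro c c' h
  obtain ⟨a⟩ := hi (Quotient.out c)
  obtain ⟨a'⟩ := hi (Quotient.out c')
  dsimp only at h
  rw [← Quotient.out_eq c, ← Quotient.out_eq c']
  refine Quotient.sound ⟨isoOfModuleEquiv ?_⟩
  rw [← h] at a'
  exact a.symm.trans a'

/-- Schur's lemma over the algebraically closed field `ℂ`, with finite-dimensional endomorphism
spaces. -/
theorem end_simple (V : RepCat H) (hV : Simple V) (f : V ⟶ V) : ∃ c : ℂ, f = c • 𝟙 V := by
  obtain ⟨c, hc⟩ := endomorphism_simple_eq_smul_id ℂ f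
  exact ⟨c, hc.symm⟩

end Module

end RepCat

/-! ### Maschke's theorem for the twisted double -/

namespace TwistedDouble

variable {G : Type*} [Group G] [Fintype G] {ω : NormalizedCocycle G}

/-- The quasi-inverse `θ_g(x, x⁻¹)⁻¹ δ_{x⁻¹gx} \overline{x⁻¹}` of `δ_g x̄`. -/
noncomputable def qinv (ω : NormalizedCocycle G) (g x : G) : TwistedDouble ω :=
  (((ω.θ g x x⁻¹)⁻¹ : ℂˣ) : ℂ) • δ ω (x⁻¹ * g * x) x⁻¹

theorem δ_mul_qinv (g x : G) : δ ω g x * qinv ω g x = δ ω g 1 := by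
  rw [qinv, mul_smul_comm, δ_mul_of_eq x⁻¹ rfl, smul_smul]
  simp

theorem qinv_mul_of_ne {g x h : G} (y : G) (e : g ≠ h) : qinv ω g x * δ ω h y = 0 := by
  rw [qinv, smul_mul_assoc, δ_mul_of_ne y, smul_zero]
  simpa [mul_assoc] using e

/-- From `δ_h ȳ · δ_{y⁻¹hy} x̄ = θ_h(y, x) δ_h \overline{yx}`: taking quasi-inverses and multiplying
by `δ_h ȳ` leaves the quasi-inverse of the second factor. The scalar is checked by the cocycle
identity of `θ` at `(y, x, x⁻¹)` and at `(yx, (yx)⁻¹, y)`. -/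
theorem qinv_mul (h x y : G) :
    qinv ω h (y * x) * δ ω h y = (ω.θ h y x : ℂ) • qinv ω (y⁻¹ * h * y) x := by
  have h1 := ω.θ_add h y x x⁻¹
  have h2 := ω.θ_add h (y * x) (y * x)⁻¹ y
  have e1 : ((y * x)⁻¹)⁻¹ * ((y * x)⁻¹ * h * (y * x)) * (y * x)⁻¹ = h := by group
  have e2 : (y * x)⁻¹ * y = x⁻¹ := by group
  have e3 : x⁻¹ * (y⁻¹ * h * y) * x = (y * x)⁻¹ * h * (y * x) := by group
  rw [qinv, qinv, smul_mul_assoc, δ_mul_of_eq y e1, e2, e3, smul_smul, smul_smul]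
  congr 1
  rw [← Units.val_mul, ← Units.val_mul]
  congr 1
  apply Additive.ofMul.injective
  rw [e2] at h2
  simp only [mul_inv_cancel, NormalizedCocycle.θ_one_right, NormalizedCocycle.θ_one_left,
    ofMul_one, zero_add, add_zero, ofMul_mul, ofMul_inv] at h1 h2 ⊢
  linear_combination (norm := abel) -h2 - h1

section Average

variable {M N : Type*} [AddCommGroup M] [Module (TwistedDouble ω) M] [Module ℂ M]
  [IsScalarTower ℂ (TwistedDouble ω) M] [AddCommGroup N] [Module (TwistedDouble ω) N] [Module ℂ N]
  [IsScalarTower ℂ (TwistedDouble ω) N]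

/-- The sum `∑ δ_g x̄ r (δ_g x̄)⁻¹` for a linear map `r`. -/
noncomputable def conjSum (r : M →ₗ[ℂ] N) : M →ₗ[ℂ] N :=
  ∑ g : G, ∑ x : G, Algebra.lsmul ℂ ℂ N (δ ω g x) ∘ₗ r ∘ₗ Algebra.lsmul ℂ ℂ M (qinv ω g x)

theorem conjSum_apply (r : M →ₗ[ℂ] N) (m : M) :
    conjSum (ω := ω) r m = ∑ g : G, ∑ x : G, δ ω g x • r (qinv ω g x • m) := by
  simp [conjSum]

/-- The substitution `x ↦ yx` of Maschke's argument. Only the summands with `g = h` survive on the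
left, and those with `g = y⁻¹hy` on the right. The scalar `θ_h(y, x)` from passing `δ_h ȳ` through
the quasi-inverse is the one from multiplying it with `δ_{y⁻¹hy} x̄`, so the twisting does not
obstruct the averaging. -/
theorem conjSum_δ_smul (r : M →ₗ[ℂ] N) (h y : G) (m : M) :
    conjSum (ω := ω) r (δ ω h y • m) = δ ω h y • conjSum (ω := ω) r m := by
  rw [conjSum_apply, conjSum_apply, Finset.smul_sum]
  refine (Finset.sum_eq_single h ?_ (by simp)).trans
    (Eq.trans ?_ (Finset.sum_eq_single (y⁻¹ * h * y) ?_ (by simp)).symm)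
  · intro g _ hg
    refine Finset.sum_eq_zero fun x _ => ?_
    rw [← mul_smul, qinv_mul_of_ne y hg, zero_smul, map_zero, smul_zero]
  · rw [Finset.smul_sum]
    refine (Fintype.sum_equiv (Equiv.mulLeft y) _ _ fun x => ?_).symm
    change δ ω h y • δ ω (y⁻¹ * h * y) x • r (qinv ω (y⁻¹ * h * y) x • m) =
      δ ω h (y * x) • r (qinv ω h (y * x) • δ ω h y • m)
    rw [← mul_smul, ← mul_smul (qinv ω h (y * x)), qinv_mul, smul_assoc _ _ m, r.map_smul,
      δ_mul_of_eq x rfl, smul_assoc, smul_comm]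
  · intro g _ hg
    rw [Finset.smul_sum]
    refine Finset.sum_eq_zero fun x _ => ?_
    rw [← mul_smul, δ_mul_of_ne x hg.symm, zero_smul]

theorem conjSum_smul (r : M →ₗ[ℂ] N) (a : TwistedDouble ω) (m : M) :
    conjSum (ω := ω) r (a • m) = a • conjSum (ω := ω) r m := by
  rw [eq_sum a]
  simp only [Finset.sum_smul, map_sum, smul_assoc, map_smul, conjSum_δ_smul]

/-- The average of a linear map is linear over the twisted double. -/
noncomputable def average (r : M →ₗ[ℂ] N) : M →ₗ[TwistedDouble ω] N where
  toFun m := ((Fintype.card G : ℂ)⁻¹) • conjSum (ω := ω) r m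
  map_add' m m' := by rw [map_add, smul_add]
  map_smul' a m := by rw [conjSum_smul, RingHom.id_apply, smul_comm]

/-- Since `i` is linear over the double, each summand collapses to the action of `δ_g x̄` times its
quasi-inverse, that is of `δ_g ē`. Summing over `g` gives the unit, and summing over `x` the factor
`|G|` that the average divides out. -/
theorem average_apply_of_eq (r : M →ₗ[ℂ] N) (i : N →ₗ[TwistedDouble ω] M)
    (h : ∀ n, r (i n) = n) (n : N) : average (ω := ω) r (i n) = n := by
  change ((Fintype.card G : ℂ)⁻¹) • conjSum (ω := ω) r (i n) = n
  have h1 : ∀ g x : G, δ ω g x • r (qinv ω g x • i n) = δ ω g 1 • n := fun g x => by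
    rw [← map_smul i, h, ← mul_smul, δ_mul_qinv]
  rw [conjSum_apply]
  simp only [h1]
  rw [Finset.sum_comm, ← Finset.sum_smul, ← one_eq, one_smul, Finset.sum_const, Finset.card_univ,
    ← Nat.cast_smul_eq_nsmul ℂ, smul_smul,
    inv_mul_cancel₀ (Nat.cast_ne_zero.2 Fintype.card_ne_zero), one_smul]

end Average

/-- The twisted double is a semisimple algebra. -/
instance isSemisimpleRing : IsSemisimpleRing (TwistedDouble ω) where
  exists_isCompl N := by
    -- A complex-linear retraction onto the left ideal is averaged to one linear over the double;
    -- its kernel is the complement.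
    obtain ⟨r, hr⟩ := LinearMap.exists_leftInverse_of_injective
      (N.subtype.restrictScalars ℂ) (LinearMap.ker_eq_bot.2 Subtype.val_injective)
    exact ⟨_, LinearMap.isCompl_of_proj fun n =>
      average_apply_of_eq (ω := ω) r N.subtype (LinearMap.congr_fun hr) n⟩

end TwistedDouble

/-! ### Representations of the twisted double as graded spaces with a projective action -/

theorem Grading.ext_proj {G : Type*} [Fintype G] {V : Type*} [AddCommGroup V] [Module ℂ V]
    {p q : Grading G V} (h : ∀ g, p.proj g = q.proj g) : p = q := by
  cases p; cases q
  congr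
  exact funext h

namespace TwistedDouble

variable {G : Type*} [Group G] [Fintype G] {ω : NormalizedCocycle G}

theorem sum_δ_mul_δ (x g y : G) :
    (∑ h : G, δ ω h x) * δ ω g y = (ω.θ (x * g * x⁻¹) x y : ℂ) • δ ω (x * g * x⁻¹) (x * y) := by
  rw [Finset.sum_mul, Finset.sum_eq_single (x * g * x⁻¹)]
  · rw [δ_mul_of_eq y (by group)]
  · intro h _ hh
    rw [δ_mul_of_ne y]
    rintro rfl
    exact hh (by group)
  · simp

theorem δ_mul_sum_δ (g x y : G) :
    δ ω g x * (∑ h : G, δ ω h y) = (ω.θ g x y : ℂ) • δ ω g (x * y) := by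
  rw [Finset.mul_sum, Finset.sum_eq_single (x⁻¹ * g * x)]
  · rw [δ_mul_of_eq y rfl]
  · intro h _ hh
    rw [δ_mul_of_ne y hh.symm]
  · simp

/-- The element `∑_g δ_g x̄`, as a unit. -/
noncomputable def grp (ω : NormalizedCocycle G) (x : G) : (TwistedDouble ω)ˣ where
  val := ∑ g : G, δ ω g x
  inv := ∑ g : G, qinv ω g x
  val_inv := by
    rw [Finset.sum_mul, one_eq]
    refine Finset.sum_congr rfl fun g _ => ?_
    rw [Finset.mul_sum, Finset.sum_eq_single g, δ_mul_qinv]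
    · intro h _ hh
      rw [qinv, mul_smul_comm, δ_mul_of_ne, smul_zero]
      simpa [mul_assoc] using hh.symm
    · simp
  inv_val := by
    -- The product of the `g`-th quasi-inverse with the sum is `δ_{x⁻¹gx} ē`, so the unit is summed
    -- over conjugates.
    rw [Finset.sum_mul, one_eq,
      ← Fintype.sum_equiv (MulAut.conj x⁻¹).toEquiv _ (fun g => δ ω g 1) fun _ => rfl]
    refine Finset.sum_congr rfl fun g _ => ?_
    rw [qinv, smul_mul_assoc, δ_mul_sum_δ, inv_mul_cancel, ω.θ_inv, smul_smul]
    simp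

theorem grp_val (x : G) : (grp ω x : TwistedDouble ω) = ∑ g : G, δ ω g x := rfl

end TwistedDouble

namespace RepCat

open TwistedDouble

variable {G : Type*} [Group G] [Fintype G] {ω : NormalizedCocycle G}

/-- The grading of a representation of the twisted double: the projection to the component of
degree `g` is the action of `δ_g ē`. -/
noncomputable def grading (V : RepCat (TwistedDouble ω)) : Grading G V.carrier where
  proj g := V.ρ (δ ω g 1)
  proj_self g v := by
    rw [← Module.End.mul_apply, ← map_mul, δ_one_mul]
  proj_ne g h v hgh := by
    rw [← Module.End.mul_apply, ← map_mul, δ_mul_of_ne _ (by simpa using hgh), map_zero]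
    rfl
  sum_proj v := by
    rw [← LinearMap.sum_apply, ← map_sum, ← one_eq, map_one]
    rfl

theorem grading_proj (V : RepCat (TwistedDouble ω)) (g : G) :
    V.grading.proj g = V.ρ (δ ω g 1) := rfl

/-- The action of `∑_g δ_g x̄`. -/
noncomputable def tr (V : RepCat (TwistedDouble ω)) (x : G) : V.carrier ≃ₗ[ℂ] V.carrier :=
  actEquiv V.ρ (grp ω x)

theorem tr_apply (V : RepCat (TwistedDouble ω)) (x : G) (v : V.carrier) :
    V.tr x v = V.ρ (grp ω x : TwistedDouble ω) v := rfl

theorem proj_tr (V : RepCat (TwistedDouble ω)) (g x : G) (v : V.carrier) :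
    V.grading.proj g (V.tr x v) = V.ρ (δ ω g x) v := by
  rw [grading_proj, tr_apply, ← Module.End.mul_apply, ← map_mul, grp_val, δ_mul_sum_δ]
  simp

theorem tr_proj' (V : RepCat (TwistedDouble ω)) (g x : G) (v : V.carrier) :
    V.tr x (V.grading.proj g v) = V.ρ (δ ω (x * g * x⁻¹) x) v := by
  rw [grading_proj, tr_apply, ← Module.End.mul_apply, ← map_mul, grp_val, sum_δ_mul_δ]
  simp

theorem tr_proj (V : RepCat (TwistedDouble ω)) (g x : G) (v : V.carrier) :
    V.tr x (V.grading.proj g v) = V.grading.proj (x * g * x⁻¹) (V.tr x v) := by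
  rw [tr_proj', proj_tr]

/-- Every basis vector acts through the grading and the operators `tr`, so these two together
determine the representation. -/
theorem ρ_δ (V : RepCat (TwistedDouble ω)) (g x : G) (v : V.carrier) :
    V.ρ (δ ω g x) v = V.tr x (V.grading.proj (x⁻¹ * g * x) v) := by
  rw [tr_proj, proj_tr]
  congr 2
  group

theorem tr_symm_proj (V : RepCat (TwistedDouble ω)) (g x : G) (v : V.carrier) :
    (V.tr x).symm (V.grading.proj g v) = V.grading.proj (x⁻¹ * g * x) ((V.tr x).symm v) := by
  rw [LinearEquiv.symm_apply_eq, tr_proj, LinearEquiv.apply_symm_apply]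
  congr 2
  group

/-- The multiplication rule of the double. The subscript of `θ` is the degree of the result,
`xyg(xy)⁻¹`, because `δ_h x̄` has its image in degree `h`. -/
theorem tr_tr (V : RepCat (TwistedDouble ω)) (g x y : G) (v : V.carrier) :
    V.tr x (V.tr y (V.grading.proj g v)) =
      (ω.θ (x * y * g * (x * y)⁻¹) x y : ℂ) • V.tr (x * y) (V.grading.proj g v) := by
  have h : x⁻¹ * (x * y * g * (x * y)⁻¹) * x = y * g * y⁻¹ := by group
  rw [tr_proj', tr_proj', ← LinearMap.smul_apply, ← map_smul V.ρ, ← δ_mul_of_eq y h,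
    map_mul, Module.End.mul_apply, ρ_δ V _ x, h, grading_proj, ← Module.End.mul_apply, ← map_mul,
    δ_one_mul]

end RepCat

/-! ### Tensor product, braiding, duality and twist in terms of the grading -/

namespace RepCat

open TwistedDouble QuasiHopf

variable {G : Type*} [Group G] [Fintype G] {ω : NormalizedCocycle G}

theorem tensorAct_δ (V W : RepCat (TwistedDouble ω)) (g x : G) :
    tensorAct V.ρ W.ρ (δ ω g x) = ∑ h : G, (ω.γ x h (h⁻¹ * g) : ℂ) •
      TensorProduct.map (V.ρ (δ ω h x)) (W.ρ (δ ω (h⁻¹ * g) x)) := by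
  change act V.ρ W.ρ (comul ω (δ ω g x)) = _
  rw [comul_δ, comulδ]
  simp only [map_sum, map_smul, act_tmul']

/-- The scalars `γ_e` are trivial, so the comultiplication of `δ_g ē` is the plain convolution of
projections. -/
theorem grading_tensor (V W : RepCat (TwistedDouble ω)) :
    (tensor V W).grading = V.grading.tensor W.grading := by
  refine Grading.ext_proj fun g => ?_
  change tensorAct V.ρ W.ρ (δ ω g 1) = _
  rw [tensorAct_δ]
  simp only [NormalizedCocycle.γ_one, Units.val_one, one_smul]
  rfl

/-- On `v ⊗ w` of degrees `(a, b)` only the summand `h = xax⁻¹` of the comultiplication survives; it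
carries the scalar `γ_x` at the degrees of the result. -/
theorem tr_tensor (V W : RepCat (TwistedDouble ω)) (x a b : G) (v : V.carrier) (w : W.carrier) :
    (tensor V W).tr x (V.grading.proj a v ⊗ₜ[ℂ] W.grading.proj b w) =
      (ω.γ x (x * a * x⁻¹) (x * b * x⁻¹) : ℂ) •
        (V.tr x (V.grading.proj a v) ⊗ₜ[ℂ] W.tr x (W.grading.proj b w)) := by
  have h1 := Grading.tensor_proj_mul V.grading W.grading a b v w
  rw [← h1, ← grading_tensor]
  refine (tr_proj' (tensor V W) (a * b) x _).trans ?_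
  change tensorAct V.ρ W.ρ (δ ω (x * (a * b) * x⁻¹) x) _ = _
  rw [tensorAct_δ, LinearMap.sum_apply, Finset.sum_eq_single (x * a * x⁻¹)]
  · have e : (x * a * x⁻¹)⁻¹ * (x * (a * b) * x⁻¹) = x * b * x⁻¹ := by group
    rw [e, LinearMap.smul_apply, TensorProduct.map_tmul, ρ_δ, ρ_δ]
    have e1 : ∀ c : G, x⁻¹ * (x * c * x⁻¹) * x = c := fun c => by group
    rw [e1, e1, Grading.proj_self, Grading.proj_self]
  · intro h _ hh
    rw [LinearMap.smul_apply, TensorProduct.map_tmul, ρ_δ, Grading.proj_ne, map_zero,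
      TensorProduct.zero_tmul, smul_zero]
    rintro rfl
    exact hh (by group)
  · simp

theorem grading_unit : (unit (TwistedDouble ω)).grading = Grading.single (1 : G) := by
  classical
  refine Grading.ext_proj fun g => LinearMap.ext fun c : ℂ => ?_
  refine Eq.trans (b := if g = 1 then c else 0) ?_ (Grading.single_proj 1 g c).symm
  change counit ω (δ ω g 1) * c = _
  rw [counit_δ]
  split_ifs <;> simp

theorem tr_unit (x : G) (c : ℂ) : (unit (TwistedDouble ω)).tr x c = c := by
  classical
  change counit ω (∑ g : G, δ ω g x) * c = c
  simp [counit_δ]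

/-- In the first factor `R` only projects, and the summands that survive on degree `g` add up to the
action of `∑_k δ_k ḡ` on the second. -/
theorem braidLin_proj (V W : RepCat (TwistedDouble ω)) (g : G) (v : V.carrier) (w : W.carrier) :
    braidLin V.ρ W.ρ (V.grading.proj g v ⊗ₜ w) = W.tr g w ⊗ₜ V.grading.proj g v := by
  rw [braidLin_apply]
  change TensorProduct.comm ℂ _ _ (act V.ρ W.ρ (TwistedDouble.Rel ω) _) = _
  rw [TwistedDouble.Rel]
  simp only [map_sum, LinearMap.sum_apply, act_tmul]
  rw [Finset.sum_eq_single g]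
  · rw [grading_proj, ← Module.End.mul_apply, ← map_mul, δ_one_mul, tr_apply, grp_val, map_sum,
      LinearMap.sum_apply, TensorProduct.sum_tmul]
    rfl
  · intro h _ hh
    refine Finset.sum_eq_zero fun k _ => ?_
    rw [← grading_proj, Grading.proj_ne _ _ _ _ hh, TensorProduct.zero_tmul, map_zero]
  · simp

theorem assocLin_eq (V W U : RepCat (TwistedDouble ω)) : assocLin V.ρ W.ρ U.ρ =
    Grading.assoc V.grading W.grading U.grading (ω⁻¹ : NormalizedCocycle G) := by
  apply LinearEquiv.toLinearMap_injective
  refine Grading.lin_ext₃ V.grading W.grading U.grading fun a b c v w u => ?_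
  rw [LinearEquiv.coe_coe, LinearEquiv.coe_coe, Grading.assoc_tmul, assocLin_apply]
  change act V.ρ (act W.ρ U.ρ) (diag₃ ω fun g h k => (ω g h k)⁻¹) _ = _
  rw [← Grading.scale_tmul]
  simp only [diag₃, map_sum, map_smul, act_tmul', Grading.scale]
  rfl

theorem ρ_diag (V : RepCat (TwistedDouble ω)) (f : G → ℂˣ) :
    V.ρ (diag f) = V.grading.diag f := by
  simp only [diag, map_sum, map_smul, Grading.diag]
  rfl

theorem grading_dual (V : RepCat (TwistedDouble ω)) : (dual V).grading = V.grading.dual := by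
  refine Grading.ext_proj fun g => LinearMap.ext fun f : Module.Dual ℂ V.carrier =>
    LinearMap.ext fun v => ?_
  change f (V.ρ (antipode ω (δ ω g 1)) v) = f (V.ρ (δ ω g⁻¹ 1) v)
  rw [antipode_e]

/-- The element `β` has coefficients `ω(g, g⁻¹, g)`. The coevaluation of graded spaces with
associator `α` uses `α(g, g⁻¹, g)⁻¹`; at `α = ω⁻¹` the two inverses cancel. -/
theorem coevLin_eq (V : RepCat (TwistedDouble ω)) : coevLin V.ρ =
    LinearMap.toSpanSingleton ℂ _ (V.grading.coevElt fun g => (ω⁻¹ g g⁻¹ g)⁻¹) := by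
  ext
  change TensorProduct.map (V.ρ (diag fun g => ω g g⁻¹ g)) LinearMap.id (coevaluation ℂ _ 1) = _
  rw [ρ_diag, LinearMap.toSpanSingleton_apply, one_smul, Grading.coevElt]
  simp only [NormalizedCocycle.inv_apply, inv_inv]

theorem evLin_eq (V : RepCat (TwistedDouble ω)) : evLin V.ρ = contractLeft ℂ V.carrier := by
  change contractLeft ℂ V.carrier ∘ₗ TensorProduct.map LinearMap.id (V.ρ 1) = _
  rw [map_one]
  exact TensorProduct.ext' fun _ _ => rfl

/-- The associator, coevaluation, evaluation and pivotal map entering the partial trace are those of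
graded spaces with associator `ω⁻¹`. Both twists thereby become instances of one graded computation
and differ only in the crossing. -/
theorem twist_eq_traceLin (V : RepCat (TwistedDouble ω)) : Hom.toLin (twist V) =
    Grading.traceLin V.grading ω⁻¹ (braidLin V.ρ V.ρ).toLinearMap := by
  change (TensorProduct.rid ℂ V.carrier).toLinearMap ∘ₗ
    TensorProduct.map LinearMap.id (evLin (dualAct V.ρ) ∘ₗ
      TensorProduct.map (Module.Dual.eval ℂ V.carrier ∘ₗ V.ρ (diag fun g => (ω g g⁻¹ g)⁻¹))
        LinearMap.id) ∘ₗ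
    (assocLin V.ρ V.ρ (dual V).ρ).toLinearMap ∘ₗ
      TensorProduct.map (braidLin V.ρ V.ρ).toLinearMap LinearMap.id ∘ₗ
    (assocLin V.ρ V.ρ (dual V).ρ).symm.toLinearMap ∘ₗ
    TensorProduct.map LinearMap.id (coevLin V.ρ) ∘ₗ
    (TensorProduct.rid ℂ V.carrier).symm.toLinearMap = _
  have h := evLin_eq (dual V)
  change evLin (dualAct V.ρ) = contractLeft ℂ (Module.Dual ℂ V.carrier) at h
  rw [h, assocLin_eq, grading_dual, coevLin_eq, ρ_diag]
  rfl

/-- The self-braiding has the form `v ⊗ w ↦ a_g w ⊗ v` with `a_g = tr g`, the case evaluated in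
`Grading.traceLin_proj`. -/
theorem twist_proj (V : RepCat (TwistedDouble ω)) (g : G) (v : V.carrier) :
    Hom.toLin (twist V) (V.grading.proj g v) = V.tr g (V.grading.proj g v) := by
  rw [twist_eq_traceLin]
  exact Grading.traceLin_proj V.grading ω⁻¹ (braidLin V.ρ V.ρ).toLinearMap
    (fun g => (V.tr g).toLinearMap) (fun g h v => tr_proj V h g v)
    (fun g v w => braidLin_proj V V g v w) g v

end RepCat

/-! ### Bilinearity of the tensor product and duals of representations -/

namespace RepCat

open QuasiHopf

section Generic

variable {H : Type*} [Ring H] [Algebra ℂ H] [QuasiHopf H]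

instance : MonoidalPreadditive (RepCat H) where
  whiskerLeft_zero {X _ _} := by
    apply hom_ext; exact TensorProduct.map_zero_right (LinearMap.id : X.carrier →ₗ[ℂ] X.carrier)
  zero_whiskerRight {X _ _} := by
    apply hom_ext; exact TensorProduct.map_zero_left (LinearMap.id : X.carrier →ₗ[ℂ] X.carrier)
  whiskerLeft_add {X _ _} f g := by
    apply hom_ext
    exact TensorProduct.map_add_right (LinearMap.id : X.carrier →ₗ[ℂ] X.carrier) _ _
  add_whiskerRight {X _ _} f g := by
    apply hom_ext
    exact TensorProduct.map_add_left _ _ (LinearMap.id : X.carrier →ₗ[ℂ] X.carrier)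

instance : MonoidalLinear ℂ (RepCat H) where
  whiskerLeft_smul X _ _ r f := by
    apply hom_ext
    exact TensorProduct.map_smul_right r (LinearMap.id : X.carrier →ₗ[ℂ] X.carrier) _
  smul_whiskerRight r _ _ f X := by
    apply hom_ext
    exact TensorProduct.map_smul_left r _ (LinearMap.id : X.carrier →ₗ[ℂ] X.carrier)

/-- Expansion of `B v` in the basis whose dual basis appears in the coevaluation. This and the next
lemma are the zigzag identities of vector spaces with operators inserted. -/
theorem coevaluation_contract_left {V : Type*} [AddCommGroup V] [Module ℂ V] [Module.Finite ℂ V]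
    (A : V →ₗ[ℂ] V) (B : V →ₗ[ℂ] V) (f : Module.Dual ℂ V) :
    TensorProduct.lid ℂ _ (TensorProduct.map (contractLeft ℂ V) LinearMap.id
      ((TensorProduct.assoc ℂ _ _ _).symm (f ⊗ₜ[ℂ] TensorProduct.map A
        (Module.Dual.transpose (R := ℂ) B) (coevaluation ℂ V 1)))) = f ∘ₗ A ∘ₗ B := by
  rw [coevaluation_apply_one]
  set b := Module.Basis.ofVectorSpace ℂ V
  simp only [map_sum, TensorProduct.map_tmul, TensorProduct.tmul_sum, TensorProduct.assoc_symm_tmul,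
    contractLeft_apply, TensorProduct.lid_tmul, LinearMap.id_apply]
  ext v
  simp only [LinearMap.sum_apply, LinearMap.smul_apply, Module.Dual.transpose_apply,
    LinearMap.comp_apply, smul_eq_mul]
  conv_rhs => rw [← b.sum_repr (B v)]
  simp only [map_sum, map_smul, smul_eq_mul]
  exact Finset.sum_congr rfl fun i _ => mul_comm _ _

theorem coevaluation_contract_right {V : Type*} [AddCommGroup V] [Module ℂ V] [Module.Finite ℂ V]
    (A B C : V →ₗ[ℂ] V) (v : V) :
    TensorProduct.rid ℂ _ (TensorProduct.map A (contractLeft ℂ V ∘ₗ TensorProduct.map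
      (Module.Dual.transpose (R := ℂ) B) C) (TensorProduct.assoc ℂ _ _ _
        (coevaluation ℂ V 1 ⊗ₜ[ℂ] v))) = A (B (C v)) := by
  rw [coevaluation_apply_one]
  set b := Module.Basis.ofVectorSpace ℂ V
  simp only [map_sum, TensorProduct.map_tmul, TensorProduct.sum_tmul, TensorProduct.assoc_tmul,
    contractLeft_apply, TensorProduct.rid_tmul, LinearMap.comp_apply, Module.Dual.transpose_apply]
  conv_rhs => rw [← b.sum_repr (B (C v))]
  simp only [map_sum, map_smul]
  rfl

/-- The zigzag `V* → V*` is the transpose of the action of `S(X) α Y β S(Z)`. -/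
theorem zigzag_dual (V : RepCat H) (x : H ⊗[ℂ] (H ⊗[ℂ] H)) (f : Module.Dual ℂ V.carrier) :
    TensorProduct.lid ℂ _ (TensorProduct.map (evLin V.ρ) LinearMap.id
      ((TensorProduct.assoc ℂ _ _ _).symm (act (dualAct V.ρ) (act V.ρ (dualAct V.ρ)) x
        (f ⊗ₜ[ℂ] coevLin V.ρ 1)))) = f ∘ₗ V.ρ (LinearMap.mul' ℂ H (TensorProduct.map antipode
    (LinearMap.mul' ℂ H ∘ₗ TensorProduct.map (LinearMap.mulLeft ℂ α)
      (LinearMap.mulLeft ℂ β ∘ₗ antipode)) x)) := by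
  induction x with
  | zero => simp
  | add x y hx hy => simp only [map_add, LinearMap.add_apply, hx, hy, LinearMap.comp_add]
  | tmul a x =>
    induction x with
    | zero => simp
    | add x y hx hy =>
      simp only [map_add, LinearMap.add_apply, hx, hy, LinearMap.comp_add, TensorProduct.tmul_add]
    | tmul b c =>
      -- The action of `a` on the dual enters the evaluation as `S(a)` to the left of `α`, `b` acts
      -- on the first leg of the coevaluation, after `β`, and `c` acts on the second leg by the
      -- transpose of `S(c)`. The operators line up as `S(a) α b β S(c)`.
      have h := coevaluation_contract_left (V.ρ (antipode a * (α * b)) ∘ₗ V.ρ β)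
        (V.ρ (antipode c)) f
      have e : TensorProduct.map (V.ρ (antipode a * (α * b)) ∘ₗ V.ρ β)
          (Module.Dual.transpose (R := ℂ) (V.ρ (antipode c))) (coevaluation ℂ V.carrier 1) =
        TensorProduct.map (V.ρ (antipode a * (α * b))) (dualAct V.ρ c) (coevLin V.ρ 1) := by
        change _ = (TensorProduct.map (V.ρ (antipode a * (α * b))) (dualAct V.ρ c) ∘ₗ
          TensorProduct.map (V.ρ β) LinearMap.id) (coevaluation ℂ V.carrier 1)
        rw [← TensorProduct.map_comp]
        rfl
      rw [e] at h
      have e2 : f ∘ₗ V.ρ (LinearMap.mul' ℂ H (TensorProduct.map antipode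
          (LinearMap.mul' ℂ H ∘ₗ TensorProduct.map (LinearMap.mulLeft ℂ α)
          (LinearMap.mulLeft ℂ β ∘ₗ antipode)) (a ⊗ₜ[ℂ] (b ⊗ₜ[ℂ] c)))) =
          f ∘ₗ (V.ρ (antipode a * (α * b)) ∘ₗ V.ρ β) ∘ₗ V.ρ (antipode c) := by
        simp only [TensorProduct.map_tmul, LinearMap.comp_apply, LinearMap.mulLeft_apply,
          LinearMap.mul'_apply, map_mul, Module.End.mul_eq_comp, LinearMap.comp_assoc]
      rw [e2, ← h, act_tmul]
      congr 1
      generalize coevLin V.ρ 1 = t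
      induction t with
      | zero => simp
      | add s t hs ht => simp only [TensorProduct.tmul_add, map_add, hs, ht]
      | tmul v g =>
        simp only [act_tmul, TensorProduct.assoc_symm_tmul, TensorProduct.map_tmul, evLin_tmul,
          contractLeft_apply, dualAct_apply, map_mul, Module.End.mul_apply]

/-- The zigzag `V → V` is the action of `X β S(Y) α Z`. -/
theorem zigzag (V : RepCat H) (x : H ⊗[ℂ] (H ⊗[ℂ] H)) (v : V.carrier) :
    TensorProduct.rid ℂ _ (TensorProduct.map LinearMap.id (evLin V.ρ)
      (act V.ρ (act (dualAct V.ρ) V.ρ) x (TensorProduct.assoc ℂ _ _ _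
        (coevLin V.ρ 1 ⊗ₜ[ℂ] v)))) = V.ρ (LinearMap.mul' ℂ H (TensorProduct.map LinearMap.id
    (LinearMap.mul' ℂ H ∘ₗ TensorProduct.map (LinearMap.mulLeft ℂ β ∘ₗ antipode)
      (LinearMap.mulLeft ℂ α)) x)) v := by
  induction x with
  | zero => simp
  | add x y hx hy => simp only [map_add, LinearMap.add_apply, hx, hy]
  | tmul a x =>
    induction x with
    | zero => simp
    | add x y hx hy =>
      simp only [map_add, LinearMap.add_apply, hx, hy, TensorProduct.tmul_add]
    | tmul b c =>
      -- Here `a` follows `β` on the first leg of the coevaluation, `b` acts on the second leg by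
      -- the transpose of `S(b)`, and `α c` is applied to the vector; the operators line up as `a β
      -- S(b) α c`.
      have h := coevaluation_contract_right (V.ρ a ∘ₗ V.ρ β) (V.ρ (antipode b))
        (V.ρ α ∘ₗ V.ρ c) v
      have e2 : V.ρ (LinearMap.mul' ℂ H (TensorProduct.map LinearMap.id
          (LinearMap.mul' ℂ H ∘ₗ TensorProduct.map (LinearMap.mulLeft ℂ β ∘ₗ antipode)
          (LinearMap.mulLeft ℂ α)) (a ⊗ₜ[ℂ] (b ⊗ₜ[ℂ] c)))) v =
          (V.ρ a ∘ₗ V.ρ β) (V.ρ (antipode b) ((V.ρ α ∘ₗ V.ρ c) v)) := by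
        simp only [TensorProduct.map_tmul, LinearMap.comp_apply, LinearMap.mulLeft_apply,
          LinearMap.mul'_apply, map_mul, Module.End.mul_apply, LinearMap.id_apply]
      rw [e2, ← h, coevLin, LinearMap.comp_apply]
      congr 1
      generalize coevaluation ℂ V.carrier 1 = t
      induction t with
      | zero => simp
      | add s t hs ht => simp only [TensorProduct.add_tmul, map_add, hs, ht]
      | tmul w g => rfl

/-- The dual representation is a dual. -/
noncomputable instance exactPairing (V : RepCat H) : ExactPairing V (dual V) where
  coevaluation' := coev V
  evaluation' := ev V
  coevaluation_evaluation' := by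
    apply hom_ext
    refine TensorProduct.ext' fun (f : Module.Dual ℂ V.carrier) (c : ℂ) => ?_
    change TensorProduct.map (evLin V.ρ) LinearMap.id ((assocLin (dualAct V.ρ) V.ρ
      (dualAct V.ρ)).symm (f ⊗ₜ[ℂ] coevLin V.ρ c)) = (1 : ℂ) ⊗ₜ[ℂ] (c • f)
    have hc : coevLin V.ρ c = c • coevLin V.ρ 1 := by rw [← map_smul, smul_eq_mul, mul_one]
    rw [assocLin_symm_apply, hc, TensorProduct.tmul_smul, TensorProduct.tmul_smul, map_smul,
      map_smul, map_smul]
    congr 1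
    apply (TensorProduct.lid ℂ _).injective
    -- The inverse associator acts by `Φ`, so this zigzag is the action of `∑ S(X) α Y β S(Z) = 1`.
    rw [zigzag_dual, antipode_Φ, map_one, TensorProduct.lid_tmul, one_smul]
    rfl
  evaluation_coevaluation' := by
    apply hom_ext
    refine TensorProduct.ext' fun (c : ℂ) (v : V.carrier) => ?_
    change TensorProduct.map LinearMap.id (evLin V.ρ) (assocLin V.ρ (dualAct V.ρ) V.ρ
      (coevLin V.ρ c ⊗ₜ[ℂ] v)) = (c • v) ⊗ₜ[ℂ] (1 : ℂ)
    have hc : coevLin V.ρ c = c • coevLin V.ρ 1 := by rw [← map_smul, smul_eq_mul, mul_one]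
    rw [assocLin_apply, hc, ← TensorProduct.smul_tmul', ← TensorProduct.smul_tmul', map_smul,
      map_smul, map_smul]
    congr 1
    apply (TensorProduct.rid ℂ _).injective
    -- The associator acts by `Φ⁻¹`, so this zigzag is the action of `∑ X β S(Y) α Z = 1`.
    rw [zigzag, antipode_Φ_inv, map_one, TensorProduct.rid_tmul, one_smul]
    rfl

end Generic

end RepCat

/-! ### Uniqueness of duals -/

namespace CategoryTheory.ExactPairing

variable {C : Type*} [Category C] [MonoidalCategory C]

/-- The comparison of two right duals. -/
theorem exists_iso_right {X Y₁ Y₂ : C} (p₁ : ExactPairing X Y₁) (p₂ : ExactPairing X Y₂) :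
    ∃ i : Y₁ ≅ Y₂, @coevaluation _ _ _ X Y₁ p₁ ≫ X ◁ i.hom = @coevaluation _ _ _ X Y₂ p₂ ∧
      i.inv ▷ X ≫ @evaluation _ _ _ X Y₁ p₁ = @evaluation _ _ _ X Y₂ p₂ := by
  refine ⟨rightDualIso p₁ p₂, ?_, ?_⟩
  -- The comparison of the duals is the mate of the identity of `X`, so both compatibilities are
  -- mate equations.
  · have h := @coevaluation_comp_rightAdjointMate C _ _ X X ⟨Y₂⟩ ⟨Y₁⟩ (𝟙 X)
    rw [id_whiskerRight, Category.comp_id] at h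
    exact h
  · have h := @rightAdjointMate_comp_evaluation C _ _ X X ⟨Y₁⟩ ⟨Y₂⟩ (𝟙 X)
    rw [MonoidalCategory.whiskerLeft_id, Category.id_comp] at h
    exact h

/-- A natural endomorphism of the identity that is self-dual on one dual of `X` is so on all. -/
theorem coevaluation_whisker_of {θ : ∀ X : C, X ⟶ X}
    (hθ : ∀ {X Y : C} (f : X ⟶ Y), f ≫ θ Y = θ X ≫ f) {X Y₁ Y₂ : C} (p₁ : ExactPairing X Y₁)
    (p₂ : ExactPairing X Y₂) (h : @coevaluation _ _ _ X Y₁ p₁ ≫ θ X ▷ Y₁ =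
      @coevaluation _ _ _ X Y₁ p₁ ≫ X ◁ θ Y₁) :
    @coevaluation _ _ _ X Y₂ p₂ ≫ θ X ▷ Y₂ = @coevaluation _ _ _ X Y₂ p₂ ≫ X ◁ θ Y₂ := by
  obtain ⟨i, h1, -⟩ := exists_iso_right p₁ p₂
  rw [← h1, Category.assoc, whisker_exchange, ← Category.assoc, h, Category.assoc, Category.assoc,
    ← MonoidalCategory.whiskerLeft_comp, ← MonoidalCategory.whiskerLeft_comp, hθ]

end CategoryTheory.ExactPairing

/-! ### The ribbon element and the balancing identities -/

namespace NormalizedCocycle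

variable {G : Type*} [Group G] (ω : NormalizedCocycle G)

/-- At these arguments all but two factors of `θ` and `γ` cancel, leaving the inverse of `ω(g⁻¹, g,
g⁻¹) ω(g, g⁻¹, g)`, which is `1` by `apply_inv`. This scalar decides whether the antipode fixes the
ribbon element. -/
theorem sc_self (g : G) : ω.sc g g = 1 := by
  have h := ω.apply_inv g
  simp only [sc, θ, γ]
  simp only [mul_inv_cancel, inv_one, mul_one, one_mul, inv_mul_cancel_right, inv_mul_cancel]
  rw [← mul_inv, inv_eq_one]
  calc _ = ω g⁻¹ g g⁻¹ * ω g g⁻¹ g := by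
        rw [div_mul_div_comm, div_eq_iff_eq_mul]
        ac_rfl
    _ = 1 := h

/-- The scalar content of `θ_{X ⊗ Y} = (θ_X ⊗ θ_Y) c c`; after cancellation it is one instance of
the cocycle identity, at `(a, b, b⁻¹ab, (ab)⁻¹b(ab))`. -/
theorem γ_mul_self (a b : G) : ω.γ (a * b) a b = ω.θ a a b * ω.θ b b (b⁻¹ * a * b) := by
  have h := congrArg Additive.ofMul (ω.cocycle a b (b⁻¹ * a * b)
    ((a * b)⁻¹ * b * (a * b)))
  apply Additive.ofMul.injective
  simp only [θ, γ, ofMul_mul, ofMul_div, mul_inv_rev, mul_assoc, inv_mul_cancel_left,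
    mul_inv_cancel_left, inv_mul_cancel, mul_one, one_mul, inv_inv] at h ⊢
  linear_combination (norm := abel) -h

end NormalizedCocycle

namespace TwistedDouble

variable {G : Type*} [Group G] [Fintype G] (ω : NormalizedCocycle G)

/-- The ribbon element `∑_g δ_g ḡ`. -/
noncomputable def ribbon : TwistedDouble ω := ∑ g : G, δ ω g g

/-- The antipode carries `δ_g ḡ` to `δ_{g⁻¹} \overline{g⁻¹}` with scalar `1`, so it permutes the
summands. -/
theorem antipode_ribbon : antipode ω (ribbon ω) = ribbon ω := by
  rw [ribbon, map_sum]
  refine Fintype.sum_equiv (Equiv.inv G) _ _ fun g => ?_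
  rw [antipode_δ, NormalizedCocycle.sc_self]
  simp

end TwistedDouble

namespace RepCat

open TwistedDouble QuasiHopf

attribute [local instance] moduleOfRep

variable {G : Type*} [Group G] [Fintype G] {ω : NormalizedCocycle G}

/-- On degree `g` only `δ_g ḡ` acts, and it acts as `tr g`. Being the action of an element of the
algebra, the twist commutes with every morphism. -/
theorem twist_toLin (V : RepCat (TwistedDouble ω)) : Hom.toLin (twist V) = V.ρ (ribbon ω) := by
  refine V.grading.lin_ext fun g v => ?_
  rw [twist_proj, ribbon, map_sum, LinearMap.sum_apply, Finset.sum_eq_single g]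
  · rw [ρ_δ, inv_mul_cancel, one_mul, Grading.proj_self]
  · intro h _ hh
    rw [ρ_δ, inv_mul_cancel, one_mul, Grading.proj_ne _ _ _ _ hh, map_zero]
  · simp

theorem twist_naturality {V W : RepCat (TwistedDouble ω)} (f : V ⟶ W) :
    f ≫ twist W = twist V ≫ f := by
  apply hom_ext
  rw [comp_toLin, comp_toLin, twist_toLin, twist_toLin]
  exact LinearMap.ext fun v => (Hom.comm f _ v).symm

theorem twist_isIso (V : RepCat (TwistedDouble ω)) : IsIso (twist V) := by
  have h : Function.Injective (Hom.toLin (twist V)) := by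
    rw [injective_iff_map_eq_zero]
    intro v hv
    rw [← V.grading.sum_proj v]
    refine Finset.sum_eq_zero fun g _ => ?_
    apply (V.tr g).injective
    -- The twist is a morphism, so it commutes with the projections: `tr g` applied to the component
    -- of degree `g` is the component of the twist of `v`, which is zero.
    rw [← twist_proj, grading_proj, Hom.comm, hv, map_zero, map_zero]
  exact isIso_of_bijective _ ⟨h, LinearMap.injective_iff_surjective.1 h⟩

/-- Let `v` have degree `g` and `gw` degree `k`, so that `v ⊗ w` has degree `kg`. The left side is
the action of `kg` on `v ⊗ w`, with scalar `γ_{kg}(kgk⁻¹, k)`. The double braiding gives `kv ⊗ gw`,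
of degrees `kgk⁻¹` and `k`, and the twists turn this into `(kgk⁻¹)k v ⊗ kg w`, with one scalar `θ`
from each factor. -/
theorem twist_tensor (V W : RepCat (TwistedDouble ω)) :
    twist (V ⊗ W) = (β_ V W).hom ≫ (β_ W V).hom ≫ (twist V ⊗ₘ twist W) := by
  apply hom_ext
  refine Grading.lin_ext₂ V.grading W.grading fun g h v w => ?_
  -- Here `k = ghg⁻¹` is the degree that `w` acquires when `v` crosses it, and the total degree
  -- becomes `kg`.
  obtain ⟨k, rfl⟩ : ∃ k, h = g⁻¹ * k * g := ⟨g * h * g⁻¹, by group⟩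
  have hl := twist_proj (tensor V W) (k * g)
    (V.grading.proj g v ⊗ₜ[ℂ] W.grading.proj (g⁻¹ * k * g) w)
  have e : (tensor V W).grading.proj (k * g)
      (V.grading.proj g v ⊗ₜ[ℂ] W.grading.proj (g⁻¹ * k * g) w) =
      V.grading.proj g v ⊗ₜ[ℂ] W.grading.proj (g⁻¹ * k * g) w := by
    have h := Grading.tensor_proj_mul V.grading W.grading g (g⁻¹ * k * g) v w
    rwa [← grading_tensor, show g * (g⁻¹ * k * g) = k * g by group] at h
  have e1 : g * (g⁻¹ * k * g) * g⁻¹ = k := by group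
  have e2 : k * g * g * (k * g)⁻¹ = k * g * k⁻¹ := by group
  have e3 : k * g * (g⁻¹ * k * g) * (k * g)⁻¹ = k := by group
  have e4 : k * g * k⁻¹ * k * g * (k * g * k⁻¹ * k)⁻¹ = k * g * k⁻¹ := by group
  have e5 : k * g * k⁻¹ * k = k * g := by group
  have e6 : k⁻¹ * (k * g * k⁻¹) * k = g := by group
  -- With `a = kgk⁻¹` and `b = k` one has `ab = kg` and `b⁻¹ab = g`, so the two factors on the right
  -- are the scalars of the two twists.
  have hγ := ω.γ_mul_self (k * g * k⁻¹) k
  rw [e5, e6] at hγ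
  refine ((congrArg (Hom.toLin (twist (tensor V W))) e).symm.trans (hl.trans
    ((congrArg ((tensor V W).tr (k * g)) e).trans (tr_tensor V W _ _ _ v w)))).trans ?_
  change _ = TensorProduct.map (Hom.toLin (twist V)) (Hom.toLin (twist W))
    (braidLin W.ρ V.ρ (braidLin V.ρ W.ρ
      (V.grading.proj g v ⊗ₜ[ℂ] W.grading.proj (g⁻¹ * k * g) w)))
  have hw : W.tr g (W.grading.proj (g⁻¹ * k * g) w) =
      W.grading.proj k (W.tr g (W.grading.proj (g⁻¹ * k * g) w)) := by
    rw [tr_proj, e1, Grading.proj_self]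
  have hw' : Hom.toLin (twist W) (W.grading.proj k (W.tr g (W.grading.proj (g⁻¹ * k * g) w))) =
      (ω.θ k k g : ℂ) • W.tr (k * g) (W.grading.proj (g⁻¹ * k * g) w) := by
    rw [twist_proj, ← hw, tr_tr, e3]
  have hv : Hom.toLin (twist V) (V.tr k (V.grading.proj g v)) =
      (ω.θ (k * g * k⁻¹) (k * g * k⁻¹) k : ℂ) • V.tr (k * g) (V.grading.proj g v) := by
    rw [tr_proj, twist_proj, ← tr_proj, tr_tr, e4, e5]
  rw [braidLin_proj, hw, braidLin_proj, TensorProduct.map_tmul, hw', hv, e3, e2, hγ,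
    TensorProduct.smul_tmul_smul, Units.val_mul]

/-- An operator on the first leg of the bare coevaluation moves to the second as its transpose. In
the application `B` is the action of `β`, and commutation lets `A` reach the coevaluation past it.
-/
theorem coevaluation_map_transpose {V : Type*} [AddCommGroup V] [Module ℂ V] [Module.Finite ℂ V]
    (A B : V →ₗ[ℂ] V) (h : A ∘ₗ B = B ∘ₗ A) :
    TensorProduct.map A LinearMap.id
      (TensorProduct.map B LinearMap.id (coevaluation ℂ V 1)) =
    TensorProduct.map LinearMap.id (Module.Dual.transpose (R := ℂ) A)
      (TensorProduct.map B LinearMap.id (coevaluation ℂ V 1)) := by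
  have h2 := coevaluation_transpose A
  rw [← LinearMap.comp_apply, ← TensorProduct.map_comp, h, TensorProduct.map_comp,
    LinearMap.comp_apply, ← h2]
  generalize coevaluation ℂ V 1 = t
  induction t with
  | zero => simp
  | add s t hs ht => simp only [map_add, hs, ht]
  | tmul v f => rfl

/-- The twist of the dual is the transpose of the action of the antipode of the ribbon element,
hence of the ribbon element itself. The twist of `V` commutes with `β` because it is a morphism. -/
theorem twist_dual_self (V : RepCat (TwistedDouble ω)) :
    coev V ≫ twist V ▷ dual V = coev V ≫ V ◁ twist (dual V) := by
  have h1 : Hom.toLin (twist (dual V)) =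
      Module.Dual.transpose (R := ℂ) (Hom.toLin (twist V)) := by
    rw [twist_toLin, twist_toLin]
    change Module.Dual.transpose (R := ℂ) (V.ρ (antipode ω (ribbon ω))) = _
    rw [antipode_ribbon]
  apply hom_ext
  ext
  refine (coevaluation_map_transpose (Hom.toLin (twist V)) (V.ρ QuasiHopf.β)
    (LinearMap.ext fun v => Hom.comm (twist V) _ v)).trans ?_
  change _ = TensorProduct.map LinearMap.id (Hom.toLin (twist (dual V))) _
  rw [h1]
  rfl

theorem simple_unit : Simple (𝟙_ (RepCat (TwistedDouble ω))) := by
  have : IsSimpleModule (TwistedDouble ω) (𝟙_ (RepCat (TwistedDouble ω))).carrier := by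
    rw [isSimpleModule_iff_toSpanSingleton_surjective]
    -- The unit is one-dimensional, so the scalar `z / c` already carries `c` to `z`.
    refine ⟨inferInstanceAs (Nontrivial ℂ), fun (c : ℂ) hc (z : ℂ) =>
      ⟨algebraMap ℂ (TwistedDouble ω) (z / c), ?_⟩⟩
    refine Eq.trans (b := (unitAct (TwistedDouble ω)) (algebraMap ℂ _ (z / c)) c) rfl ?_
    rw [AlgHom.commutes]
    change z / c * c = z
    exact div_mul_cancel₀ z hc
  exact simple_of_isSimpleModule _

theorem isRibbonFusion : IsRibbonFusion (RepCat.twist (H := TwistedDouble ω)) where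
  monoidalPreadditive := inferInstance
  monoidalLinear := inferInstance
  hasFiniteProducts := inferInstance
  hasKernels := inferInstance
  hasCokernels := inferInstance
  normalMono := inferInstance
  normalEpi := inferInstance
  finite_hom := inferInstance
  end_simple := end_simple
  semisimple := semisimple
  finite_simple := finite_simpleClass
  simple_unit := simple_unit
  exists_right_dual X := ⟨dual X, ⟨exactPairing X⟩⟩
  -- In a braided category a right dual is also a left dual.
  exists_left_dual X := ⟨dual X, ⟨BraidedCategory.exactPairing_swap X (dual X)⟩⟩
  twist_naturality := twist_naturality
  twist_isIso := twist_isIso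
  twist_tensor := twist_tensor
  -- The axiom quantifies over all dual pairs; an arbitrary one is compared with the standard dual.
  twist_dual X _ p := ExactPairing.coevaluation_whisker_of twist_naturality (exactPairing X) p
    (twist_dual_self X)

end RepCat

/-! ### Half-braidings on graded spaces from families of automorphisms -/

namespace NormalizedCocycle

variable {G : Type*} [Group G] (ω : NormalizedCocycle G)

theorem inv_θ (g x y : G) : ω⁻¹.θ g x y = (ω.θ g x y)⁻¹ := by
  simp only [θ, inv_apply, div_eq_mul_inv, mul_inv_rev, inv_inv]
  ac_rfl

theorem inv_γ (x h l : G) : ω⁻¹.γ x h l = (ω.γ x h l)⁻¹ := by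
  simp only [γ, inv_apply, div_eq_mul_inv, mul_inv_rev, inv_inv]
  ac_rfl

end NormalizedCocycle

namespace Grading

variable {G : Type*} [Fintype G] {V U : Type*} [AddCommGroup V] [Module ℂ V] [AddCommGroup U]
  [Module ℂ U]

/-- The crossing `v ⊗ u ↦ u ⊗ a_k v` for `u` of degree `k`. -/
noncomputable def cross (q : Grading G U) (a : G → V ≃ₗ[ℂ] V) : V ⊗[ℂ] U ≃ₗ[ℂ] U ⊗[ℂ] V :=
  LinearEquiv.ofLinearMap
    ((∑ k : G, TensorProduct.map (q.proj k) (a k).toLinearMap) ∘ₗ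
      (TensorProduct.comm ℂ V U).toLinearMap)
    ((∑ k : G, TensorProduct.map (a k).symm.toLinearMap (q.proj k)) ∘ₗ
      (TensorProduct.comm ℂ U V).toLinearMap)
    (by
      classical
      refine TensorProduct.ext (q.lin_ext fun k u => LinearMap.ext fun v => ?_)
      simp [LinearMap.sum_apply, proj_proj, TensorProduct.ite_tmul, TensorProduct.tmul_ite])
    (by
      classical
      refine TensorProduct.ext (LinearMap.ext fun v => q.lin_ext fun k u => ?_)
      simp [LinearMap.sum_apply, proj_proj, TensorProduct.ite_tmul, TensorProduct.tmul_ite])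

theorem cross_tmul (q : Grading G U) (a : G → V ≃ₗ[ℂ] V) (k : G) (v : V) (u : U) :
    q.cross a (v ⊗ₜ q.proj k u) = q.proj k u ⊗ₜ a k v := by
  classical
  simp [cross, LinearMap.sum_apply, proj_proj, TensorProduct.ite_tmul]

end Grading

namespace VecG

variable {G : Type*} [Group G] [Fintype G] {α : NormalizedCocycle G}

/-- The half braiding `v ⊗ u ↦ u ⊗ a_k v`, for `u` of degree `k`. -/
noncomputable def halfBraiding (V : VecG α) (a : G → V.carrier ≃ₗ[ℂ] V.carrier)
    (ha : ∀ k g v, a k (V.grading.proj g v) = V.grading.proj (k⁻¹ * g * k) (a k v))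
    (hmul : ∀ k l g v, a (k * l) (V.grading.proj g v) =
      (((α.θ g k l)⁻¹ : ℂˣ) : ℂ) • a l (a k (V.grading.proj g v))) : HalfBraiding V where
  β U := isoMk (V := tensor V U) (W := tensor U V) (U.grading.cross a) fun g => by
    classical
    refine LinearMap.congr_fun (f := (U.grading.cross a).toLinearMap ∘ₗ
      (V.grading.tensor U.grading).proj g) (g := (U.grading.tensor V.grading).proj g ∘ₗ
        (U.grading.cross a).toLinearMap) (Grading.lin_ext₂ V.grading U.grading fun h k v u => ?_)
    simp only [LinearMap.comp_apply, LinearEquiv.coe_coe, Grading.tensor_proj,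
      Grading.cross_tmul, ha]
    have e : k * (k⁻¹ * h * k) = h * k := by group
    rw [e]
    split_ifs with hg
    · rw [Grading.cross_tmul, ha]
    · rw [map_zero]
  monoidal U U' := by
    apply hom_ext
    change ((U.grading.tensor U'.grading).cross a).toLinearMap =
      (Grading.assoc U.grading U'.grading V.grading α).symm.toLinearMap ∘ₗ
      TensorProduct.map LinearMap.id (U'.grading.cross a).toLinearMap ∘ₗ
      (Grading.assoc U.grading V.grading U'.grading α).toLinearMap ∘ₗ
      TensorProduct.map (U.grading.cross a).toLinearMap LinearMap.id ∘ₗ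
      (Grading.assoc V.grading U.grading U'.grading α).symm.toLinearMap
    refine Grading.lin_ext₃' V.grading U.grading U'.grading fun g k l v u u' => ?_
    have h1 := Grading.tensor_proj_mul U.grading U'.grading k l u u'
    have e : (k * l)⁻¹ * g * (k * l) = l⁻¹ * (k⁻¹ * g * k) * l := by group
    have h2 := (U.grading.tensor U'.grading).cross_tmul a (k * l) (V.grading.proj g v)
      (U.grading.proj k u ⊗ₜ U'.grading.proj l u')
    rw [h1] at h2
    simp only [LinearMap.comp_apply, LinearEquiv.coe_coe, h2, Grading.assoc_symm_tmul, map_smul,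
      TensorProduct.map_tmul, Grading.cross_tmul, LinearMap.id_apply, ha k g, Grading.assoc_tmul,
      ha l, smul_smul]
    -- The associators at degrees `(g, k, l)` and `(k, l, (kl)⁻¹g(kl))`, inverted, and the one at
    -- `(k, k⁻¹gk, l)` multiply to `θ_g(k, l)⁻¹`, the scalar in `hmul`.
    rw [hmul, ha k, ha l, TensorProduct.tmul_smul]
    congr 1
    simp only [NormalizedCocycle.θ, e]
    push_cast
    field_simp
  naturality {U U'} f := by
    apply hom_ext
    change (U'.grading.cross a).toLinearMap ∘ₗ TensorProduct.map LinearMap.id (Hom.toLin f) =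
      TensorProduct.map (Hom.toLin f) LinearMap.id ∘ₗ (U.grading.cross a).toLinearMap
    refine TensorProduct.ext (LinearMap.ext fun v => U.grading.lin_ext fun k u => ?_)
    simp [Grading.cross_tmul]

theorem hbEnd_halfBraiding (V : VecG α) (a : G → V.carrier ≃ₗ[ℂ] V.carrier) (ha) (hmul) (k : G)
    (v : V.carrier) : hbEnd (V.halfBraiding a ha hmul) k v = a k v := by
  have h := Grading.cross_tmul (Grading.single k) a k v (1 : ℂ)
  rw [Grading.single_proj_self] at h
  refine (congrArg (TensorProduct.lid ℂ V.carrier) h).trans ?_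
  rw [TensorProduct.lid_tmul, one_smul]

/-- This is the condition on morphisms of the center at the one-dimensional space of degree `k`; by
naturality in the second object these instances imply all others, as `centerHom` shows. -/
theorem hbEnd_naturality {X Y : Center (VecG α)} (f : X ⟶ Y) (k : G) (v : X.1.carrier) :
    Hom.toLin f.f (hbEnd X.2 k v) = hbEnd Y.2 k (Hom.toLin f.f v) := by
  have h := LinearMap.congr_fun (congrArg Hom.toLin (f.comm (single k))) (v ⊗ₜ[ℂ] (1 : ℂ))
  have h' : hbs Y.2 k (Hom.toLin f.f v ⊗ₜ[ℂ] (1 : ℂ)) =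
      TensorProduct.map LinearMap.id (Hom.toLin f.f) (hbs X.2 k (v ⊗ₜ[ℂ] (1 : ℂ))) := h
  rw [hbs_tmul, hbs_tmul, TensorProduct.map_tmul] at h'
  have h2 := congrArg (TensorProduct.lid ℂ Y.1.carrier) h'
  rw [TensorProduct.lid_tmul, TensorProduct.lid_tmul] at h2
  simpa using h2.symm

/-- A morphism of the center, from a degree-preserving map that commutes with the automorphisms
`hbEnd`. -/
noncomputable def centerHom {X Y : Center (VecG α)} (f : X.1 ⟶ Y.1)
    (hf : ∀ k v, Hom.toLin f (hbEnd X.2 k v) = hbEnd Y.2 k (Hom.toLin f v)) : X ⟶ Y where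
  f := f
  comm U := by
    apply hom_ext
    change (hb Y.2 U).toLinearMap ∘ₗ TensorProduct.map (Hom.toLin f) LinearMap.id =
      TensorProduct.map LinearMap.id (Hom.toLin f) ∘ₗ (hb X.2 U).toLinearMap
    refine TensorProduct.ext (LinearMap.ext fun v => U.grading.lin_ext fun k u => ?_)
    simp [hb_tmul, hf]

/-- An isomorphism of the center, from a degree-preserving isomorphism that commutes with the
automorphisms `hbEnd`. -/
noncomputable def centerIso {X Y : Center (VecG α)} (e : X.1.carrier ≃ₗ[ℂ] Y.1.carrier)
    (he : ∀ g v, e (X.1.grading.proj g v) = Y.1.grading.proj g (e v))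
    (hf : ∀ k v, e (hbEnd X.2 k v) = hbEnd Y.2 k (e v)) : X ≅ Y where
  hom := centerHom (isoMk e he).hom hf
  inv := centerHom (isoMk e he).inv fun k v => by
    apply e.injective
    change e (e.symm _) = e (hbEnd X.2 k (e.symm v))
    rw [hf, LinearEquiv.apply_symm_apply, LinearEquiv.apply_symm_apply]
  hom_inv_id := Center.ext _ _ (isoMk e he).hom_inv_id
  inv_hom_id := Center.ext _ _ (isoMk e he).inv_hom_id

/-- The half-braiding of a tensor product passes through three associators, at degrees `(a, b, k)`,
`(a, k, k⁻¹bk)` and `(k, k⁻¹ak, k⁻¹bk)`, the middle one inverted. Their product is `γ_k(a, b)`. -/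
theorem hbEnd_tensor (X Y : Center (VecG α)) (k a b : G) (v : X.1.carrier) (w : Y.1.carrier) :
    hbEnd (X ⊗ Y : Center (VecG α)).2 k (X.1.grading.proj a v ⊗ₜ[ℂ] Y.1.grading.proj b w) =
      (α.γ k a b : ℂ) • (hbEnd X.2 k (X.1.grading.proj a v) ⊗ₜ[ℂ]
        hbEnd Y.2 k (Y.1.grading.proj b w)) := by
  let s : Grading G ℂ := Grading.single k
  change TensorProduct.lid ℂ (X.1.carrier ⊗[ℂ] Y.1.carrier)
    (Grading.assoc s X.1.grading Y.1.grading α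
      (TensorProduct.map (hbs X.2 k).toLinearMap LinearMap.id
        ((Grading.assoc X.1.grading s Y.1.grading α).symm
          (TensorProduct.map LinearMap.id (hbs Y.2 k).toLinearMap
            (Grading.assoc X.1.grading Y.1.grading s α
              ((X.1.grading.proj a v ⊗ₜ[ℂ] Y.1.grading.proj b w) ⊗ₜ[ℂ] (1 : ℂ))))))) = _
  have a1 := Grading.assoc_tmul X.1.grading Y.1.grading s α a b k v w (1 : ℂ)
  have a2 := Grading.assoc_symm_tmul X.1.grading s Y.1.grading α a k (k⁻¹ * b * k) v (1 : ℂ)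
    (hbEnd Y.2 k w)
  have a3 := Grading.assoc_tmul s X.1.grading Y.1.grading α k (k⁻¹ * a * k) (k⁻¹ * b * k) (1 : ℂ)
    (hbEnd X.2 k v) (hbEnd Y.2 k w)
  simp only [s, Grading.single_proj_self] at a1 a2 a3
  simp only [s, a1, map_smul, TensorProduct.map_tmul, LinearEquiv.coe_coe, hbs_tmul,
    LinearMap.id_apply, hbEnd_proj Y.2 k b, a2, hbEnd_proj X.2 k a, a3, smul_smul,
    TensorProduct.lid_tmul, one_smul]
  congr 1
  simp only [NormalizedCocycle.γ]
  push_cast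
  field_simp

theorem hbEnd_unit (k : G) (c : ℂ) :
    hbEnd (𝟙_ (Center (VecG α))).2 k c = c := by
  change TensorProduct.lid ℂ ℂ ((TensorProduct.rid ℂ ℂ).symm (TensorProduct.lid ℂ ℂ
    (c ⊗ₜ[ℂ] (1 : ℂ)))) = c
  simp

end VecG

/-! ### The braided equivalence between representations and the center -/

namespace RepCat

open TwistedDouble QuasiHopf VecG

variable {G : Type*} [Group G] [Fintype G] {ω : NormalizedCocycle G}

theorem hom_tr {V W : RepCat (TwistedDouble ω)} (f : V ⟶ W) (x : G) (v : V.carrier) :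
    Hom.toLin f (V.tr x v) = W.tr x (Hom.toLin f v) := Hom.comm f _ v

/-- Inverting `tr_tr` reverses the order of composition. Half-braiding automorphisms compose in this
reversed order, so they correspond to the inverses of the operators `tr`. -/
theorem tr_mul_symm (V : RepCat (TwistedDouble ω)) (k l g : G) (v : V.carrier) :
    (V.tr (k * l)).symm (V.grading.proj g v) =
      (ω.θ g k l : ℂ) • (V.tr l).symm ((V.tr k).symm (V.grading.proj g v)) := by
  rw [LinearEquiv.symm_apply_eq, map_smul]
  set u := (V.tr l).symm ((V.tr k).symm v)
  have h : (V.tr l).symm ((V.tr k).symm (V.grading.proj g v)) =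
      V.grading.proj ((k * l)⁻¹ * g * (k * l)) u := by
    rw [tr_symm_proj, tr_symm_proj]
    congr 2
    group
  have e : k * l * ((k * l)⁻¹ * g * (k * l)) * (k * l)⁻¹ = g := by group
  -- The rule is applied to the vector of degree `(kl)⁻¹g(kl)` that `kl` carries to degree `g`; the
  -- subscript of `θ` then becomes `g`.
  have h2 := tr_tr V ((k * l)⁻¹ * g * (k * l)) k l u
  rw [← h, LinearEquiv.apply_symm_apply, LinearEquiv.apply_symm_apply, e] at h2
  exact h2

/-- The graded vector space underlying a representation of the twisted double. -/
noncomputable def toVecG (V : RepCat (TwistedDouble ω)) : VecG ω⁻¹ where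
  carrier := V.carrier
  grading := V.grading

/-- The hypothesis of `VecG.halfBraiding` asks for the inverse of `θ` of the associator cocycle. To
produce `θ` of `ω`, the associator has to be `ω⁻¹`. -/
theorem tr_symm_mul (V : RepCat (TwistedDouble ω)) (k l g : G) (v : V.carrier) :
    (V.tr (k * l)).symm (V.grading.proj g v) =
      (((ω⁻¹.θ g k l)⁻¹ : ℂˣ) : ℂ) • (V.tr l).symm ((V.tr k).symm (V.grading.proj g v)) := by
  rw [NormalizedCocycle.inv_θ, inv_inv, tr_mul_symm]

/-- The object of the center defined by a representation: elements of degree `g` are crossed by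
elements `u` of degree `k` as `v ⊗ u ↦ u ⊗ k̄⁻¹ v`. -/
noncomputable def toCenterObj (V : RepCat (TwistedDouble ω)) : Center (VecG ω⁻¹) :=
  ⟨V.toVecG, V.toVecG.halfBraiding (fun k => (V.tr k).symm) (fun k g v => V.tr_symm_proj g k v)
    V.tr_symm_mul⟩

theorem hbEnd_toCenterObj (V : RepCat (TwistedDouble ω)) (k : G) (v : V.carrier) :
    hbEnd V.toCenterObj.2 k v = (V.tr k).symm v :=
  hbEnd_halfBraiding V.toVecG (fun k => (V.tr k).symm) (fun k g v => V.tr_symm_proj g k v)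
    V.tr_symm_mul k v

theorem hom_tr_symm {V W : RepCat (TwistedDouble ω)} (f : V ⟶ W) (x : G) (v : V.carrier) :
    Hom.toLin f ((V.tr x).symm v) = (W.tr x).symm (Hom.toLin f v) := by
  rw [LinearEquiv.eq_symm_apply, ← hom_tr, LinearEquiv.apply_symm_apply]

variable (ω) in
/-- The functor from representations of the twisted double to the center of graded vector
spaces. -/
noncomputable def toCenter : RepCat (TwistedDouble ω) ⥤ Bop (Center (VecG ω⁻¹)) where
  obj V := V.toCenterObj
  map {V W} f := centerHom (X := V.toCenterObj) (Y := W.toCenterObj)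
    ⟨Hom.toLin f, fun _ v => Hom.comm f _ v⟩ fun k v =>
      (congrArg (Hom.toLin f) (hbEnd_toCenterObj V k v)).trans
        ((hom_tr_symm f k v).trans (hbEnd_toCenterObj W k _).symm)
  map_id _ := rfl
  map_comp _ _ := rfl

instance : (toCenter ω).Faithful where
  map_injective {V W _ _} h := by
    apply hom_ext
    exact congrArg (fun φ : Center.Hom V.toCenterObj W.toCenterObj => VecG.Hom.toLin φ.f) h

/-- By `ρ_δ`, every basis vector of the double acts through the grading and the operators `tr`. -/
theorem hom_comm_of {V W : RepCat (TwistedDouble ω)} (f : V.carrier →ₗ[ℂ] W.carrier)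
    (hg : ∀ g v, f (V.grading.proj g v) = W.grading.proj g (f v))
    (ht : ∀ x v, f (V.tr x v) = W.tr x (f v)) (h : TwistedDouble ω) (v : V.carrier) :
    f (V.ρ h v) = W.ρ h (f v) := by
  refine LinearMap.congr_fun (f := f ∘ₗ LinearMap.flip V.ρ.toLinearMap v)
    (g := LinearMap.flip W.ρ.toLinearMap (f v)) (TwistedDouble.lin_ext fun g x => ?_) h
  change f (V.ρ (δ ω g x) v) = W.ρ (δ ω g x) (f v)
  rw [ρ_δ, ρ_δ, ht, hg]

instance : (toCenter ω).Full where
  map_surjective {V W} φ := by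
    let ψ : V.toCenterObj ⟶ W.toCenterObj := φ
    refine ⟨⟨VecG.Hom.toLin ψ.f, hom_comm_of _ (VecG.Hom.comm ψ.f) fun x v => ?_⟩, rfl⟩
    -- A morphism of the center commutes with the inverses of `tr`; evaluating at `tr x v` yields
    -- commutation with `tr` itself.
    have h := hbEnd_naturality ψ x (V.tr x v)
    rw [hbEnd_toCenterObj] at h
    have h2 := h.trans (hbEnd_toCenterObj W x (VecG.Hom.toLin ψ.f (V.tr x v)))
    rw [LinearEquiv.symm_apply_apply] at h2
    exact ((LinearEquiv.eq_symm_apply (W.tr x)).1 h2).symm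

/-- The action of the basis vector `δ_g x̄` on an object of the center. -/
noncomputable def centerAct (X : Center (VecG ω⁻¹)) :
    TwistedDouble ω →ₗ[ℂ] Module.End ℂ X.1.carrier :=
  TwistedDouble.lift fun g x =>
    (hbEnd X.2 x).symm.toLinearMap ∘ₗ X.1.grading.proj (x⁻¹ * g * x)

theorem centerAct_δ (X : Center (VecG ω⁻¹)) (g x : G) (v : X.1.carrier) :
    centerAct X (δ ω g x) v = (hbEnd X.2 x).symm (X.1.grading.proj (x⁻¹ * g * x) v) := by
  rw [centerAct, TwistedDouble.lift_δ]
  rfl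

theorem proj_hbEnd_symm (X : Center (VecG ω⁻¹)) (g x : G) (v : X.1.carrier) :
    X.1.grading.proj g ((hbEnd X.2 x).symm v) =
      (hbEnd X.2 x).symm (X.1.grading.proj (x⁻¹ * g * x) v) := by
  rw [LinearEquiv.eq_symm_apply, hbEnd_proj, LinearEquiv.apply_symm_apply]

/-- The converse translation: the inverses of the half-braiding automorphisms compose by the
multiplication rule of the double. -/
theorem hbEnd_symm_symm (X : Center (VecG ω⁻¹)) (g x y : G) (v : X.1.carrier) :
    (hbEnd X.2 x).symm ((hbEnd X.2 y).symm (X.1.grading.proj ((x * y)⁻¹ * g * (x * y)) v)) =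
      (ω.θ g x y : ℂ) • (hbEnd X.2 (x * y)).symm
        (X.1.grading.proj ((x * y)⁻¹ * g * (x * y)) v) := by
  rw [← map_smul, LinearEquiv.eq_symm_apply]
  have e : (x * y)⁻¹ * g * (x * y) = y⁻¹ * (x⁻¹ * g * x) * y := by group
  rw [e, ← proj_hbEnd_symm, ← proj_hbEnd_symm, hbEnd_mul, NormalizedCocycle.inv_θ, inv_inv,
    proj_hbEnd_symm, proj_hbEnd_symm, LinearEquiv.apply_symm_apply, LinearEquiv.apply_symm_apply]

/-- The image of `δ_h ȳ` lies in degree `h`, and `δ_g x̄` sees only degree `x⁻¹gx`. If these degrees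
differ, both sides vanish; otherwise the scalar is that of `hbEnd_symm_symm`. -/
theorem centerAct_mul (X : Center (VecG ω⁻¹)) (a b : TwistedDouble ω) :
    centerAct X (a * b) = centerAct X a * centerAct X b := by
  classical
  refine LinearMap.congr_fun₂ (f := (LinearMap.mul ℂ (TwistedDouble ω)).compr₂ (centerAct X))
    (g := (LinearMap.mul ℂ (Module.End ℂ X.1.carrier)).compl₁₂ (centerAct X) (centerAct X))
    (TwistedDouble.lin_ext fun g x => TwistedDouble.lin_ext fun h y => LinearMap.ext fun v => ?_)
    a b
  change centerAct X (δ ω g x * δ ω h y) v = centerAct X (δ ω g x) (centerAct X (δ ω h y) v)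
  rw [centerAct_δ, centerAct_δ, ← proj_hbEnd_symm X h]
  by_cases e : x⁻¹ * g * x = h
  · subst e
    have e : y⁻¹ * (x⁻¹ * g * x) * y = (x * y)⁻¹ * g * (x * y) := by group
    rw [δ_mul_of_eq y rfl, map_smul, LinearMap.smul_apply, centerAct_δ, Grading.proj_self,
      proj_hbEnd_symm, e, hbEnd_symm_symm]
  · rw [δ_mul_of_ne y e, Grading.proj_ne _ _ _ _ e, map_zero, map_zero, LinearMap.zero_apply]

/-- Since `θ_g(e, e) = 1`, the automorphism for `e` is idempotent, and an idempotent automorphism is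
the identity. -/
theorem hbEnd_one (X : Center (VecG ω⁻¹)) (v : X.1.carrier) : hbEnd X.2 1 v = v := by
  refine LinearMap.congr_fun (f := (hbEnd X.2 1).toLinearMap) (g := LinearMap.id)
    (X.1.grading.lin_ext fun g v => ?_) v
  have h := hbEnd_mul X.2 1 1 g v
  rw [NormalizedCocycle.θ_one_left, inv_one, Units.val_one, one_smul, one_mul] at h
  exact ((hbEnd X.2 1).injective h).symm

/-- The representation defined by an object of the center. -/
noncomputable def ofCenterObj (X : Center (VecG ω⁻¹)) : RepCat (TwistedDouble ω) where
  carrier := X.1.carrier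
  ρ := AlgHom.ofLinearMap (centerAct X)
    (by
      refine LinearMap.ext fun v => ?_
      rw [one_eq, map_sum, LinearMap.sum_apply]
      refine Eq.trans (Finset.sum_congr rfl fun g _ => ?_) (X.1.grading.sum_proj v)
      rw [centerAct_δ, LinearEquiv.symm_apply_eq, hbEnd_one, inv_one, one_mul, mul_one])
    (centerAct_mul X)

theorem grading_ofCenterObj (X : Center (VecG ω⁻¹)) : (ofCenterObj X).grading = X.1.grading := by
  refine Grading.ext_proj fun g => LinearMap.ext fun v => ?_
  refine (centerAct_δ X g 1 v).trans ((LinearEquiv.symm_apply_eq (hbEnd X.2 1)).2 ?_)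
  refine Eq.trans ?_ (hbEnd_one X _).symm
  rw [inv_one, one_mul, mul_one]
  rfl

theorem tr_ofCenterObj (X : Center (VecG ω⁻¹)) (x : G) (v : X.1.carrier) :
    (ofCenterObj X).tr x v = (hbEnd X.2 x).symm v := by
  change centerAct X (∑ g : G, δ ω g x) v = _
  rw [map_sum, LinearMap.sum_apply]
  conv_rhs => rw [← X.1.grading.sum_proj ((hbEnd X.2 x).symm v)]
  exact Finset.sum_congr rfl fun g _ => by rw [centerAct_δ, proj_hbEnd_symm]

/-- The identity of the underlying space is the isomorphism: the representation built from `X`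
recovers its grading, and its operators `tr` are the inverses of the half-braiding automorphisms. -/
instance : (toCenter ω).EssSurj where
  mem_essImage Y := by
    let X : Center (VecG ω⁻¹) := Y
    refine ⟨ofCenterObj X, ⟨centerIso (X := (ofCenterObj X).toCenterObj) (Y := X)
      (LinearEquiv.refl ℂ X.1.carrier) (fun g v => ?_) fun k v => ?_⟩⟩
    · exact congrArg (fun p : Grading G X.1.carrier => p.proj g v) (grading_ofCenterObj X)
    · refine (hbEnd_toCenterObj (ofCenterObj X) k v).trans
        ((LinearEquiv.symm_apply_eq ((ofCenterObj X).tr k)).2 ?_)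
      exact ((tr_ofCenterObj X k _).trans (LinearEquiv.symm_apply_apply _ _)).symm

instance : (toCenter ω).IsEquivalence where

instance : (toCenter ω).Additive where
  map_add := rfl

instance : (toCenter ω).Linear ℂ where
  map_smul _ _ := rfl

/-- On degree `g` the twist of representations is `tr g`, and that of the reversed center is the
inverse of the half-braiding automorphism for `g`, which is itself the inverse of `tr g`. -/
theorem toCenter_map_twist (V : RepCat (TwistedDouble ω)) :
    (toCenter ω).map (twist V) = bopTwist ((toCenter ω).obj V) := by
  refine Center.ext (X := V.toCenterObj) (Y := V.toCenterObj) _ _ (VecG.hom_ext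
    (V.grading.lin_ext fun g v => ?_))
  refine (twist_proj V g v).trans (Eq.trans ?_ (VecG.twist_proj V.toCenterObj.2 g v).symm)
  refine Eq.symm ((LinearEquiv.symm_apply_eq _).2 ?_)
  exact ((hbEnd_toCenterObj V g _).trans (LinearEquiv.symm_apply_apply _ _)).symm

/-- The inverse of `tr k` on a tensor product carries `γ_k(a, b)⁻¹`, and the half-braiding of a
tensor product in the center carries `γ_k(a, b)` of the cocycle `ω⁻¹`; these scalars coincide. -/
theorem hbEnd_toCenterObj_tensor (V W : RepCat (TwistedDouble ω)) (k : G)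
    (t : V.carrier ⊗[ℂ] W.carrier) :
    hbEnd (V.toCenterObj ⊗ W.toCenterObj : Center (VecG ω⁻¹)).2 k t =
      hbEnd (tensor V W).toCenterObj.2 k t := by
  refine LinearMap.congr_fun
    (f := (hbEnd (V.toCenterObj ⊗ W.toCenterObj : Center (VecG ω⁻¹)).2 k).toLinearMap)
    (g := ((tensor V W).tr k).symm.toLinearMap)
    (Grading.lin_ext₂ V.grading W.grading fun a b v w => ?_) t |>.trans
    (hbEnd_toCenterObj (tensor V W) k t).symm
  refine (VecG.hbEnd_tensor V.toCenterObj W.toCenterObj k a b v w).trans ?_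
  refine ((LinearEquiv.symm_apply_eq ((tensor V W).tr k)).2 ?_).symm
  -- The degrees are conjugated back by `k`, so that the vectors after the action of `k` have the
  -- given degrees `a` and `b`.
  have h := tr_tensor V W k (k⁻¹ * a * k) (k⁻¹ * b * k) ((V.tr k).symm v) ((W.tr k).symm w)
  rw [← tr_symm_proj, ← tr_symm_proj, LinearEquiv.apply_symm_apply,
    LinearEquiv.apply_symm_apply] at h
  have e : ∀ c : G, k * (k⁻¹ * c * k) * k⁻¹ = c := fun c => by group
  rw [e, e] at h
  refine Eq.symm ((congrArg ((tensor V W).tr k) (congrArg₂ (fun x y => (ω⁻¹.γ k a b : ℂ) •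
    (x ⊗ₜ[ℂ] y)) (hbEnd_toCenterObj V k _) (hbEnd_toCenterObj W k _))).trans ?_)
  refine ((map_smul _ _ _).trans (congrArg _ h)).trans ?_
  refine (smul_smul (ω⁻¹.γ k a b : ℂ) (ω.γ k a b : ℂ)
    (V.grading.proj a v ⊗ₜ[ℂ] W.grading.proj b w)).trans ?_
  rw [NormalizedCocycle.inv_γ, Units.inv_mul, one_smul]

/-- The tensorator of `toCenter`, which is the identity on underlying spaces. -/
noncomputable def toCenterμ (V W : RepCat (TwistedDouble ω)) :
    (V.toCenterObj ⊗ W.toCenterObj : Center (VecG ω⁻¹)) ≅ (tensor V W).toCenterObj :=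
  centerIso (LinearEquiv.refl ℂ (V.carrier ⊗[ℂ] W.carrier))
    (fun g v => congrArg (fun p : Grading G (V.carrier ⊗[ℂ] W.carrier) => p.proj g v)
      (grading_tensor V W).symm) (hbEnd_toCenterObj_tensor V W)

variable (ω) in
/-- The unit constraint of `toCenter`, which is the identity of `ℂ`. -/
noncomputable def toCenterε : 𝟙_ (Center (VecG ω⁻¹)) ≅ (unit (TwistedDouble ω)).toCenterObj :=
  centerIso (LinearEquiv.refl ℂ ℂ)
    (fun g v => congrArg (fun p : Grading G ℂ => p.proj g v) grading_unit.symm) fun k c => by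
      refine (VecG.hbEnd_unit k c).trans
        (Eq.trans ?_ (hbEnd_toCenterObj (unit (TwistedDouble ω)) k c).symm)
      exact Eq.symm ((LinearEquiv.symm_apply_eq ((unit (TwistedDouble ω)).tr k)).2
        (tr_unit k c).symm)

variable (ω) in
/-- `toCenter` is strict monoidal on underlying spaces. -/
noncomputable def toCenterCore : (toCenter ω).CoreMonoidal where
  εIso := toCenterε ω
  μIso := toCenterμ
  μIso_hom_natural_left _ _ := rfl
  μIso_hom_natural_right _ _ := rfl
  associativity V W U := by
    refine Center.ext (C := VecG ω⁻¹) _ _ (VecG.hom_ext ?_)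
    -- All constraints being identities on spaces, only the equality of the two associators remains.
    change (assocLin V.ρ W.ρ U.ρ).toLinearMap ∘ₗ LinearMap.id ∘ₗ
      TensorProduct.map LinearMap.id LinearMap.id =
      (LinearMap.id ∘ₗ TensorProduct.map LinearMap.id LinearMap.id) ∘ₗ
        (Grading.assoc V.grading W.grading U.grading (ω⁻¹ : NormalizedCocycle G)).toLinearMap
    rw [assocLin_eq, TensorProduct.map_id, TensorProduct.map_id]
    rfl
  left_unitality V := by
    refine Center.ext (C := VecG ω⁻¹) _ _ (VecG.hom_ext ?_)
    change (TensorProduct.lid ℂ V.carrier).toLinearMap =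
      (TensorProduct.lid ℂ V.carrier).toLinearMap ∘ₗ LinearMap.id ∘ₗ
        TensorProduct.map LinearMap.id LinearMap.id
    rw [TensorProduct.map_id]
    rfl
  right_unitality V := by
    refine Center.ext (C := VecG ω⁻¹) _ _ (VecG.hom_ext ?_)
    change (TensorProduct.rid ℂ V.carrier).toLinearMap =
      (TensorProduct.rid ℂ V.carrier).toLinearMap ∘ₗ LinearMap.id ∘ₗ
        TensorProduct.map LinearMap.id LinearMap.id
    rw [TensorProduct.map_id]
    rfl

noncomputable instance : (toCenter ω).Monoidal := (toCenterCore ω).toMonoidal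

/-- The reversed braiding is the inverse of the half-braiding of `W` at `V`, so the claim is that
the two compose to the identity: `w ⊗ v ↦ v ⊗ g⁻¹w ↦ gg⁻¹w ⊗ v` for `v` of degree `g`. -/
noncomputable instance : (toCenter ω).Braided where
  braided V W := by
    refine (Iso.eq_inv_comp (β_ W.toCenterObj V.toCenterObj)).2 ?_
    refine Center.ext (C := VecG ω⁻¹) _ _ (VecG.hom_ext ?_)
    change ((braidLin V.ρ W.ρ).toLinearMap ∘ₗ LinearMap.id) ∘ₗ
      (hb W.toCenterObj.2 V.toVecG).toLinearMap = LinearMap.id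
    refine TensorProduct.ext (LinearMap.ext fun w => V.grading.lin_ext fun g v => ?_)
    refine (congrArg (braidLin V.ρ W.ρ) (hb_tmul W.toCenterObj.2 V.toVecG g w v)).trans ?_
    refine (braidLin_proj V W g v _).trans (congrArg (fun x => x ⊗ₜ[ℂ] V.grading.proj g v) ?_)
    exact (congrArg (W.tr g) (hbEnd_toCenterObj W g w)).trans (LinearEquiv.apply_symm_apply _ _)

end RepCat

/-! ### Duals under monoidal functors -/

namespace CategoryTheory.ExactPairing

open Functor.LaxMonoidal Functor.OplaxMonoidal

variable {C D : Type*} [Category C] [Category D] [MonoidalCategory C] [MonoidalCategory D]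

/-- The image of an exact pairing under a monoidal functor. -/
@[reducible]
def map (F : C ⥤ D) [F.Monoidal] (X X' : C) [ExactPairing X X'] :
    ExactPairing (F.obj X) (F.obj X') where
  coevaluation' := ε F ≫ F.map (η_ X X') ≫ δ F X X'
  evaluation' := μ F X' X ≫ F.map (ε_ X X') ≫ η F
  coevaluation_evaluation' := by
    have h := congrArg F.map (coevaluation_evaluation X X')
    simp only [Functor.map_comp, Functor.Monoidal.map_whiskerLeft,
      Functor.Monoidal.map_whiskerRight, Functor.Monoidal.map_associator_inv,
      Functor.Monoidal.map_rightUnitor, Functor.Monoidal.map_leftUnitor_inv, Category.assoc,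
      Functor.Monoidal.μ_δ_assoc, Functor.Monoidal.whiskerRight_μ_δ_assoc] at h
    -- Composing with the structure isomorphisms at both ends turns the goal into the image of the
    -- zigzag identity under `F`.
    rw [← cancel_epi (F.obj X' ◁ η F), ← cancel_epi (δ F X' (𝟙_ C)),
      ← cancel_mono (ε F ▷ F.obj X'), ← cancel_mono (μ F _ _)]
    simp only [MonoidalCategory.whiskerLeft_comp, comp_whiskerRight, Category.assoc,
      Functor.Monoidal.whiskerLeft_η_ε_assoc, Functor.Monoidal.whiskerRight_η_ε_assoc]
    exact h
  evaluation_coevaluation' := by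
    have h := congrArg F.map (evaluation_coevaluation X X')
    simp only [Functor.map_comp, Functor.Monoidal.map_whiskerLeft,
      Functor.Monoidal.map_whiskerRight, Functor.Monoidal.map_associator,
      Functor.Monoidal.map_leftUnitor, Functor.Monoidal.map_rightUnitor_inv, Category.assoc,
      Functor.Monoidal.μ_δ_assoc, Functor.Monoidal.whiskerLeft_μ_δ_assoc] at h
    rw [← cancel_epi (η F ▷ F.obj X), ← cancel_epi (δ F (𝟙_ C) X),
      ← cancel_mono (F.obj X ◁ ε F), ← cancel_mono (μ F _ _)]
    simp only [MonoidalCategory.whiskerLeft_comp, comp_whiskerRight, Category.assoc,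
      Functor.Monoidal.whiskerLeft_η_ε_assoc, Functor.Monoidal.whiskerRight_η_ε_assoc]
    exact h

end CategoryTheory.ExactPairing

/-! ### Naturality of the morphism that defines the entries of `S` -/

section Naturality

variable {C : Type*} [Category C] [MonoidalCategory C] [BraidedCategory C]

/-- The double braiding of the two middle factors of `(X ⊗ X') ⊗ (Y ⊗ Y')`. -/
def middleBraiding (X X' Y Y' : C) : (X ⊗ X') ⊗ (Y ⊗ Y') ⟶ (X ⊗ X') ⊗ (Y ⊗ Y') :=
  (α_ X X' (Y ⊗ Y')).hom ≫ X ◁ (α_ X' Y Y').inv ≫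
    X ◁ (((β_ X' Y).hom ≫ (β_ Y X').hom) ▷ Y') ≫ X ◁ (α_ X' Y Y').hom ≫ (α_ X X' (Y ⊗ Y')).inv

theorem sMorphism_eq (θ : ∀ X : C, X ⟶ X) (X X' Y Y' : C) [ExactPairing X X']
    [ExactPairing Y Y'] : sMorphism θ X X' Y Y' = (λ_ (𝟙_ C)).inv ≫ (η_ X X' ⊗ₘ η_ Y Y') ≫
      middleBraiding X X' Y Y' ≫ (twistedEv θ X X' ⊗ₘ twistedEv θ Y Y') ≫ (λ_ (𝟙_ C)).hom := by
  simp only [sMorphism, middleBraiding, Category.assoc]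

theorem tensorHom_whiskerLeft_eq {X₁ X₂ A₁ A₂ B₁ B₂ : C} (f : X₁ ⟶ X₂) {a : A₁ ⟶ A₂}
    {b : B₁ ⟶ B₂} {s₁ : A₁ ⟶ B₁} {s₂ : A₂ ⟶ B₂} (h : a ≫ s₂ = s₁ ≫ b) :
    (f ⊗ₘ a) ≫ X₂ ◁ s₂ = X₁ ◁ s₁ ≫ (f ⊗ₘ b) := by
  rw [← id_tensorHom, ← id_tensorHom, tensorHom_comp_tensorHom, tensorHom_comp_tensorHom, h,
    Category.comp_id, Category.id_comp]

theorem tensorHom_whiskerRight_eq {X₁ X₂ A₁ A₂ B₁ B₂ : C} (f : X₁ ⟶ X₂) {a : A₁ ⟶ A₂}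
    {b : B₁ ⟶ B₂} {s₁ : A₁ ⟶ B₁} {s₂ : A₂ ⟶ B₂} (h : a ≫ s₂ = s₁ ≫ b) :
    (a ⊗ₘ f) ≫ s₂ ▷ X₂ = s₁ ▷ X₁ ≫ (b ⊗ₘ f) := by
  rw [← tensorHom_id, ← tensorHom_id, tensorHom_comp_tensorHom, tensorHom_comp_tensorHom, h,
    Category.comp_id, Category.id_comp]

theorem middleBraiding_naturality {X₁ X₁' Y₁ Y₁' X₂ X₂' Y₂ Y₂' : C} (f : X₁ ⟶ X₂)
    (f' : X₁' ⟶ X₂') (g : Y₁ ⟶ Y₂) (g' : Y₁' ⟶ Y₂') :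
    ((f ⊗ₘ f') ⊗ₘ (g ⊗ₘ g')) ≫ middleBraiding X₂ X₂' Y₂ Y₂' =
      middleBraiding X₁ X₁' Y₁ Y₁' ≫ ((f ⊗ₘ f') ⊗ₘ (g ⊗ₘ g')) := by
  have hb : (f' ⊗ₘ g) ≫ (β_ X₂' Y₂).hom ≫ (β_ Y₂ X₂').hom =
      ((β_ X₁' Y₁).hom ≫ (β_ Y₁ X₁').hom) ≫ (f' ⊗ₘ g) := by
    rw [BraidedCategory.braiding_naturality_assoc, BraidedCategory.braiding_naturality,
      Category.assoc]
  have h2 := tensorHom_whiskerLeft_eq f (associator_inv_naturality f' g g')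
  have h3 := tensorHom_whiskerLeft_eq f (tensorHom_whiskerRight_eq g' hb)
  have h4 := tensorHom_whiskerLeft_eq f (associator_naturality f' g g')
  simp only [middleBraiding, Category.assoc]
  rw [associator_naturality_assoc, reassoc_of% h2, reassoc_of% h3, reassoc_of% h4,
    associator_inv_naturality]

variable {D : Type*} [Category D] [MonoidalCategory D] [BraidedCategory D]

open Functor.LaxMonoidal Functor.OplaxMonoidal

theorem map_middleBraiding (F : C ⥤ D) [F.Braided] (X X' Y Y' : C) :
    F.map (middleBraiding X X' Y Y') = δ F _ _ ≫ (δ F X X' ⊗ₘ δ F Y Y') ≫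
      middleBraiding (F.obj X) (F.obj X') (F.obj Y) (F.obj Y') ≫ (μ F X X' ⊗ₘ μ F Y Y') ≫
        μ F _ _ := by
  have h : ∀ (A B Z W : C) {T : D} (f : F.obj A ⊗ (F.obj Z ⊗ F.obj W) ⊗ F.obj B ⟶ T),
      F.obj A ◁ μ F Z W ▷ F.obj B ≫ F.obj A ◁ δ F Z W ▷ F.obj B ≫ f = f := by
    intro A B Z W T f
    rw [← MonoidalCategory.whiskerLeft_comp_assoc, Functor.Monoidal.whiskerRight_μ_δ,
      MonoidalCategory.whiskerLeft_id, Category.id_comp]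
  simp only [middleBraiding, Functor.map_comp, Functor.Monoidal.map_whiskerLeft,
    Functor.Monoidal.map_whiskerRight, Functor.Monoidal.map_associator,
    Functor.Monoidal.map_associator_inv, Functor.map_braiding, Category.assoc,
    Functor.Monoidal.μ_δ_assoc, MonoidalCategory.whiskerLeft_comp,
    Functor.Monoidal.whiskerLeft_μ_δ_assoc, comp_whiskerRight, h]
  -- Splitting the tensor products of constraints lets the parts belonging to `Y` and `Y'` slide
  -- past the outer associators.
  rw [MonoidalCategory.tensorHom_def (δ F X X'), MonoidalCategory.tensorHom_def' (μ F X X')]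
  simp only [Category.assoc, associator_naturality_right_assoc,
    associator_inv_naturality_right_assoc]

theorem tensorHom_η_comp_leftUnitor (F : C ⥤ D) [F.Monoidal] :
    (η F ⊗ₘ η F) ≫ (λ_ (𝟙_ D)).hom = μ F (𝟙_ C) (𝟙_ C) ≫ F.map (λ_ (𝟙_ C)).hom ≫ η F := by
  rw [Functor.Monoidal.map_leftUnitor, MonoidalCategory.tensorHom_def, Category.assoc,
    Category.assoc, Category.assoc, Functor.Monoidal.μ_δ_assoc, leftUnitor_naturality]

theorem leftUnitor_inv_comp_tensorHom_ε (F : C ⥤ D) [F.Monoidal] :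
    (λ_ (𝟙_ D)).inv ≫ (ε F ⊗ₘ ε F) = ε F ≫ F.map (λ_ (𝟙_ C)).inv ≫ δ F (𝟙_ C) (𝟙_ C) := by
  rw [Functor.Monoidal.map_leftUnitor_inv, MonoidalCategory.tensorHom_def', Category.assoc,
    Category.assoc, Functor.Monoidal.μ_δ, leftUnitor_inv_naturality_assoc, Category.comp_id]

theorem map_twistedEv (F : C ⥤ D) [F.Braided] {θ : ∀ X : C, X ⟶ X} {θ' : ∀ X : D, X ⟶ X}
    (h : ∀ X, F.map (θ X) = θ' (F.obj X)) (X X' : C) [ExactPairing X X'] :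
    @twistedEv D _ _ _ θ' (F.obj X) (F.obj X') (ExactPairing.map F X X') =
      μ F X X' ≫ F.map (twistedEv θ X X') ≫ η F := by
  simp only [twistedEv, Functor.map_comp, Functor.Monoidal.map_whiskerRight, Functor.map_braiding,
    Category.assoc, Functor.Monoidal.μ_δ_assoc, h]
  rfl

theorem sMorphism_map (F : C ⥤ D) [F.Braided] {θ : ∀ X : C, X ⟶ X} {θ' : ∀ X : D, X ⟶ X}
    (h : ∀ X, F.map (θ X) = θ' (F.obj X)) (X X' Y Y' : C) [ExactPairing X X']
    [ExactPairing Y Y'] : @sMorphism D _ _ _ θ' (F.obj X) (F.obj X') (F.obj Y) (F.obj Y')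
      (ExactPairing.map F X X') (ExactPairing.map F Y Y') =
      ε F ≫ F.map (sMorphism θ X X' Y Y') ≫ η F := by
  have e : ∀ Z Z' : C, ∀ p : ExactPairing Z Z', @ExactPairing.coevaluation _ _ _ (F.obj Z)
      (F.obj Z') (ExactPairing.map F Z Z') = ε F ≫ F.map (η_ Z Z') ≫ δ F Z Z' := fun _ _ _ => rfl
  rw [sMorphism_eq, sMorphism_eq, map_twistedEv F h, map_twistedEv F h, e, e]
  simp only [Functor.map_comp, map_middleBraiding, Functor.Monoidal.map_tensor, Category.assoc,
    Functor.Monoidal.μ_δ_assoc, ← tensorHom_comp_tensorHom]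
  rw [tensorHom_η_comp_leftUnitor, reassoc_of% (leftUnitor_inv_comp_tensorHom_ε F)]

/-- An isomorphism of objects extends to compatible isomorphisms of their duals. -/
theorem ExactPairing.exists_iso_compatible {X₁ X₂ X₁' X₂' : C} (p₁ : ExactPairing X₁ X₁')
    (p₂ : ExactPairing X₂ X₂') (i : X₁ ≅ X₂) : ∃ k : X₁' ≅ X₂',
      η_ X₁ X₁' ≫ (i.hom ⊗ₘ k.hom) = η_ X₂ X₂' ∧ (k.hom ⊗ₘ i.hom) ≫ ε_ X₂ X₂' = ε_ X₁ X₁' := by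
  -- Transporting `p₂` along `i` makes `X₂'` a second dual of `X₁`, so uniqueness of duals applies.
  obtain ⟨k, h1, h2⟩ := ExactPairing.exists_iso_right p₁
    (@exactPairingCongrLeft _ _ _ _ _ _ p₂ i)
  have h1' : η_ X₁ X₁' ≫ X₁ ◁ k.hom = η_ X₂ X₂' ≫ i.inv ▷ X₂' := h1
  have h2' : k.inv ▷ X₁ ≫ ε_ X₁ X₁' = X₂' ◁ i.hom ≫ ε_ X₂ X₂' := h2
  refine ⟨k, ?_, ?_⟩
  · rw [MonoidalCategory.tensorHom_def', reassoc_of% h1', ← comp_whiskerRight, i.inv_hom_id,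
      id_whiskerRight, Category.comp_id]
  · rw [MonoidalCategory.tensorHom_def, Category.assoc, ← h2', ← comp_whiskerRight_assoc,
      k.hom_inv_id, id_whiskerRight, Category.id_comp]

/-- The coevaluations and twisted evaluations match under compatible isomorphisms of the objects and
their duals, and the double braiding between them is natural. With identity isomorphisms this is
independence of the choice of duals. -/
theorem sMorphism_congr {θ : ∀ X : C, X ⟶ X} (hθ : ∀ {X Y : C} (f : X ⟶ Y), f ≫ θ Y = θ X ≫ f)
    {X₁ X₁' Y₁ Y₁' X₂ X₂' Y₂ Y₂' : C} (p₁ : ExactPairing X₁ X₁') (q₁ : ExactPairing Y₁ Y₁')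
    (p₂ : ExactPairing X₂ X₂') (q₂ : ExactPairing Y₂ Y₂') (i : X₁ ≅ X₂) (j : Y₁ ≅ Y₂) :
    sMorphism θ X₁ X₁' Y₁ Y₁' = sMorphism θ X₂ X₂' Y₂ Y₂' := by
  -- Naturality of the twist and of the braiding reduces the twisted evaluation to the plain one.
  have key : ∀ {Z₁ Z₁' Z₂ Z₂' : C} (_ : ExactPairing Z₁ Z₁') (_ : ExactPairing Z₂ Z₂')
      (u : Z₁ ≅ Z₂) (w : Z₁' ≅ Z₂'), (w.hom ⊗ₘ u.hom) ≫ ε_ Z₂ Z₂' = ε_ Z₁ Z₁' →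
      (u.hom ⊗ₘ w.hom) ≫ twistedEv θ Z₂ Z₂' = twistedEv θ Z₁ Z₁' := by
    intro Z₁ Z₁' Z₂ Z₂' _ _ u w h
    rw [twistedEv, twistedEv, reassoc_of% (tensorHom_whiskerRight_eq w.hom (hθ u.hom)),
      BraidedCategory.braiding_naturality_assoc, h]
  obtain ⟨k, h1, h2⟩ := ExactPairing.exists_iso_compatible p₁ p₂ i
  obtain ⟨l, h3, h4⟩ := ExactPairing.exists_iso_compatible q₁ q₂ j
  rw [sMorphism_eq, sMorphism_eq, ← h1, ← h3, ← key p₁ p₂ i k h2, ← key q₁ q₂ j l h4,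
    ← tensorHom_comp_tensorHom, ← tensorHom_comp_tensorHom, Category.assoc, Category.assoc,
    reassoc_of% (middleBraiding_naturality i.hom k.hom j.hom l.hom)]

end Naturality

/-! ### Scalars of endomorphisms and classes of simple objects -/

section Scalars

variable {C : Type*} [Category C] [Preadditive C] [Linear ℂ C]
variable {D : Type*} [Category D] [Preadditive D] [Linear ℂ D]

/-- The value is a choice made from the set of admissible scalars. It depends on that set only, so
equal sets give equal values even when the scalar is not unique. -/
theorem endScalar_congr {X : C} {Y : D} {f : X ⟶ X} {g : Y ⟶ Y}
    (h : ∀ c : ℂ, f = c • 𝟙 X ↔ g = c • 𝟙 Y) : endScalar f = endScalar g := by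
  have key : ∀ P Q : ℂ → Prop, P = Q → ∀ (_ : Decidable (∃ c, P c)) (_ : Decidable (∃ c, Q c)),
      (if h : ∃ c, P c then h.choose else 0) = (if h : ∃ c, Q c then h.choose else 0) := by
    rintro P _ rfl _ _
    congr
  exact key _ _ (funext fun c => propext (h c)) _ _

theorem endScalar_iso {X Y : C} (i : X ≅ Y) {f : X ⟶ X} {g : Y ⟶ Y} (h : i.hom ≫ g = f ≫ i.hom) :
    endScalar f = endScalar g := by
  refine endScalar_congr fun c => ?_
  rw [← cancel_mono i.hom, ← h, ← cancel_epi i.hom (g := g)]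
  simp

theorem endScalar_map (F : C ⥤ D) [F.Faithful] [F.Additive] [F.Linear ℂ] {X : C} (f : X ⟶ X) :
    endScalar (F.map f) = endScalar f := by
  refine endScalar_congr fun c => ?_
  rw [← F.map_id, ← F.map_smul]
  exact F.map_injective.eq_iff

/-- An equivalence of categories induces a bijection of the classes of simple objects. -/
noncomputable def SimpleClass.equiv (F : C ⥤ D) [F.IsEquivalence] :
    SimpleClass C ≃ SimpleClass D :=
  Equiv.ofBijective
    (Quotient.map (fun X => ⟨F.obj X.1, @simple_obj _ _ _ _ _ _ F _ X.1 X.2⟩)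
      fun _ _ ⟨i⟩ => ⟨F.mapIso i⟩)
    ⟨by
      rintro ⟨X⟩ ⟨Y⟩ h
      obtain ⟨i⟩ := Quotient.exact h
      exact Quotient.sound ⟨F.preimageIso i⟩, by
      rintro ⟨Y⟩
      have := Y.2
      have i := F.objObjPreimageIso Y.1
      have : Simple (F.obj (F.objPreimage Y.1)) := Simple.of_iso i
      exact ⟨Quotient.mk _ ⟨F.objPreimage Y.1, (simple_obj_iff F _).1 this⟩, Quotient.sound ⟨i⟩⟩⟩

/-- Representatives are chosen separately in the two categories, so they correspond only up to
isomorphism; this is why the entries must be invariant under isomorphism. -/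
theorem SimpleClass.equiv_rep (F : C ⥤ D) [F.IsEquivalence] (i : SimpleClass C) :
    Nonempty (F.obj i.rep ≅ (SimpleClass.equiv F i).rep) := by
  have h : SimpleClass.equiv F (Quotient.mk _ (Quotient.out i)) =
      Quotient.mk _ (Quotient.out (SimpleClass.equiv F i)) :=
    (congrArg (SimpleClass.equiv F) (Quotient.out_eq i)).trans (Quotient.out_eq _).symm
  exact Quotient.exact h

end Scalars

/-! ### Invariance of the `S`- and `T`-matrices under equivalences -/

section Modular

variable {C : Type*} [Category C] [Preadditive C] [Linear ℂ C] [MonoidalCategory C]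
  [BraidedCategory C]
variable {D : Type*} [Category D] [Preadditive D] [Linear ℂ D] [MonoidalCategory D]
  [BraidedCategory D]

/-- The definition chooses duals arbitrarily; by `sMorphism_congr` an entry may be computed with any
duals, and on any isomorphic objects. -/
theorem sEntry_eq {θ : ∀ X : C, X ⟶ X} (hθ : ∀ {X Y : C} (f : X ⟶ Y), f ≫ θ Y = θ X ≫ f)
    {X₁ X₂ Y₁ Y₂ : C} (X' Y' : C) (p : ExactPairing X₂ X') (q : ExactPairing Y₂ Y')
    (i : X₁ ≅ X₂) (j : Y₁ ≅ Y₂) :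
    sEntry θ X₁ Y₁ = endScalar (sMorphism θ X₂ X' Y₂ Y') := by
  have h : (∃ X' : C, Nonempty (ExactPairing X₁ X')) ∧ ∃ Y' : C, Nonempty (ExactPairing Y₁ Y') :=
    ⟨⟨X', ⟨exactPairingCongrLeft i⟩⟩, ⟨Y', ⟨exactPairingCongrLeft j⟩⟩⟩
  rw [sEntry, dif_pos h, sMorphism_congr hθ _ _ p q i j]

open Functor.LaxMonoidal Functor.OplaxMonoidal

theorem sMatrix_equiv (F : C ⥤ D) [F.Braided] [F.IsEquivalence] [F.Additive] [F.Linear ℂ]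
    {θ : ∀ X : C, X ⟶ X} {θ' : ∀ X : D, X ⟶ X}
    (hθ : ∀ {X Y : C} (f : X ⟶ Y), f ≫ θ Y = θ X ≫ f)
    (hθ' : ∀ {X Y : D} (f : X ⟶ Y), f ≫ θ' Y = θ' X ≫ f) (h : ∀ X, F.map (θ X) = θ' (F.obj X))
    (hC : ∀ X : C, ∃ Y : C, Nonempty (ExactPairing X Y)) (d : ℂ) (i j : SimpleClass C) :
    sMatrix θ' d (SimpleClass.equiv F i) (SimpleClass.equiv F j) = sMatrix θ d i j := by
  obtain ⟨u⟩ := SimpleClass.equiv_rep F i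
  obtain ⟨w⟩ := SimpleClass.equiv_rep F j
  obtain ⟨X', ⟨p⟩⟩ := hC i.rep
  obtain ⟨Y', ⟨q⟩⟩ := hC j.rep
  rw [sMatrix, sMatrix, sEntry_eq hθ X' Y' p q (Iso.refl _) (Iso.refl _),
    sEntry_eq hθ' (F.obj X') (F.obj Y') (ExactPairing.map F _ _) (ExactPairing.map F _ _) u.symm
      w.symm, sMorphism_map F h]
  congr 1
  -- What remains are endomorphisms of the two unit objects, conjugate under the unit isomorphism of
  -- `F`.
  rw [← endScalar_map F]
  refine endScalar_iso (Functor.Monoidal.εIso F) ?_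
  simp

end Modular

theorem tMatrix_equiv {C D : Type*} [Category C] [Preadditive C] [Linear ℂ C] [Category D]
    [Preadditive D] [Linear ℂ D] (F : C ⥤ D) [F.IsEquivalence] [F.Additive] [F.Linear ℂ]
    {θ : ∀ X : C, X ⟶ X} {θ' : ∀ X : D, X ⟶ X}
    (hθ' : ∀ {X Y : D} (f : X ⟶ Y), f ≫ θ' Y = θ' X ≫ f) (h : ∀ X, F.map (θ X) = θ' (F.obj X))
    (i j : SimpleClass C) :
    tMatrix θ' (SimpleClass.equiv F i) (SimpleClass.equiv F j) = tMatrix θ i j := by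
  classical
  obtain ⟨u⟩ := SimpleClass.equiv_rep F i
  rw [tMatrix, tMatrix, Matrix.diagonal_apply, Matrix.diagonal_apply]
  by_cases e : i = j
  · rw [if_pos e, if_pos (congrArg _ e), ← endScalar_map F, h]
    exact (endScalar_iso u (hθ' u.hom)).symm
  · rw [if_neg e, if_neg fun e' => e ((SimpleClass.equiv F).injective e')]

/-! ### Transport of the ribbon fusion axioms along an equivalence -/

namespace IsRibbonFusion

open Limits Functor.LaxMonoidal Functor.OplaxMonoidal

variable {C : Type*} [Category C] [Preadditive C] [Linear ℂ C] [MonoidalCategory C]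
  [BraidedCategory C]
variable {D : Type*} [Category D] [Preadditive D] [Linear ℂ D] [MonoidalCategory D]
  [BraidedCategory D]

/-- Every map involved is natural. This reduces the tensor axiom of the twist to objects in the
image of the functor. -/
theorem twist_tensor_of_iso {θ : ∀ X : C, X ⟶ X}
    (hθ : ∀ {X Y : C} (f : X ⟶ Y), f ≫ θ Y = θ X ≫ f) {X₁ Y₁ X₂ Y₂ : C} (i : X₁ ≅ X₂)
    (j : Y₁ ≅ Y₂) (h : θ (X₁ ⊗ Y₁) = (β_ X₁ Y₁).hom ≫ (β_ Y₁ X₁).hom ≫ (θ X₁ ⊗ₘ θ Y₁)) :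
    θ (X₂ ⊗ Y₂) = (β_ X₂ Y₂).hom ≫ (β_ Y₂ X₂).hom ≫ (θ X₂ ⊗ₘ θ Y₂) := by
  rw [← cancel_epi (i.hom ⊗ₘ j.hom), hθ, h, BraidedCategory.braiding_naturality_assoc,
    BraidedCategory.braiding_naturality_assoc, tensorHom_comp_tensorHom, hθ, hθ,
    ← tensorHom_comp_tensorHom, Category.assoc, Category.assoc]

/-- A ribbon fusion structure is transported along a linear braided equivalence that respects the
twists. -/
theorem transfer (F : C ⥤ D) [F.Braided] [F.IsEquivalence] [F.Additive] [F.Linear ℂ]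
    {θ : ∀ X : C, X ⟶ X} {θ' : ∀ X : D, X ⟶ X} (H : IsRibbonFusion θ) [MonoidalPreadditive D]
    [MonoidalLinear ℂ D] (hθ' : ∀ {X Y : D} (f : X ⟶ Y), f ≫ θ' Y = θ' X ≫ f)
    (h : ∀ X, F.map (θ X) = θ' (F.obj X)) : IsRibbonFusion θ' := by
  have := H.hasFiniteProducts
  have := H.hasKernels
  have := H.hasCokernels
  have := H.normalMono
  have := H.normalEpi
  -- The conditions on products, kernels, cokernels and normality are together the property of being
  -- abelian, which passes along equivalences.
  let _ : Abelian C := {}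
  have hD : HasFiniteProducts D :=
    ⟨fun n => Adjunction.hasLimitsOfShape_of_equivalence F.inv⟩
  let _ : Abelian D := abelianOfEquivalence F.inv
  have simple_pre : ∀ X : D, Simple X → Simple (F.objPreimage X) := fun X hX => by
    have : Simple (F.obj (F.objPreimage X)) := Simple.of_iso (F.objObjPreimageIso X)
    exact (simple_obj_iff F _).1 this
  refine
    { monoidalPreadditive := inferInstance
      monoidalLinear := inferInstance
      hasFiniteProducts := hD
      hasKernels := inferInstance
      hasCokernels := inferInstance
      normalMono := inferInstance
      normalEpi := inferInstance
      finite_hom := fun X Y => ?_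
      end_simple := fun X hX f => ?_
      semisimple := fun X => ?_
      finite_simple := ?_
      simple_unit := ?_
      exists_right_dual := fun X => ?_
      exists_left_dual := fun X => ?_
      twist_naturality := hθ'
      twist_isIso := fun X => ?_
      twist_tensor := fun X Y => ?_
      twist_dual := fun X Y p => ?_ }
  · have := H.finite_hom (F.objPreimage X) (F.objPreimage Y)
    let i := F.objObjPreimageIso X
    let j := F.objObjPreimageIso Y
    -- Morphisms `X ⟶ Y` are, up to isomorphisms of source and target, images under the full functor
    -- `F`; this makes a finite-dimensional space surject onto them.
    refine Module.Finite.of_surjective ((Linear.leftComp ℂ Y i.inv ∘ₗ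
      Linear.rightComp ℂ _ j.hom) ∘ₗ F.mapLinearMap ℂ (X := F.objPreimage X)
        (Y := F.objPreimage Y)) fun f => ?_
    obtain ⟨g, hg⟩ := F.map_surjective (i.hom ≫ f ≫ j.inv)
    refine ⟨g, ?_⟩
    simp [hg]
  · let i := F.objObjPreimageIso X
    obtain ⟨g, hg⟩ := F.map_surjective (i.hom ≫ f ≫ i.inv)
    obtain ⟨c, hc⟩ := H.end_simple _ (simple_pre X hX) g
    refine ⟨c, ?_⟩
    rw [← cancel_epi i.hom, ← cancel_mono i.inv, Category.assoc, ← hg, hc]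
    simp
  · obtain ⟨n, S, b, hS, ⟨hb⟩, ⟨i⟩⟩ := H.semisimple (F.objPreimage X)
    refine ⟨n, F.obj ∘ S, F.mapBicone b, fun k => ?_, ⟨isBilimitOfPreserves F hb⟩,
      ⟨F.mapIso i ≪≫ F.objObjPreimageIso X⟩⟩
    have := hS k
    exact simple_obj F (S k)
  · have := H.finite_simple
    exact Finite.of_equiv _ (SimpleClass.equiv F)
  · have := H.simple_unit
    have := simple_obj F (𝟙_ C)
    exact Simple.of_iso (Functor.Monoidal.εIso F)
  · obtain ⟨Y, ⟨p⟩⟩ := H.exists_right_dual (F.objPreimage X)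
    have := ExactPairing.map F (F.objPreimage X) Y
    exact ⟨F.obj Y, ⟨exactPairingCongrLeft (F.objObjPreimageIso X).symm⟩⟩
  · obtain ⟨Y, ⟨p⟩⟩ := H.exists_left_dual (F.objPreimage X)
    have := ExactPairing.map F Y (F.objPreimage X)
    exact ⟨F.obj Y, ⟨exactPairingCongrRight (F.objObjPreimageIso X).symm⟩⟩
  · let i := F.objObjPreimageIso X
    have := H.twist_isIso (F.objPreimage X)
    have e : θ' X = i.inv ≫ F.map (θ (F.objPreimage X)) ≫ i.hom := by
      rw [h, ← hθ', Iso.inv_hom_id_assoc]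
    rw [e]
    infer_instance
  · refine twist_tensor_of_iso hθ' (F.objObjPreimageIso X) (F.objObjPreimageIso Y) ?_
    -- On the image of `F`, naturality moves the twist across the tensor constraint, where it
    -- becomes the image of the twist of a tensor product in `C`.
    rw [← cancel_mono (μ F _ _), ← hθ', ← h, H.twist_tensor]
    simp [Functor.Monoidal.map_tensor, h]
  · obtain ⟨Z, ⟨q⟩⟩ := H.exists_right_dual (F.objPreimage X)
    let pF := ExactPairing.map F (F.objPreimage X) Z
    -- The given dual pair is compared with the image of a dual pair in `C`, for which the axiom is
    -- the image of the one in `C`; naturality of the twist does the rest.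
    obtain ⟨k, hk, -⟩ := ExactPairing.exists_iso_compatible pF p (F.objObjPreimageIso X)
    have e : η_ (F.obj (F.objPreimage X)) (F.obj Z) =
      ε F ≫ F.map (η_ (F.objPreimage X) Z) ≫ δ F _ _ := rfl
    have hF : η_ (F.obj (F.objPreimage X)) (F.obj Z) ≫ θ' (F.obj (F.objPreimage X)) ▷ F.obj Z =
        η_ (F.obj (F.objPreimage X)) (F.obj Z) ≫ F.obj (F.objPreimage X) ◁ θ' (F.obj Z) := by
      rw [e, ← h, ← h, Category.assoc, Category.assoc, Category.assoc, Category.assoc,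
        δ_natural_left, δ_natural_right, ← F.map_comp_assoc, H.twist_dual, F.map_comp_assoc]
    rw [← hk, Category.assoc, Category.assoc, tensorHom_whiskerRight_eq k.hom (hθ' _),
      tensorHom_whiskerLeft_eq _ (hθ' k.hom), reassoc_of% hF]

end IsRibbonFusion

/-! ### Bilinearity in the center, and the conclusion -/

namespace CenterLinear

variable {C : Type*} [Category C] [Preadditive C] [Linear ℂ C] [MonoidalCategory C]
  [MonoidalPreadditive C] [MonoidalLinear ℂ C]

instance : MonoidalPreadditive (Center C) where
  whiskerLeft_zero {X _ _} := Center.ext _ _ (MonoidalPreadditive.whiskerLeft_zero (X := X.1))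
  zero_whiskerRight {X _ _} := Center.ext _ _ (MonoidalPreadditive.zero_whiskerRight (X := X.1))
  whiskerLeft_add f g := Center.ext _ _ (MonoidalPreadditive.whiskerLeft_add f.f g.f)
  add_whiskerRight f g := Center.ext _ _ (MonoidalPreadditive.add_whiskerRight f.f g.f)

instance : MonoidalLinear ℂ (Center C) where
  whiskerLeft_smul X _ _ r f := Center.ext _ _ (MonoidalLinear.whiskerLeft_smul X.1 r f.f)
  smul_whiskerRight r _ _ f X := Center.ext _ _ (MonoidalLinear.smul_whiskerRight r f.f X.1)

end CenterLinear

namespace Bop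

variable (C : Type*) [Category C] [Preadditive C] [MonoidalCategory C]

instance [MonoidalPreadditive C] : MonoidalPreadditive (Bop C) :=
  inferInstanceAs (MonoidalPreadditive C)

instance [Linear ℂ C] [MonoidalPreadditive C] [MonoidalLinear ℂ C] : MonoidalLinear ℂ (Bop C) :=
  inferInstanceAs (MonoidalLinear ℂ C)

end Bop

/-- On degree `g` the twist is the inverse of the half-braiding automorphism for `g`, and morphisms
of the center preserve degrees and commute with these automorphisms. -/
theorem bopTwist_naturality {G : Type*} [Group G] [Fintype G] {α : NormalizedCocycle G}
    {X Y : Bop (Center (VecG α))} (f : X ⟶ Y) : f ≫ bopTwist Y = bopTwist X ≫ f := by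
  let X' : Center (VecG α) := X
  let Y' : Center (VecG α) := Y
  let f' : X' ⟶ Y' := f
  refine Center.ext (C := VecG α) _ _ (VecG.hom_ext (X'.1.grading.lin_ext fun g v => ?_))
  change VecG.Hom.toLin (VecG.twist Y'.2) (VecG.Hom.toLin f'.f (X'.1.grading.proj g v)) =
    VecG.Hom.toLin f'.f (VecG.Hom.toLin (VecG.twist X'.2) (X'.1.grading.proj g v))
  rw [VecG.twist_proj, VecG.Hom.comm, VecG.twist_proj, ← VecG.Hom.comm]
  refine (LinearEquiv.symm_apply_eq (VecG.hbEnd Y'.2 g)).2 ?_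
  refine Eq.trans ?_ (VecG.hbEnd_naturality f' g _)
  rw [LinearEquiv.apply_symm_apply]

theorem mainTheorem2 {G : Type*} [Group G] [Fintype G] (ω : NormalizedCocycle G)
    (hω : ω.IsUnitary) :
    IsRibbonFusion (RepCat.twist (H := TwistedDouble ω)) ∧
    IsRibbonFusion (bopTwist (α := ω⁻¹)) ∧
    (∃ F : RepCat (TwistedDouble ω) ⥤ Bop (Center (VecG ω⁻¹)),
      Nonempty F.Braided ∧ F.IsEquivalence ∧ F.Additive ∧ F.Linear ℂ ∧
        ∀ V, F.map (RepCat.twist V) = bopTwist (F.obj V)) ∧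
    ∃ e : SimpleClass (RepCat (TwistedDouble ω)) ≃ SimpleClass (Bop (Center (VecG ω⁻¹))),
      (∀ i j, sMatrix bopTwist (Fintype.card G) (e i) (e j) =
        sMatrix RepCat.twist (Fintype.card G) i j) ∧
      ∀ i j, tMatrix bopTwist (e i) (e j) = tMatrix RepCat.twist i j :=
  have hR := RepCat.isRibbonFusion (ω := ω)
  have hF := RepCat.toCenter_map_twist (ω := ω)
  ⟨hR, hR.transfer (RepCat.toCenter ω) bopTwist_naturality hF,
    ⟨RepCat.toCenter ω, ⟨inferInstance⟩, inferInstance, inferInstance, inferInstance, hF⟩,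
    SimpleClass.equiv (RepCat.toCenter ω),
    sMatrix_equiv (RepCat.toCenter ω) hR.twist_naturality bopTwist_naturality hF
      hR.exists_right_dual _,
    tMatrix_equiv (RepCat.toCenter ω) bopTwist_naturality hF⟩
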